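/- Let $K$ be a field of characteristic $p>0$. For a tuple $\Xi=(S_n,R_n\mid n\ge 0)$ of positive integers let $R(\Xi)$ be the divided power algebra over $K$ with basis the monomials $\prod_{n} x_n^{(\alpha_n)}y_n^{(\beta_n)}z_n^{(\gamma_n)}$ (finitely many nonzero exponents, $0\le\alpha_n<p^{S_n}$, $0\le\beta_n,\gamma_n<p^{R_n}$) and product $t^{(i)}t^{(j)}=\binom{i+j}{i}t^{(i+j)}$ in each variable, with derivations $\partial_t(t^{(i)})=t^{(i-1)}$. Define $v_i,w_i,u_i\in\operatorname{Der}R(\Xi)$, $i\ge 0$, recursively by $$v_i=\partial_{x_i}+x_i^{(p^{S_i}-1)}y_i^{(p^{R_i}-1)}v_{i+1},\quad w_i=\partial_{y_i}+y_i^{(p^{R_i}-1)}x_i^{(p^{S_i}-1)}w_{i+1},\quad u_i=\partial_{z_i}+z_i^{(p^{R_i}-1)}x_i^{(p^{S_i}-1)}u_{i+1}.$$ The clover restricted Lie algebra $\mathbf T(\Xi)=\mathrm{Lie}_p(v_0,w_0,u_0)$ is the smallest Lie subalgebra of $\operatorname{Der}R(\Xi)$ that contains $v_0,w_0,u_0$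 and is closed under $D\mapsto D^p$. With $X=\{v_0,w_0,u_0\}$, its growth function is $$\gamma(n)=\dim_K\big\langle[a_1,[a_2,\dots,a_s]]^{p^k}\;\big|\;a_j\in X,\ s\ge1,\ k\ge0,\ sp^k\le n\big\rangle_K .$$ Write $f\preccurlyeq g$ if there are positive integers $N,C$ with $f(n)\le g(Cn)$ for all $n\ge N$; $\ln^{(q)}$ and $\exp^{(q)}$ denote $q$-fold iterates. Put $$\mathrm{GKdim}=\limsup_n\frac{\ln\gamma(n)}{\ln n},\qquad \underline{\mathrm{GKdim}}=\liminf_n\frac{\ln\gamma(n)}{\ln n},$$ $$\mathrm{Ldim}^q=\inf\{\beta>0\mid\gamma(m)\preccurlyeq m(\ln^{(q)}m)^\beta\},\qquad \underline{\mathrm{Ldim}}^q=\sup\{\beta>0\mid m(\ln^{(q)}m)^\beta\preccurlyeq\gamma(m)\}.$$ **Theorem.** For all integers $q\ge1$ and reals $\kappa>0$ there are tuples $\Xi_{q,\kappa}=(S_n,R_n\mid n\ge0)$ of positive integers, with $R_n=1$ for all $n$ and $S_0+\dots+S_n=\lfloor\exp^{(q)}(\lambda(n+2))\rfloor+1$ for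 all sufficiently large $n$, where $\lambda=\ln(p^2)/\kappa$, such that the growth function $\gamma$ of $\mathbf T(\Xi_{q,\kappa})$ satisfies: 1. $\gamma(m)=m\,(\ln^{(q)}m)^{\kappa+o(1)}$ as $m\to\infty$; 2. $\mathrm{GKdim}=\underline{\mathrm{GKdim}}=1$; 3. $\mathrm{Ldim}^q=\underline{\mathrm{Ldim}}^q=\kappa$; 4. the growth is not linear: $\gamma(m)\not\preccurlyeq m$; 5. for different pairs $(q,\kappa)\ne(q',\kappa')$ the algebras $\mathbf T(\Xi_{q,\kappa})$ and $\mathbf T(\Xi_{q',\kappa'})$ are not isomorphic as Lie algebras over $K$ (hence not as restricted Lie algebras). -/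

import Mathlib

open Filter Topology

attribute [local instance] LieRing.ofAssociativeRing

/-! ### Divided power algebras -/

/-- Multi-exponents `α` with finite support and `α a < p ^ S a` for every variable `a`; they index
the monomials `∏ a, t_a^(α a)`. -/
abbrev DPExponent {Θ : Type*} (p : ℕ) (S : Θ → ℕ) : Type _ :=
  {α : Θ →₀ ℕ // ∀ a, α a < p ^ S a}

/-- The divided power algebra on variables `t_a`, `a : Θ`, as a vector space: the space with
basis the divided power monomials `∏ a, t_a^(α a)`, `α a < p ^ S a`. -/
def DPAlg {Θ : Type*} (K : Type*) [Field K] (p : ℕ) (S : Θ → ℕ) : Type _ :=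
  DPExponent p S →₀ K

namespace DPAlg

section Basic

variable {Θ : Type*} {K : Type*} [Field K] {p : ℕ} {S : Θ → ℕ}

noncomputable instance : AddCommGroup (DPAlg K p S) :=
  inferInstanceAs (AddCommGroup (DPExponent p S →₀ K))

noncomputable instance : Module K (DPAlg K p S) :=
  inferInstanceAs (Module K (DPExponent p S →₀ K))

/-- The basis monomial `∏ a, t_a^(α a)`. -/
noncomputable def mono (K : Type*) [Field K] (α : DPExponent p S) : DPAlg K p S :=
  Finsupp.single α 1

/-- Extend a map given on the basis monomials linearly. -/
noncomputable def ext {M : Type*} [AddCommGroup M] [Module K M] (f : DPExponent p S → M) :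
    DPAlg K p S →ₗ[K] M :=
  Finsupp.linearCombination K f

@[simp] theorem ext_mono {M : Type*} [AddCommGroup M] [Module K M] (f : DPExponent p S → M)
    (α : DPExponent p S) : ext f (mono K α) = f α := by
  exact (Finsupp.linearCombination_single K 1 α).trans (one_smul K _)

theorem hom_ext {M : Type*} [AddCommGroup M] [Module K M] {f g : DPAlg K p S →ₗ[K] M}
    (h : ∀ α, f (mono K α) = g (mono K α)) : f = g :=
  Finsupp.lhom_ext' fun α => LinearMap.ext_ring (h α)

/-- The integer `∏ a, binom (α a + β a) (α a)`. -/
noncomputable def binom (α β : Θ →₀ ℕ) : ℕ :=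
  ∏ a ∈ (α + β).support, (α a + β a).choose (α a)

theorem binom_eq (α β : Θ →₀ ℕ) (s : Finset Θ) (h : (α + β).support ⊆ s) :
    binom α β = ∏ a ∈ s, (α a + β a).choose (α a) := by
  refine Finset.prod_subset h fun a _ ha => ?_
  have : α a + β a = 0 := by simpa using ha
  simp [(Nat.add_eq_zero_iff.1 this).1]

theorem binom_comm (α β : Θ →₀ ℕ) : binom α β = binom β α := by
  rw [binom, binom, add_comm β α]
  refine Finset.prod_congr rfl fun a _ => ?_
  rw [add_comm (β a), Nat.choose_symm_add]

theorem binom_assoc (α β γ : Θ →₀ ℕ) :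
    binom α β * binom (α + β) γ = binom β γ * binom α (β + γ) := by
  classical
  have h1 : (α + β).support ⊆ (α + β + γ).support := by
    intro a; simp only [Finsupp.mem_support_iff, Finsupp.add_apply]; omega
  have h2 : (β + γ).support ⊆ (α + β + γ).support := by
    intro a; simp only [Finsupp.mem_support_iff, Finsupp.add_apply]; omega
  rw [binom_eq α β _ h1, binom_eq β γ _ h2, binom_eq (α + β) γ _ subset_rfl,
    binom_eq α (β + γ) (α + β + γ).support (by rw [add_assoc]), ← Finset.prod_mul_distrib,
    ← Finset.prod_mul_distrib]
  refine Finset.prod_congr rfl fun a _ => ?_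
  simp only [Finsupp.add_apply]
  have h : ∀ i j : ℕ, (i + j).choose i * i.factorial * j.factorial = (i + j).factorial := by
    intro i j
    rw [Nat.choose_symm_add, Nat.add_choose_mul_factorial_mul_factorial]
  apply Nat.eq_of_mul_eq_mul_right
    (by positivity : 0 < (α a).factorial * (β a).factorial * (γ a).factorial)
  have e1 := h (α a) (β a)
  have e2 := h (α a + β a) (γ a)
  have e3 := h (β a) (γ a)
  have e4 := h (α a) (β a + γ a)
  rw [← add_assoc] at e4
  rw [← add_assoc]
  calc _ = (α a + β a + γ a).choose (α a + β a) *
        ((α a + β a).choose (α a) * (α a).factorial * (β a).factorial) * (γ a).factorial := by ring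
    _ = (α a + β a + γ a).factorial := by rw [e1, e2]
    _ = (α a + β a + γ a).choose (α a) * (α a).factorial *
        ((β a + γ a).choose (β a) * (β a).factorial * (γ a).factorial) := by rw [e3, e4]
    _ = _ := by ring

open Classical in
/-- The monomial `∏ t_a^(α a)`, read as `0` if some `α a` exceeds the top degree `p ^ S a - 1`. -/
noncomputable def monoZ (K : Type*) [Field K] (p : ℕ) (S : Θ → ℕ) (α : Θ →₀ ℕ) : DPAlg K p S :=
  if h : ∀ a, α a < p ^ S a then mono K ⟨α, h⟩ else 0

theorem monoZ_coe (α : DPExponent p S) : monoZ K p S α.1 = mono K α := dif_pos α.2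

/-- The bilinear product with
`∏ t_a^(α a) * ∏ t_a^(β a) = ∏ binom (α a + β a) (α a) t_a^(α a + β a)`.
If some `α a + β a ≥ p ^ S a` the product is `0` (in characteristic `p` the binomial coefficient
vanishes then). -/
noncomputable def mulₗ : DPAlg K p S →ₗ[K] DPAlg K p S →ₗ[K] DPAlg K p S :=
  ext fun α => ext fun β => (binom α.1 β.1 : K) • monoZ K p S (α.1 + β.1)

noncomputable instance : Mul (DPAlg K p S) := ⟨fun f g => mulₗ f g⟩

theorem mul_def (f g : DPAlg K p S) : f * g = mulₗ f g := rfl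

theorem mono_mul_mono (α β : DPExponent p S) :
    mono K α * mono K β = (binom α.1 β.1 : K) • monoZ K p S (α.1 + β.1) := by
  simp [mul_def, mulₗ]

theorem mul_comm' (f g : DPAlg K p S) : f * g = g * f := by
  suffices h : (mulₗ : DPAlg K p S →ₗ[K] _) = mulₗ.flip by
    rw [mul_def, h]; rfl
  refine hom_ext fun α => hom_ext fun β => ?_
  rw [LinearMap.flip_apply, ← mul_def, ← mul_def, mono_mul_mono, mono_mul_mono, binom_comm,
    add_comm β.1]

theorem monoZ_mul_mono (α : Θ →₀ ℕ) (β : DPExponent p S) :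
    monoZ K p S α * mono K β = (binom α β.1 : K) • monoZ K p S (α + β.1) := by
  by_cases h : ∀ a, α a < p ^ S a
  · exact (congrArg (· * mono K β) (monoZ_coe ⟨α, h⟩)).trans (mono_mul_mono _ _)
  · have h' : ¬ ∀ a, (α + β.1) a < p ^ S a := fun h' => h fun a =>
      (Nat.le_add_right _ _).trans_lt (h' a)
    rw [monoZ, monoZ, dif_neg h, dif_neg h', mul_def, map_zero, LinearMap.zero_apply, smul_zero]

theorem mul_assoc' (f g h : DPAlg K p S) : f * g * h = f * (g * h) := by
  let A : DPAlg K p S →ₗ[K] DPAlg K p S →ₗ[K] DPAlg K p S →ₗ[K] DPAlg K p S :=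
    mulₗ.compr₂ mulₗ
  let B : DPAlg K p S →ₗ[K] DPAlg K p S →ₗ[K] DPAlg K p S →ₗ[K] DPAlg K p S :=
    LinearMap.mk₂ K (fun f g => (mulₗ f).comp (mulₗ g))
      (by intros; ext; simp) (by intros; ext; simp) (by intros; ext; simp) (by intros; ext; simp)
  suffices H : A = B from LinearMap.congr_fun (LinearMap.congr_fun (LinearMap.congr_fun H f) g) h
  refine hom_ext fun α => hom_ext fun β => hom_ext fun γ => ?_
  change mono K α * mono K β * mono K γ = mono K α * (mono K β * mono K γ)
  rw [mul_comm' (mono K α) (mono K β * mono K γ), mono_mul_mono, mono_mul_mono]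
  have hs : ∀ (c : K) (x y : DPAlg K p S), c • x * y = c • (x * y) := fun c x y => by
    simp [mul_def]
  rw [hs, hs, monoZ_mul_mono, monoZ_mul_mono, smul_smul, smul_smul, ← Nat.cast_mul,
    ← Nat.cast_mul, binom_assoc, binom_comm (β.1 + γ.1), add_comm (β.1 + γ.1), add_assoc]

end Basic

section Ring

variable {Θ : Type*} {K : Type*} [Field K] {p : ℕ} [Fact p.Prime] {S : Θ → ℕ}

instance : Zero (DPExponent p S) := ⟨⟨0, fun _ => pow_pos (Fact.out : p.Prime).pos _⟩⟩

noncomputable instance : One (DPAlg K p S) := ⟨mono K 0⟩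

theorem one_mul' (f : DPAlg K p S) : 1 * f = f := by
  suffices h : mulₗ (mono K 0) = (LinearMap.id : DPAlg K p S →ₗ[K] _) from
    LinearMap.congr_fun h f
  refine hom_ext fun α => ?_
  have hb : binom (0 : Θ →₀ ℕ) α.1 = 1 := by simp [binom]
  have h0 : ((0 : DPExponent p S) : Θ →₀ ℕ) = 0 := rfl
  rw [← mul_def, mono_mul_mono, h0, hb, zero_add, monoZ_coe, Nat.cast_one, one_smul]
  rfl

/-- The divided power algebra is a commutative ring with unit. -/
noncomputable instance : CommRing (DPAlg K p S) where
  __ := (inferInstance : AddCommGroup (DPAlg K p S))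
  mul_assoc := mul_assoc'
  mul_comm := mul_comm'
  one_mul := one_mul'
  mul_one f := by rw [mul_comm', one_mul']
  left_distrib f g h := by simp [mul_def]
  right_distrib f g h := by simp [mul_def]
  zero_mul f := by simp [mul_def]
  mul_zero f := by simp [mul_def]

noncomputable instance : Algebra K (DPAlg K p S) :=
  Algebra.ofModule (fun c f g => by simp [mul_def]) (fun c f g => by simp [mul_def])

open Classical in
/-- The linear map `∂_a` with `∂_a (t_a^(i)) = t_a^(i - 1)`, `∂_a (t_a^(0)) = 0`, acting on the
variable `t_a` only. -/
noncomputable def pd (a : Θ) : DPAlg K p S →ₗ[K] DPAlg K p S :=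
  ext fun α => if α.1 a = 0 then 0 else monoZ K p S (α.1 - Finsupp.single a 1)

theorem binom_pascal (α β : Θ →₀ ℕ) (a : Θ) (h : α a + β a ≠ 0) :
    binom α β = (if α a = 0 then 0 else binom (α - Finsupp.single a 1) β) +
      (if β a = 0 then 0 else binom α (β - Finsupp.single a 1)) := by
  classical
  have hs : a ∈ (α + β).support := by simpa [-Nat.add_eq_zero_iff] using h
  have h1 : (α - Finsupp.single a 1 + β).support ⊆ (α + β).support := by
    intro b
    simp only [Finsupp.mem_support_iff, Finsupp.add_apply, Finsupp.tsub_apply]; omega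
  have h2 : (α + (β - Finsupp.single a 1)).support ⊆ (α + β).support := by
    intro b
    simp only [Finsupp.mem_support_iff, Finsupp.add_apply, Finsupp.tsub_apply]; omega
  rw [binom_eq _ _ _ h1, binom_eq _ _ _ h2, binom, ← Finset.mul_prod_erase _ _ hs,
    ← Finset.mul_prod_erase _ _ hs, ← Finset.mul_prod_erase _ _ hs]
  have e0 : ∀ (δ : Θ →₀ ℕ), ∀ b ∈ (α + β).support.erase a,
      (δ - Finsupp.single a 1 : Θ →₀ ℕ) b = δ b := fun δ b hb => by
    simp [Finsupp.single_eq_of_ne (Finset.ne_of_mem_erase hb)]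
  have e1 : ∏ b ∈ (α + β).support.erase a, ((α - Finsupp.single a 1 : Θ →₀ ℕ) b + β b).choose
      ((α - Finsupp.single a 1 : Θ →₀ ℕ) b) =
      ∏ b ∈ (α + β).support.erase a, (α b + β b).choose (α b) :=
    Finset.prod_congr rfl fun b hb => by rw [e0 α b hb]
  have e2 : ∏ b ∈ (α + β).support.erase a,
      (α b + (β - Finsupp.single a 1 : Θ →₀ ℕ) b).choose (α b) =
      ∏ b ∈ (α + β).support.erase a, (α b + β b).choose (α b) :=
    Finset.prod_congr rfl fun b hb => by rw [e0 β b hb]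
  rw [e1, e2]
  rcases hx : α a with _ | i <;> rcases hy : β a with _ | j
  · omega
  · simp [hy]
  · simp [hx]
  · simp only [Finsupp.tsub_apply, Finsupp.single_eq_same, hx, hy, Nat.add_one_ne_zero, if_false,
      Nat.add_sub_cancel]
    rw [← add_mul, show i + 1 + (j + 1) = (i + (j + 1)) + 1 by ring, Nat.choose_succ_succ,
      show i + 1 + j = i + (j + 1) by ring]

theorem pd_mono_mul [CharP K p] (a : Θ) (α β : DPExponent p S) :
    pd a (mono K α * mono K β) =
      mono K α * pd a (mono K β) + mono K β * pd a (mono K α) := by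
  classical
  have hp : p.Prime := Fact.out
  have key : ∀ α β : DPExponent p S, mono K α * pd a (mono K β) =
      ((if β.1 a = 0 then 0 else binom α.1 (β.1 - Finsupp.single a 1) : ℕ) : K) •
        monoZ K p S (α.1 + β.1 - Finsupp.single a 1) := by
    intro α β
    rw [pd, ext_mono]
    split_ifs with h
    · simp
    · rw [mul_comm, monoZ_mul_mono, binom_comm, add_comm _ α.1]
      congr 2
      ext b
      by_cases hb : b = a
      · subst hb; simp; omega
      · simp [Finsupp.single_eq_of_ne hb]
  rw [key α β, key β α, add_comm β.1 α.1, ← add_smul, ← Nat.cast_add]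
  by_cases h0 : α.1 a + β.1 a = 0
  · obtain ⟨h1, h2⟩ := Nat.add_eq_zero_iff.1 h0
    rw [if_pos h1, if_pos h2, mono_mul_mono, map_smul]
    rw [add_zero, Nat.cast_zero, zero_smul, monoZ]
    split_ifs
    · simp [pd, h1, h2]
    · simp
  rw [binom_comm β.1, add_comm (ite _ _ _), ← binom_pascal α.1 β.1 a h0, mono_mul_mono, map_smul]
  by_cases h : ∀ b, (α.1 + β.1) b < p ^ S b
  · congr 1
    rw [monoZ, dif_pos h, pd, ext_mono]
    exact if_neg h0
  · rw [monoZ, dif_neg h, map_zero, smul_zero]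
    by_cases h' : ∀ b, (α.1 + β.1 - Finsupp.single a 1 : Θ →₀ ℕ) b < p ^ S b
    · have hb : (α.1 + β.1) a = p ^ S a := by
        push Not at h
        obtain ⟨b, hb⟩ := h
        have h'b := h' b
        by_cases hba : b = a
        · subst hba
          simp at h'b hb ⊢
          omega
        · simp [Finsupp.single_eq_of_ne hba] at h'b hb
          omega
      have hd : p ∣ binom α.1 β.1 := by
        refine dvd_trans ?_ (Finset.dvd_prod_of_mem _
          (show a ∈ (α.1 + β.1).support by simpa [-Nat.add_eq_zero_iff] using h0))
        have hα := α.2 a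
        have hβ := β.2 a
        rw [Finsupp.add_apply] at hb
        rw [hb]
        exact hp.dvd_choose_pow (by omega) (by omega)
      rw [(CharP.cast_eq_zero_iff K p _).2 hd, zero_smul]
    · rw [monoZ, dif_neg h', smul_zero]

theorem pd_mono_eq_zero (a : Θ) (α : DPExponent p S) (h : α.1 a = 0) : pd a (mono K α) = 0 := by
  rw [pd, ext_mono, if_pos h]

/-- The linear map underlying `vecField`. -/
noncomputable def vecFieldₗ (f : Θ → DPAlg K p S) : DPAlg K p S →ₗ[K] DPAlg K p S :=
  ext fun α => ∑ a ∈ α.1.support, f a * pd a (mono K α)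

theorem vecFieldₗ_mono (f : Θ → DPAlg K p S) (α : DPExponent p S) (s : Finset Θ)
    (h : α.1.support ⊆ s) : vecFieldₗ f (mono K α) = ∑ a ∈ s, f a * pd a (mono K α) := by
  rw [vecFieldₗ, ext_mono]
  refine Finset.sum_subset h fun a _ ha => ?_
  rw [pd_mono_eq_zero a α (by simpa using ha), mul_zero]

theorem vecFieldₗ_mono_mul (f : Θ → DPAlg K p S) (α β : DPExponent p S) (s : Finset Θ)
    (h : (α.1 + β.1).support ⊆ s) : vecFieldₗ f (mono K α * mono K β) =
      ∑ a ∈ s, f a * pd a (mono K α * mono K β) := by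
  rw [mono_mul_mono, monoZ]
  split_ifs with h1
  · rw [map_smul, vecFieldₗ_mono f _ s h, Finset.smul_sum]
    simp only [map_smul, mul_smul_comm]
  · simp

/-- The derivation `∑ a, f a ∂_a` for an arbitrary, possibly infinite, family of coefficients
`f a`; on a monomial only the finitely many `∂_a` with `t_a` occurring in it act nontrivially. -/
noncomputable def vecField [CharP K p] (f : Θ → DPAlg K p S) :
    Derivation K (DPAlg K p S) (DPAlg K p S) :=
  Derivation.mk' (vecFieldₗ f) fun g h => by
    classical
    let D := vecFieldₗ f
    let A : DPAlg K p S →ₗ[K] DPAlg K p S →ₗ[K] DPAlg K p S := (LinearMap.mul K _).compr₂ D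
    let B : DPAlg K p S →ₗ[K] DPAlg K p S →ₗ[K] DPAlg K p S :=
      (LinearMap.mul K _).compl₂ D + ((LinearMap.mul K _).compl₂ D).flip
    suffices H : A = B from LinearMap.congr_fun (LinearMap.congr_fun H g) h
    refine hom_ext fun α => hom_ext fun β => ?_
    change D (mono K α * mono K β) = mono K α * D (mono K β) + mono K β * D (mono K α)
    have hα : α.1.support ⊆ (α.1 + β.1).support := by
      intro b; simp only [Finsupp.mem_support_iff, Finsupp.add_apply]; omega
    have hβ : β.1.support ⊆ (α.1 + β.1).support := by
      intro b; simp only [Finsupp.mem_support_iff, Finsupp.add_apply]; omega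
    simp only [D]
    rw [vecFieldₗ_mono_mul f α β _ subset_rfl, vecFieldₗ_mono f α _ hα, vecFieldₗ_mono f β _ hβ,
      Finset.mul_sum, Finset.mul_sum, ← Finset.sum_add_distrib]
    refine Finset.sum_congr rfl fun a _ => ?_
    rw [pd_mono_mul]
    ring

theorem vecField_mono [CharP K p] (f : Θ → DPAlg K p S) (α : DPExponent p S) :
    vecField f (mono K α) = ∑ a ∈ α.1.support, f a * pd a (mono K α) :=
  vecFieldₗ_mono f α _ subset_rfl

theorem vecField_add_smul [CharP K p] (f g : Θ → DPAlg K p S) (c : DPAlg K p S) :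
    vecField (fun a => f a + c * g a) = vecField f + c • vecField g := by
  have : ((vecField (fun a => f a + c * g a) :
      Derivation K (DPAlg K p S) (DPAlg K p S)) :
      DPAlg K p S →ₗ[K] DPAlg K p S) =
      (((vecField f + c • vecField g : Derivation K (DPAlg K p S) (DPAlg K p S))) :
        DPAlg K p S →ₗ[K] DPAlg K p S) := by
    refine hom_ext fun α => ?_
    simp only [Derivation.coeFn_coe, Derivation.coe_add_linearMap,
      Derivation.coe_smul_linearMap, LinearMap.add_apply, LinearMap.smul_apply, vecField_mono,
      smul_eq_mul, Finset.mul_sum, ← Finset.sum_add_distrib]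
    refine Finset.sum_congr rfl fun a _ => by ring
  exact Derivation.ext fun x => LinearMap.congr_fun this x

open Classical in
/-- The partial derivation `∂_a` in `Der R`. -/
noncomputable def partialDer [CharP K p] (a : Θ) : Derivation K (DPAlg K p S) (DPAlg K p S) :=
  vecField (Pi.single a 1)

/-- The derivation `∂_a` acts as described by `pd`. -/
theorem partialDer_mono [CharP K p] (a : Θ) (α : DPExponent p S) :
    partialDer a (mono K α) = pd a (mono K α) := by
  classical
  rw [partialDer, vecField_mono]
  by_cases h : a ∈ α.1.support
  · rw [Finset.sum_eq_single_of_mem a h]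
    · simp
    · intro b _ hb
      simp [Pi.single_eq_of_ne hb]
  · rw [pd_mono_eq_zero a α (by simpa using h)]
    refine Finset.sum_eq_zero fun b hb => ?_
    have : b ≠ a := by rintro rfl; exact h hb
    simp [Pi.single_eq_of_ne this]

/-- The divided power `t_a^(i)`. It is a basis monomial for `i < p ^ S a`. -/
noncomputable def dpow (K : Type*) [Field K] (p : ℕ) (S : Θ → ℕ) (a : Θ) (i : ℕ) : DPAlg K p S :=
  monoZ K p S (Finsupp.single a i)

end Ring
end DPAlg

/-! ### Clover restricted Lie algebras -/

/-- A tuple `Ξ = (S n, R n | n ≥ 0)` of positive integers. -/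
structure CloverTuple where
  S : ℕ → ℕ
  R : ℕ → ℕ
  S_pos : ∀ n, 0 < S n
  R_pos : ∀ n, 0 < R n

/-- The variables `x n`, `y n`, `z n`, `n ≥ 0`. -/
inductive CloverVar : Type
  | x : ℕ → CloverVar
  | y : ℕ → CloverVar
  | z : ℕ → CloverVar

/-- Powers of `x n` are bounded by `p ^ S n`, those of `y n` and of `z n` by `p ^ R n`. -/
def CloverTuple.height (Ξ : CloverTuple) : CloverVar → ℕ
  | .x n => Ξ.S n
  | .y n => Ξ.R n
  | .z n => Ξ.R n

/-- The divided power algebra `R(Ξ)`. -/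
abbrev CloverRing (K : Type*) [Field K] (p : ℕ) (Ξ : CloverTuple) : Type _ :=
  DPAlg K p Ξ.height

namespace Clover

open DPAlg

section Pivot

variable (K : Type*) [Field K] (p : ℕ) [Fact p.Prime] [CharP K p] (Ξ : CloverTuple)

/-- `x_n^(p^{S_n} - 1)`. -/
noncomputable def xTop (n : ℕ) : CloverRing K p Ξ := dpow K p Ξ.height (.x n) (p ^ Ξ.S n - 1)

/-- `y_n^(p^{R_n} - 1)`. -/
noncomputable def yTop (n : ℕ) : CloverRing K p Ξ := dpow K p Ξ.height (.y n) (p ^ Ξ.R n - 1)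

/-- `z_n^(p^{R_n} - 1)`. -/
noncomputable def zTop (n : ℕ) : CloverRing K p Ξ := dpow K p Ξ.height (.z n) (p ^ Ξ.R n - 1)

/-- `v_i = ∂_{x_i} + x_i^(top) y_i^(top) (∂_{x_{i+1}} + x_{i+1}^(top) y_{i+1}^(top) (⋯))`,
that is, `v_i = ∑_{j ≥ i} (∏_{i ≤ l < j} x_l^(top) y_l^(top)) ∂_{x_j}`. -/
noncomputable def v (i : ℕ) : Derivation K (CloverRing K p Ξ) (CloverRing K p Ξ) :=
  vecField fun
    | .x j => if i ≤ j then ∏ l ∈ Finset.Ico i j, (xTop K p Ξ l * yTop K p Ξ l) else 0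
    | .y _ => 0
    | .z _ => 0

/-- `w_i = ∂_{y_i} + y_i^(top) x_i^(top) (∂_{y_{i+1}} + y_{i+1}^(top) x_{i+1}^(top) (⋯))`. -/
noncomputable def w (i : ℕ) : Derivation K (CloverRing K p Ξ) (CloverRing K p Ξ) :=
  vecField fun
    | .x _ => 0
    | .y j => if i ≤ j then ∏ l ∈ Finset.Ico i j, (yTop K p Ξ l * xTop K p Ξ l) else 0
    | .z _ => 0

/-- `u_i = ∂_{z_i} + z_i^(top) x_i^(top) (∂_{z_{i+1}} + z_{i+1}^(top) x_{i+1}^(top) (⋯))`. -/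
noncomputable def u (i : ℕ) : Derivation K (CloverRing K p Ξ) (CloverRing K p Ξ) :=
  vecField fun
    | .x _ => 0
    | .y _ => 0
    | .z j => if i ≤ j then ∏ l ∈ Finset.Ico i j, (zTop K p Ξ l * xTop K p Ξ l) else 0

theorem coef_step {M : Type*} [CommRing M] (f : ℕ → M) (i j : ℕ) :
    (if i ≤ j then ∏ l ∈ Finset.Ico i j, f l else 0) =
      (if j = i then 1 else 0) +
        f i * (if i + 1 ≤ j then ∏ l ∈ Finset.Ico (i + 1) j, f l else 0) := by
  rcases lt_trichotomy i j with h | h | h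
  · rw [if_pos h.le, if_neg h.ne', if_pos (show i + 1 ≤ j from h), zero_add,
      Finset.prod_eq_prod_Ico_succ_bot h]
  · subst h; simp
  · rw [if_neg (by omega), if_neg (by omega), if_neg (by omega)]; simp

/-- The defining recursion of the pivot elements `v i`. -/
theorem v_eq (i : ℕ) : v K p Ξ i =
    partialDer (.x i) + (xTop K p Ξ i * yTop K p Ξ i) • v K p Ξ (i + 1) := by
  classical
  rw [v, v, partialDer, ← vecField_add_smul]
  congr 1
  funext a
  cases a with
  | x j => refine (coef_step (fun l => xTop K p Ξ l * yTop K p Ξ l) i j).trans ?_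
           simp [Pi.single_apply]
  | y j => simp
  | z j => simp

/-- The defining recursion of the pivot elements `w i`. -/
theorem w_eq (i : ℕ) : w K p Ξ i =
    partialDer (.y i) + (yTop K p Ξ i * xTop K p Ξ i) • w K p Ξ (i + 1) := by
  classical
  rw [w, w, partialDer, ← vecField_add_smul]
  congr 1
  funext a
  cases a with
  | y j => refine (coef_step (fun l => yTop K p Ξ l * xTop K p Ξ l) i j).trans ?_
           simp [Pi.single_apply]
  | x j => simp
  | z j => simp

/-- The defining recursion of the pivot elements `u i`. -/
theorem u_eq (i : ℕ) : u K p Ξ i =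
    partialDer (.z i) + (zTop K p Ξ i * xTop K p Ξ i) • u K p Ξ (i + 1) := by
  classical
  rw [u, u, partialDer, ← vecField_add_smul]
  congr 1
  funext a
  cases a with
  | z j => refine (coef_step (fun l => zTop K p Ξ l * xTop K p Ξ l) i j).trans ?_
           simp [Pi.single_apply]
  | x j => simp
  | y j => simp

/-- The three generators `v_0, w_0, u_0`, as `K`-linear operators on `R(Ξ)`. -/
noncomputable def gens : Set (Module.End K (CloverRing K p Ξ)) :=
  {((v K p Ξ 0 : Derivation K _ _) : Module.End K (CloverRing K p Ξ)),
   ((w K p Ξ 0 : Derivation K _ _) : Module.End K (CloverRing K p Ξ)),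
   ((u K p Ξ 0 : Derivation K _ _) : Module.End K (CloverRing K p Ξ))}

end Pivot

end Clover

/-- The restricted Lie subalgebra `Lie_p(X)` generated by `X` in an associative algebra `A` of
characteristic `p`: the smallest Lie subalgebra for `⁅a, b⁆ = a b - b a` that contains `X` and
is closed under `a ↦ a ^ p`. -/
def lieP (K : Type*) [Field K] (p : ℕ) {A : Type*} [Ring A] [Algebra K A] (X : Set A) :
    LieSubalgebra K A :=
  sInf {L | X ⊆ L ∧ ∀ a ∈ L, a ^ p ∈ L}

/-- The clover restricted Lie algebra `T(Ξ) = Lie_p(v_0, w_0, u_0)`. The derivations of `R(Ξ)` form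
a restricted Lie subalgebra of the algebra of all linear operators on `R(Ξ)`, so `Lie_p` is
computed there. -/
noncomputable def CloverLie (K : Type*) [Field K] (p : ℕ) [Fact p.Prime] [CharP K p]
    (Ξ : CloverTuple) : LieSubalgebra K (Module.End K (CloverRing K p Ξ)) :=
  lieP K p (Clover.gens K p Ξ)

/-! ### Growth -/

/-- The right-normed commutators `[x_0, [x_1, […, x_s]]]` of length `s + 1` in elements of `X`. -/
def rnComm {A : Type*} [Ring A] (X : Set A) : ℕ → Set A
  | 0 => X
  | s + 1 => {c | ∃ x ∈ X, ∃ b ∈ rnComm X s, c = ⁅x, b⁆}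

/-- The growth function of the restricted Lie algebra `Lie_p(X)` with respect to `X`: the dimension
of the span of all `[x_1, …, x_s]^(p^k)` with `x_j ∈ X`, `s ≥ 1`, `k ≥ 0` and `s p^k ≤ n`. -/
noncomputable def growthLieP (K : Type*) [Field K] (p : ℕ) {A : Type*} [Ring A] [Algebra K A]
    (X : Set A) (n : ℕ) : ℕ :=
  Module.finrank K (Submodule.span K
    {a : A | ∃ s k : ℕ, (s + 1) * p ^ k ≤ n ∧ ∃ c ∈ rnComm X s, a = c ^ p ^ k})

/-- The growth function of the clover algebra `T(Ξ)` for the generators `v_0, w_0, u_0`. -/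
noncomputable def cloverGrowth (K : Type*) [Field K] (p : ℕ) [Fact p.Prime] [CharP K p]
    (Ξ : CloverTuple) : ℕ → ℕ :=
  growthLieP K p (Clover.gens K p Ξ)

/-- `f ≼ g`: there are positive integers `N`, `C` with `f n ≤ g (C n)` for all `n ≥ N`. -/
def GrowthLE (f g : ℕ → ℝ) : Prop :=
  ∃ N C : ℕ, 0 < N ∧ 0 < C ∧ ∀ n ≥ N, f n ≤ g (C * n)

/-- The `q`-fold iterated natural logarithm. -/
noncomputable def iterLog (q : ℕ) (x : ℝ) : ℝ := Real.log^[q] x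

/-- The `q`-fold iterated exponential. -/
noncomputable def iterExp (q : ℕ) (x : ℝ) : ℝ := Real.exp^[q] x

/-- Upper Gelfand--Kirillov dimension of a growth function, with values in `[-∞, ∞]`. -/
noncomputable def gkDim (γ : ℕ → ℕ) : EReal :=
  limsup (fun n : ℕ => ((Real.log (γ n) / Real.log n : ℝ) : EReal)) atTop

/-- Lower Gelfand--Kirillov dimension of a growth function, with values in `[-∞, ∞]`. -/
noncomputable def lowerGKDim (γ : ℕ → ℕ) : EReal :=
  liminf (fun n : ℕ => ((Real.log (γ n) / Real.log n : ℝ) : EReal)) atTop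

/-- The function `m (ln^(q) m)^β`. -/
noncomputable def quasiLinear (q : ℕ) (β : ℝ) (m : ℕ) : ℝ := m * iterLog q m ^ β

/-- `Ldim^q`, `q ≥ 1`, with values in `[0, ∞]`; it is `∞` if no `β` qualifies. -/
noncomputable def lDim (q : ℕ) (γ : ℕ → ℕ) : ENNReal :=
  sInf {b | ∃ β : ℝ, 0 < β ∧ GrowthLE (fun n => γ n) (quasiLinear q β) ∧ b = ENNReal.ofReal β}

/-- Lower `Ldim^q`, `q ≥ 1`, with values in `[0, ∞]`; it is `0` if no `β` qualifies. -/
noncomputable def lowerLDim (q : ℕ) (γ : ℕ → ℕ) : ENNReal :=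
  sSup {b | ∃ β : ℝ, 0 < β ∧ GrowthLE (quasiLinear q β) (fun n => γ n) ∧ b = ENNReal.ofReal β}

/-! ### Jacobson's formula for the `p`-th power of a sum -/

section Jacobson

open Polynomial

/-! With all `R n = 1`, give the pivot elements `v n`, `w n`, `u n` the common weight `wt n`, where
`wt 0 = 1` and `wt (n + 1) = (p ^ S n + p - 1) * wt n`, and give the variables of level `n` degree
`wt n`. Every pivot is then homogeneous. The weights are right because a pivot raised to the power
`p` to the height of its variable is the top divided power of the partner variable times the next
pivot (`pivot_pow`), and bracketing with the pivot of the partner variable strips that divided power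
off again (`dpow_partner_mem`).

Upper bound. The standard filtration lies in the span `upSpan` of monomial multiples of pivots and
of the powers `v_i ^ (p ^ j)`, filtered by weight. Monomials of level below `n` have degree less
than `3/2 * wt n`, so at level `n + 1` only weights above `wt n / 2` arise. This keeps the span
closed under brackets (`lie_mem_upSpan`) and under `p`-th powers (`pow_mem_upSpan`, by Jacobson's
formula), and it bounds the level by the weight. Once the weight, the level and the exponents of the
`y` and `z` are fixed, the exponents of the `x` are digits in a mixed radix system and hence
determined. So the growth at `d` is at most a constant times `d * p ^ (2 * n)` when `d` is between
`2 * wt n` and `2 * wt (n + 1)` (`cloverGrowth_le`).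

Lower bound. The algebra contains the multiples of `u (n + 1)` by all monomials free of `y n` in
which no `x i` has its top exponent (`small_u_mem`). Counting them gives a multiple of `d * p ^ (2 *
n)` again (`le_cloverGrowth`), because `∏ (p ^ S i - 1)` is comparable to `wt n` once `∑ p ^ (-S i)`
converges (`exists_mul_wt_le_prod`).

The prescribed partial sums of `S` make `ln^(q+1) d` equal to `ln (p ^ 2) / κ * n + O(1)` on that
range, so `ln (γ d / d) = κ * ln^(q+1) d + O(1)`. All dimensions follow from this single estimate,
`HasQuasiLinearGrowth`.

Non-isomorphism. The centre is zero (`centre_eq_zero`), so the `p`-map is determined by the bracket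
through `ad (a ^ p) = (ad a) ^ p`, and any Lie isomorphism respects it. Such a map distorts the
standard filtration by at most a constant factor, and the estimate recovers `q` and `κ` from growth
up to that equivalence. -/

theorem cast_choose_prime_sub_one {R : Type*} [Ring R] {p : ℕ} (hp : p.Prime) [CharP R p]
    {m : ℕ} (hm : m < p) : ((p - 1).choose m : R) = (-1) ^ m := by
  induction m with
  | zero => simp
  | succ m ih =>
    have h1 : (p.choose (m + 1) : R) = 0 :=
      (CharP.cast_eq_zero_iff R p _).2 (hp.dvd_choose_self (Nat.succ_ne_zero m) hm)
    obtain ⟨n, rfl⟩ : ∃ n, p = n + 1 := ⟨p - 1, by have := hp.pos; omega⟩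
    rw [Nat.choose_succ_succ, Nat.cast_add] at h1
    rw [Nat.add_sub_cancel] at ih ⊢
    rw [pow_succ, ← ih (by omega), eq_neg_of_add_eq_zero_right h1]
    simp

/-- Modulo `p` the binomial coefficients of exponent `p - 1` are signs, and these cancel the signs
coming from `a - b`. The intended `a` and `b` are left and right multiplication by one element,
whose difference is `ad`. -/
theorem Commute.geom_sum_char {R : Type*} [Ring R] {p : ℕ} (hp : p.Prime) [CharP R p] {a b : R}
    (h : Commute a b) : ∑ i ∈ Finset.range p, a ^ i * b ^ (p - 1 - i) = (a - b) ^ (p - 1) := by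
  have hp1 : p - 1 + 1 = p := by have := hp.pos; omega
  rw [← neg_sub b a, neg_pow, sub_eq_neg_add, (h.neg_left).add_pow, hp1, Finset.mul_sum]
  refine Finset.sum_congr rfl fun i hi => ?_
  have hi' : i < p := Finset.mem_range.1 hi
  rw [cast_choose_prime_sub_one hp hi', neg_pow a i]
  have h2 : ((-1 : R) ^ (p - 1)) = 1 := by
    have := cast_choose_prime_sub_one (R := R) hp (show p - 1 < p by omega)
    rw [Nat.choose_self, Nat.cast_one] at this
    exact this.symm
  have h3 : (-1 : R) ^ i * (-1) ^ i = 1 := by rw [← pow_add, Even.neg_one_pow ⟨i, rfl⟩]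
  have h4 := (Commute.neg_one_left (a ^ i * b ^ (p - 1 - i))).pow_left i
  rw [h2, one_mul, mul_assoc, mul_assoc, ← mul_assoc (a ^ i), ← h4.eq, ← mul_assoc, h3, one_mul]

variable {A : Type*} [Ring A]

/-- `ad x`, iterated. -/
def adIter (x : A) (n : ℕ) (y : A) : A := (fun z => ⁅x, z⁆)^[n] y

@[simp] theorem adIter_zero (x y : A) : adIter x 0 y = y := rfl

theorem adIter_succ (x y : A) (n : ℕ) : adIter x (n + 1) y = ⁅x, adIter x n y⁆ :=
  Function.iterate_succ_apply' _ _ _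

theorem adIter_succ' (x y : A) (n : ℕ) : adIter x (n + 1) y = adIter x n ⁅x, y⁆ :=
  Function.iterate_succ_apply _ _ _

theorem adIter_eq (x y : A) (n : ℕ) :
    adIter x n y = ((LinearMap.mulLeft ℤ x - LinearMap.mulRight ℤ x) ^ n) y := by
  rw [Module.End.pow_apply]
  rfl

theorem charP_end_int {p : ℕ} [CharP A p] : CharP (Module.End ℤ A) p := by
  refine ⟨fun n => ?_⟩
  rw [← CharP.cast_eq_zero_iff A p n]
  constructor
  · intro h
    have := LinearMap.congr_fun h (1 : A)
    simpa [Module.End.natCast_apply] using this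
  · intro h
    ext y
    simp [Module.End.natCast_apply, h]

/-- In characteristic `p`, `ad (x ^ (p ^ k)) = (ad x) ^ (p ^ k)`. -/
theorem lie_pow_char_pow {p : ℕ} [Fact p.Prime] [CharP A p] (x y : A) (k : ℕ) :
    ⁅x ^ p ^ k, y⁆ = adIter x (p ^ k) y := by
  have : CharP (Module.End ℤ A) p := charP_end_int
  rw [adIter_eq, sub_pow_char_pow_of_commute _ _ (LinearMap.commute_mulLeft_right (R := ℤ) x x),
    LinearMap.pow_mulLeft, LinearMap.pow_mulRight]
  rfl

theorem lie_pow_char {p : ℕ} [Fact p.Prime] [CharP A p] (x y : A) :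
    ⁅x ^ p, y⁆ = adIter x p y := by
  simpa using lie_pow_char_pow x y 1

theorem Polynomial.derivative_pow_noncomm (q : A[X]) (n : ℕ) :
    derivative (q ^ n) = ∑ i ∈ Finset.range n, q ^ i * derivative q * q ^ (n - 1 - i) := by
  induction n with
  | zero => simp
  | succ n ih =>
    rw [pow_succ, derivative_mul, ih, Finset.sum_range_succ, Finset.sum_mul]
    simp only [Nat.add_sub_cancel, Nat.sub_self, pow_zero, mul_one]
    congr 1
    refine Finset.sum_congr rfl fun i hi => ?_
    have := Finset.mem_range.1 hi
    rw [mul_assoc, ← pow_succ]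
    congr 2
    omega

/-- The noncommutative Leibniz sum is a geometric sum in left and right multiplication by `q`, so
`Commute.geom_sum_char` turns it into `(ad q) ^ (p - 1)`. -/
theorem Polynomial.derivative_pow_char {p : ℕ} [Fact p.Prime] [CharP A p] (q : A[X]) :
    derivative (q ^ p) = adIter q (p - 1) (derivative q) := by
  have : CharP (Module.End ℤ A[X]) p := charP_end_int
  rw [derivative_pow_noncomm, adIter_eq, ← Commute.geom_sum_char (Fact.out : p.Prime)
    (LinearMap.commute_mulLeft_right (R := ℤ) q q), LinearMap.sum_apply]
  refine Finset.sum_congr rfl fun i _ => ?_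
  rw [LinearMap.pow_mulLeft, LinearMap.pow_mulRight]
  simp [mul_assoc]

/-- **Jacobson's formula**. -/
theorem add_pow_char_jacobson {p : ℕ} [Fact p.Prime] [CharP A p] (x y : A) :
    ∃ s : ℕ → A, (x + y) ^ p = y ^ p + ∑ i ∈ Finset.range (p - 1), s i + x ^ p ∧
      ∀ i, s i * ((i : A) + 1) =
        (adIter (C x * X + C y) (p - 1) (C x)).coeff i := by
  have hp := (Fact.out : p.Prime).pos
  set q : A[X] := C x * X + C y with hq
  -- Expand `(x T + y) ^ p` in powers of a central `T`. Setting `T = 1` gives the sum, and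
  -- differentiating in `T` identifies the coefficients.
  refine ⟨fun i => (q ^ p).coeff (i + 1), ?_, fun i => ?_⟩
  · have hdeg : q.natDegree ≤ 1 := natDegree_linear_le
    have hdp : (q ^ p).natDegree < p + 1 := by
      have := natDegree_pow_le_of_le p hdeg
      omega
    let ev : A[X] →+* A := eval₂RingHom' (RingHom.id A) 1 fun a => Commute.one_right _
    have h1 : ev (q ^ p) = (x + y) ^ p := by
      rw [map_pow]
      congr 1
      change eval₂ (RingHom.id A) 1 q = _
      simp [hq, eval₂_mul_X]
    have h2 : ev (q ^ p) = ∑ i ∈ Finset.range (p + 1), (q ^ p).coeff i := by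
      change eval₂ (RingHom.id A) 1 (q ^ p) = _
      rw [eval₂_eq_sum_range' _ hdp]
      simp
    rw [← h1, h2, Finset.sum_range_succ]
    obtain ⟨n, hn⟩ : ∃ n, p = n + 1 := ⟨p - 1, by omega⟩
    have h3 : (q ^ p).coeff p = x ^ p := by
      have := coeff_pow_of_natDegree_le (m := p) hdeg
      rw [mul_one] at this
      rw [this]
      simp [hq]
    have h4 : (q ^ p).coeff 0 = y ^ p := by
      rw [← constantCoeff_apply, map_pow]
      simp [hq]
    rw [h3, ← h4]
    congr 1
    conv_lhs => rw [hn]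
    rw [Finset.sum_range_succ', hn, Nat.add_sub_cancel, add_comm]
  · rw [← coeff_derivative, derivative_pow_char]
    simp [hq]

variable {K : Type*} [Field K] [Algebra K A]

/-- In a filtration compatible with brackets, if the `p`-th powers of `x` and `y` have at most
`p` times the degree, then so has the `p`-th power of `x + y`. -/
theorem add_pow_char_mem {p : ℕ} [Fact p.Prime] [CharP K p] [CharP A p] {F : ℕ → Submodule K A}
    (hF : ∀ {a b x y}, x ∈ F a → y ∈ F b → ⁅x, y⁆ ∈ F (a + b)) {d : ℕ} {x y : A}
    (hx : x ∈ F d) (hy : y ∈ F d) (hxp : x ^ p ∈ F (p * d)) (hyp : y ^ p ∈ F (p * d)) :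
    (x + y) ^ p ∈ F (p * d) := by
  have hp := (Fact.out : p.Prime).pos
  obtain ⟨s, hs, hs'⟩ := add_pow_char_jacobson (p := p) x y
  -- Each coefficient is a sum of brackets with `j + 1` entries taken from `x` and `y`.
  have key : ∀ j i, (adIter (C x * X + C y) j (C x)).coeff i ∈ F ((j + 1) * d) := by
    intro j
    induction j with
    | zero =>
      intro i
      rw [adIter_zero, coeff_C]
      split_ifs
      · simpa using hx
      · exact zero_mem _
    | succ j ih =>
      intro i
      set r := adIter (C x * X + C y) j (C x)
      have e : (adIter (C x * X + C y) (j + 1) (C x)).coeff i =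
          ⁅x, (X * r).coeff i⁆ + ⁅y, r.coeff i⁆ := by
        have e1 : r * (C x * X) = X * r * C x := by rw [← mul_assoc, ← X_mul, mul_assoc]
        rw [adIter_succ, Ring.lie_def, Ring.lie_def, Ring.lie_def, add_mul, mul_add, e1, mul_assoc,
          coeff_sub, coeff_add, coeff_add, coeff_C_mul, coeff_C_mul, coeff_mul_C, coeff_mul_C]
        abel
      have h1 : (X * r).coeff i ∈ F ((j + 1) * d) := by
        cases i with
        | zero => simp
        | succ i => simpa using ih i
      rw [e, show (j + 1 + 1) * d = d + (j + 1) * d by ring]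
      exact add_mem (hF hx h1) (hF hy (ih i))
  rw [hs]
  refine add_mem (add_mem hyp (sum_mem fun i hi => ?_)) hxp
  have h1 := key (p - 1) i
  rw [← hs', Nat.sub_add_cancel hp] at h1
  have hi' := Finset.mem_range.1 hi
  have h2 : ((i + 1 : ℕ) : K) ≠ 0 := by
    rw [Ne, CharP.cast_eq_zero_iff K p]
    exact Nat.not_dvd_of_pos_of_lt (Nat.succ_pos i) (by omega)
  have h3 : s i * ((i : A) + 1) = ((i + 1 : ℕ) : K) • s i := by
    rw [Algebra.smul_def, map_natCast, (Nat.cast_commute (i + 1) (s i)).eq, Nat.cast_succ]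
  rw [h3] at h1
  exact (Submodule.smul_mem_iff _ h2).1 h1

/-- Span induction must carry `x ∈ F d` along with the claim on `x ^ p`, since the mixed terms in
Jacobson's formula are controlled by the degrees of the summands. -/
theorem pow_char_mem_of_span {p : ℕ} [Fact p.Prime] [CharP K p] [CharP A p]
    {F : ℕ → Submodule K A} (hF : ∀ {a b x y}, x ∈ F a → y ∈ F b → ⁅x, y⁆ ∈ F (a + b)) {d : ℕ}
    {S : Set A} (hS : F d = Submodule.span K S) (h : ∀ x ∈ S, x ^ p ∈ F (p * d)) {x : A}
    (hx : x ∈ F d) : x ^ p ∈ F (p * d) := by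
  have : ∀ x ∈ Submodule.span K S, x ∈ F d ∧ x ^ p ∈ F (p * d) := by
    intro x hx
    induction hx using Submodule.span_induction with
    | mem x hx => exact ⟨hS ▸ Submodule.subset_span hx, h x hx⟩
    | zero => rw [zero_pow (Fact.out : p.Prime).ne_zero]; exact ⟨zero_mem _, zero_mem _⟩
    | add x y _ _ ihx ihy =>
      exact ⟨add_mem ihx.1 ihy.1, add_pow_char_mem hF ihx.1 ihy.1 ihx.2 ihy.2⟩
    | smul c x _ ih =>
      rw [_root_.smul_pow]
      exact ⟨Submodule.smul_mem _ _ ih.1, Submodule.smul_mem _ _ ih.2⟩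
  exact (this x (hS ▸ hx)).2

/-- If the iterated brackets `(ad x)^j y` commute with `y`, then
`(x + y) ^ p = x ^ p + (ad x)^(p-1) y + y ^ p`. -/
theorem add_pow_char_of_lie_adIter {p : ℕ} [Fact p.Prime] [CharP K p] [CharP A p] (x y : A)
    (h : ∀ j, ⁅y, adIter x j y⁆ = 0) :
    (x + y) ^ p = x ^ p + adIter x (p - 1) y + y ^ p := by
  have hp := (Fact.out : p.Prime).two_le
  obtain ⟨s, hs, hs'⟩ := add_pow_char_jacobson (p := p) y x
  -- By hypothesis the `y X` part of the bracket contributes nothing, so the polynomial stays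
  -- constant and only the term `i = 0` of Jacobson's formula survives.
  have key : ∀ j, adIter (C y * X + C x) j (C y) = C (adIter x j y) := by
    intro j
    induction j with
    | zero => rfl
    | succ j ih =>
      have h1 := h j
      rw [Ring.lie_def, sub_eq_zero] at h1
      rw [adIter_succ, adIter_succ, ih, Ring.lie_def, Ring.lie_def, add_mul, mul_add, mul_assoc,
        X_mul_C, ← mul_assoc, ← C_mul, h1, ← mul_assoc, ← C_mul, C_sub, C_mul, C_mul, C_mul]
      abel
  rw [add_comm y x] at hs
  rw [hs]
  congr 2
  rw [Finset.sum_eq_single 0]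
  · have := hs' 0
    rw [key, coeff_C_zero] at this
    simpa using this
  · intro i hi hi0
    have hi' := Finset.mem_range.1 hi
    have h1 := hs' i
    rw [key, coeff_C_of_ne_zero hi0] at h1
    have h2 : ((i + 1 : ℕ) : K) ≠ 0 := by
      rw [Ne, CharP.cast_eq_zero_iff K p]
      exact Nat.not_dvd_of_pos_of_lt (Nat.succ_pos i) (by omega)
    have h3 : s i * ((i : A) + 1) = ((i + 1 : ℕ) : K) • s i := by
      rw [Algebra.smul_def, map_natCast, (Nat.cast_commute (i + 1) (s i)).eq, Nat.cast_succ]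
    rw [h3] at h1
    exact (smul_eq_zero.1 h1).resolve_left h2
  · intro h0
    exact absurd (Finset.mem_range.2 (by omega)) h0

end Jacobson

/-! ### The standard filtration of `Lie_p(X)` -/

section GrowthFiltration

variable {K : Type*} [Field K] {A : Type*} [Ring A] [Algebra K A]

theorem lie_mem_of_span {S T : Set A} {N : Submodule K A} {x y : A}
    (h : ∀ s ∈ S, ∀ t ∈ T, ⁅s, t⁆ ∈ N) (hx : x ∈ Submodule.span K S)
    (hy : y ∈ Submodule.span K T) : ⁅x, y⁆ ∈ N := by
  induction hx using Submodule.span_induction with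
  | mem x hx =>
    induction hy using Submodule.span_induction with
    | mem y hy => exact h x hx y hy
    | zero => simp
    | add y z _ _ h1 h2 => rw [lie_add]; exact add_mem h1 h2
    | smul c y _ h1 => rw [lie_smul]; exact Submodule.smul_mem _ _ h1
  | zero => simp
  | add y z _ _ h1 h2 => rw [add_lie]; exact add_mem h1 h2
  | smul c y _ h1 => rw [smul_lie]; exact Submodule.smul_mem _ _ h1

/-- Induction on the first commutator through `[[x, b], d] = [x, [b, d]] - [b, [x, d]]`. The index
counts letters minus one, hence `s + t + 1`. -/
theorem lie_rnComm {X : Set A} {s t : ℕ} {c d : A} (hc : c ∈ rnComm X s) (hd : d ∈ rnComm X t) :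
    ⁅c, d⁆ ∈ Submodule.span K (rnComm X (s + t + 1)) := by
  induction s generalizing c d t with
  | zero =>
    rw [zero_add]
    exact Submodule.subset_span ⟨c, hc, d, hd, rfl⟩
  | succ s ih =>
    obtain ⟨x, hx, b, hb, rfl⟩ := hc
    have h2 : ⁅b, ⁅x, d⁆⁆ ∈ Submodule.span K (rnComm X (s + (t + 1) + 1)) :=
      ih hb ⟨x, hx, d, hd, rfl⟩
    have h1 : ⁅x, ⁅b, d⁆⁆ ∈ Submodule.span K (rnComm X (s + t + 1 + 1)) :=
      lie_mem_of_span (S := {x}) (T := rnComm X (s + t + 1))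
        (fun x' hx' y hy => by
          rw [Set.mem_singleton_iff.1 hx']
          exact Submodule.subset_span ⟨x, hx, y, hy, rfl⟩)
        (Submodule.mem_span_singleton_self x) (ih hb hd)
    rw [lie_lie]
    refine sub_mem ?_ ?_
    · rwa [show s + 1 + t + 1 = s + t + 1 + 1 by ring]
    · rwa [show s + 1 + t + 1 = s + (t + 1) + 1 by ring]

theorem lie_mem_span_rnComm {X : Set A} {s t : ℕ} {c d : A}
    (hc : c ∈ Submodule.span K (rnComm X s)) (hd : d ∈ Submodule.span K (rnComm X t)) :
    ⁅c, d⁆ ∈ Submodule.span K (rnComm X (s + t + 1)) :=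
  lie_mem_of_span (fun _ h _ h' => lie_rnComm h h') hc hd

theorem adIter_mem_span_rnComm {X : Set A} {s t : ℕ} {c d : A}
    (hc : c ∈ Submodule.span K (rnComm X s)) (hd : d ∈ Submodule.span K (rnComm X t)) (n : ℕ) :
    adIter c n d ∈ Submodule.span K (rnComm X (n * (s + 1) + t)) := by
  induction n with
  | zero => simpa using hd
  | succ n ih =>
    rw [adIter_succ, show (n + 1) * (s + 1) + t = s + (n * (s + 1) + t) + 1 by ring]
    exact lie_mem_span_rnComm hc ih

variable (K) in
/-- The set `{[a_1, …, a_s]^(p^k) | s p^k ≤ n}` whose span has dimension `growthLieP K p X n`. -/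
def growthSet (p : ℕ) (X : Set A) (n : ℕ) : Set A :=
  {a : A | ∃ s k : ℕ, (s + 1) * p ^ k ≤ n ∧ ∃ c ∈ rnComm X s, a = c ^ p ^ k}

variable (K) in
/-- The standard filtration of `Lie_p(X)`. -/
def growthSpan (p : ℕ) (X : Set A) (n : ℕ) : Submodule K A :=
  Submodule.span K (growthSet p X n)

theorem growthLieP_eq (p : ℕ) (X : Set A) (n : ℕ) :
    growthLieP K p X n = Module.finrank K (growthSpan K p X n) := rfl

theorem growthSpan_mono (p : ℕ) (X : Set A) : Monotone (growthSpan K p X) := by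
  intro m n h
  refine Submodule.span_mono ?_
  rintro a ⟨s, k, hs, c, hc, rfl⟩
  exact ⟨s, k, hs.trans h, c, hc, rfl⟩

theorem subset_growthSpan (p : ℕ) {X : Set A} {x : A} (hx : x ∈ X) : x ∈ growthSpan K p X 1 :=
  Submodule.subset_span ⟨0, 0, by simp, x, hx, by simp⟩

theorem span_rnComm_le_growthSpan (p : ℕ) (X : Set A) {s n : ℕ} (h : s + 1 ≤ n) :
    Submodule.span K (rnComm X s) ≤ growthSpan K p X n :=
  Submodule.span_mono fun c hc => ⟨s, 0, by simpa using h, c, hc, by simp⟩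

theorem rnComm_finite {X : Set A} (hX : X.Finite) (s : ℕ) : (rnComm X s).Finite := by
  induction s with
  | zero => exact hX
  | succ s ih =>
    refine (hX.image2 (fun x b => ⁅x, b⁆) ih).subset ?_
    rintro c ⟨x, hx, b, hb, rfl⟩
    exact ⟨x, hx, b, hb, rfl⟩

theorem growthSet_finite {p : ℕ} (hp : 1 < p) {X : Set A} (hX : X.Finite) (n : ℕ) :
    (growthSet p X n).Finite := by
  have h : (⋃ s ∈ Set.Iio n, ⋃ k ∈ Set.Iio n, (fun c : A => c ^ p ^ k) '' rnComm X s).Finite :=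
    (Set.finite_Iio n).biUnion fun s _ => (Set.finite_Iio n).biUnion fun k _ =>
      (rnComm_finite hX s).image _
  refine h.subset ?_
  rintro a ⟨s, k, hs, c, hc, rfl⟩
  have h1 : 0 < p ^ k := pow_pos (by omega) k
  have h2 : k < p ^ k := Nat.lt_pow_self hp
  simp only [Set.mem_iUnion]
  refine ⟨s, ?_, k, ?_, c, hc, rfl⟩
  · have : s + 1 ≤ (s + 1) * p ^ k := Nat.le_mul_of_pos_right _ h1
    exact Set.mem_Iio.2 (by omega)
  · have : p ^ k ≤ (s + 1) * p ^ k := Nat.le_mul_of_pos_left _ (Nat.succ_pos s)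
    exact Set.mem_Iio.2 (by omega)

theorem mem_lieP {p : ℕ} {X : Set A} {x : A} : x ∈ lieP K p X ↔
    ∀ L : LieSubalgebra K A, X ⊆ L → (∀ a ∈ L, a ^ p ∈ L) → x ∈ L := by
  rw [lieP, ← SetLike.mem_coe, LieSubalgebra.coe_sInf]
  simp only [Set.mem_iInter, Set.mem_ofPred_eq, and_imp, SetLike.mem_coe]

theorem subset_lieP {p : ℕ} (X : Set A) : X ⊆ lieP K p X :=
  fun _ hx => mem_lieP.2 fun _ hL _ => hL hx

theorem pow_mem_lieP {p : ℕ} {X : Set A} {x : A} (hx : x ∈ lieP K p X) : x ^ p ∈ lieP K p X := by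
  rw [mem_lieP] at hx ⊢
  exact fun L hL hL' => hL' x (hx L hL hL')

theorem pow_pow_mem_lieP {p : ℕ} {X : Set A} {x : A} (hx : x ∈ lieP K p X) (k : ℕ) :
    x ^ p ^ k ∈ lieP K p X := by
  induction k with
  | zero => simpa using hx
  | succ k ih => rw [pow_succ, pow_mul]; exact pow_mem_lieP ih

theorem rnComm_subset_lieP {p : ℕ} (X : Set A) (s : ℕ) : rnComm X s ⊆ lieP K p X := by
  induction s with
  | zero => exact subset_lieP X
  | succ s ih =>
    rintro c ⟨x, hx, b, hb, rfl⟩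
    exact LieSubalgebra.lie_mem _ (subset_lieP X hx) (ih hb)

theorem growthSpan_le_lieP {p : ℕ} (X : Set A) (n : ℕ) :
    growthSpan K p X n ≤ (lieP K p X).toSubmodule := by
  refine Submodule.span_le.2 ?_
  rintro _ ⟨s, k, -, c, hc, rfl⟩
  exact pow_pow_mem_lieP (rnComm_subset_lieP X s hc) k

theorem growthSpan_finiteDimensional {p : ℕ} (hp : 1 < p) {X : Set A} (hX : X.Finite) (n : ℕ) :
    FiniteDimensional K (growthSpan K p X n) :=
  FiniteDimensional.span_of_finite K (growthSet_finite hp hX n)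

variable {p : ℕ} [Fact p.Prime] [CharP A p]

/-- Inside a bracket a `p ^ k`-th power acts as an iterated `ad`, so a bracket of two powers is
already a combination of plain commutators of the right length. -/
theorem lie_mem_growthSpan {X : Set A} {a b : ℕ} {x y : A} (hx : x ∈ growthSpan K p X a)
    (hy : y ∈ growthSpan K p X b) : ⁅x, y⁆ ∈ growthSpan K p X (a + b) := by
  refine lie_mem_of_span ?_ hx hy
  rintro _ ⟨s, k, hs, c, hc, rfl⟩ _ ⟨t, l, ht, d, hd, rfl⟩
  obtain ⟨n, hn⟩ : ∃ n, p ^ k = n + 1 :=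
    ⟨p ^ k - 1, by have := pow_pos (Fact.out : p.Prime).pos k; omega⟩
  have hc' := Submodule.subset_span (R := K) hc
  have hd' := Submodule.subset_span (R := K) hd
  -- One `ad c` is split off: `(ad c) ^ n` is applied to `[c, d ^ (p ^ l)] = -(ad d) ^ (p ^ l) c`,
  -- so that both powers turn into iterated brackets.
  have h := neg_mem (adIter_mem_span_rnComm hc' (neg_mem (adIter_mem_span_rnComm hd' hc' (p ^ l))) n)
  refine span_rnComm_le_growthSpan p X (s := n * (s + 1) + (p ^ l * (t + 1) + s)) ?_ ?_
  · rw [hn] at hs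
    nlinarith
  · rw [lie_pow_char_pow, hn, adIter_succ', ← lie_skew, lie_pow_char_pow]
    simpa using neg_mem h

variable [CharP K p]

theorem pow_mem_growthSpan {X : Set A} {a : ℕ} {x : A} (hx : x ∈ growthSpan K p X a) :
    x ^ p ∈ growthSpan K p X (p * a) := by
  refine pow_char_mem_of_span (F := growthSpan K p X) (S := growthSet p X a)
    lie_mem_growthSpan rfl ?_ hx
  rintro _ ⟨s, k, hs, c, hc, rfl⟩
  refine Submodule.subset_span ⟨s, k + 1, ?_, c, hc, ?_⟩
  · rw [pow_succ]; nlinarith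
  · rw [← pow_mul, pow_succ]

theorem pow_pow_mem_growthSpan {X : Set A} {a : ℕ} {x : A} (hx : x ∈ growthSpan K p X a) (k : ℕ) :
    x ^ p ^ k ∈ growthSpan K p X (p ^ k * a) := by
  induction k with
  | zero => simpa using hx
  | succ k ih =>
    have := pow_mem_growthSpan ih
    rwa [← pow_mul, ← pow_succ, ← mul_assoc, ← pow_succ'] at this

/-- The union of the filtration is itself a restricted Lie subalgebra containing `X`. -/
theorem exists_mem_growthSpan {X : Set A} {x : A} (hx : x ∈ lieP K p X) :
    ∃ n, x ∈ growthSpan K p X n := by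
  let L : LieSubalgebra K A :=
    { carrier := {x | ∃ n, x ∈ growthSpan K p X n}
      add_mem' := by
        rintro x y ⟨m, hm⟩ ⟨n, hn⟩
        exact ⟨max m n, add_mem (growthSpan_mono p X (le_max_left m n) hm)
          (growthSpan_mono p X (le_max_right m n) hn)⟩
      zero_mem' := ⟨0, zero_mem _⟩
      smul_mem' := fun c x ⟨n, hn⟩ => ⟨n, Submodule.smul_mem _ c hn⟩
      lie_mem' := fun ⟨m, hm⟩ ⟨n, hn⟩ => ⟨m + n, lie_mem_growthSpan hm hn⟩ }
  exact mem_lieP.1 hx L (fun x hx => ⟨1, subset_growthSpan p hx⟩) fun a ⟨n, hn⟩ =>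
    ⟨p * n, pow_mem_growthSpan hn⟩

end GrowthFiltration

/-! ### Lie isomorphisms and growth -/

section LieEquivGrowth

variable {K : Type*} [Field K] {A A' : Type*} [Ring A] [Algebra K A] [Ring A'] [Algebra K A']

theorem LieSubalgebra.coe_ad_pow_eq_adIter (L : LieSubalgebra K A) (a b : L) (n : ℕ) :
    (((LieAlgebra.ad K L a ^ n) b : L) : A) = adIter (a : A) n b := by
  induction n with
  | zero => simp
  | succ n ih =>
    rw [pow_succ', Module.End.mul_apply, LieAlgebra.ad_apply, LieSubalgebra.coe_bracket, ih,
      adIter_succ]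

theorem LieEquiv.map_ad_pow {L L' : Type*} [LieRing L] [LieAlgebra K L] [LieRing L']
    [LieAlgebra K L'] (φ : L ≃ₗ⁅K⁆ L') (a b : L) (n : ℕ) :
    φ ((LieAlgebra.ad K L a ^ n) b) = (LieAlgebra.ad K L' (φ a) ^ n) (φ b) := by
  induction n with
  | zero => simp
  | succ n ih =>
    rw [pow_succ', Module.End.mul_apply, LieAlgebra.ad_apply, LieEquiv.map_lie, ih, pow_succ',
      Module.End.mul_apply, LieAlgebra.ad_apply]

variable {p : ℕ} [Fact p.Prime] [CharP A p] [CharP A' p]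

/-- A Lie isomorphism onto a restricted Lie algebra with zero centre is compatible with `p`-th
powers. -/
theorem LieEquiv.map_pow_char {X : Set A} {X' : Set A'}
    (hc : ∀ z ∈ lieP K p X', (∀ y ∈ lieP K p X', ⁅z, y⁆ = 0) → z = 0)
    (φ : lieP K p X ≃ₗ⁅K⁆ lieP K p X') (a : lieP K p X) :
    (φ ⟨(a : A) ^ p, pow_mem_lieP a.2⟩ : A') = (φ a : A') ^ p := by
  rw [← sub_eq_zero]
  -- Both terms have adjoint action `(ad (φ a)) ^ p`, so their difference is central.
  refine hc _ (sub_mem (φ _).2 (pow_mem_lieP (φ a).2)) fun y hy => ?_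
  obtain ⟨b, hb⟩ := φ.surjective ⟨y, hy⟩
  have hby : (φ b : A') = y := congrArg Subtype.val hb
  have h1 : (⁅(⟨(a : A) ^ p, pow_mem_lieP a.2⟩ : lieP K p X), b⁆) =
      (LieAlgebra.ad K (lieP K p X) a ^ p) b := by
    apply Subtype.ext
    rw [LieSubalgebra.coe_ad_pow_eq_adIter, LieSubalgebra.coe_bracket, ← lie_pow_char]
  rw [sub_lie, sub_eq_zero, lie_pow_char, ← hby, ← LieSubalgebra.coe_bracket, ← LieEquiv.map_lie,
    h1, LieEquiv.map_ad_pow, LieSubalgebra.coe_ad_pow_eq_adIter]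

variable [CharP K p]

/-- The finitely many generators land in some degree `C + 1` of the target filtration. Brackets add
degrees and the `p`-map, which the isomorphism respects for lack of a centre, multiplies them by
`p`, so degree `n` goes into degree `(C + 1) * n`. -/
theorem growthLieP_le_of_lieEquiv {X : Set A} {X' : Set A'} (hX : X.Finite) (hX' : X'.Finite)
    (hc : ∀ z ∈ lieP K p X', (∀ y ∈ lieP K p X', ⁅z, y⁆ = 0) → z = 0)
    (φ : lieP K p X ≃ₗ⁅K⁆ lieP K p X') :
    ∃ C : ℕ, 0 < C ∧ ∀ n, growthLieP K p X n ≤ growthLieP K p X' (C * n) := by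
  -- The degree is chosen for every element of `A`, with value `0` outside the algebra, so that a
  -- finite supremum over `X` can be taken.
  have h0 : ∀ x : A, ∃ n, ∀ hx : x ∈ lieP K p X, (φ ⟨x, hx⟩ : A') ∈ growthSpan K p X' n := by
    intro x
    by_cases hx : x ∈ lieP K p X
    · obtain ⟨n, hn⟩ := exists_mem_growthSpan (φ ⟨x, hx⟩).2
      exact ⟨n, fun _ => hn⟩
    · exact ⟨0, fun h => absurd h hx⟩
  choose f hf using h0
  obtain ⟨C, hC⟩ : ∃ C, ∀ x ∈ X, f x ≤ C :=
    ⟨hX.toFinset.sup f, fun x hx => Finset.le_sup (hX.mem_toFinset.2 hx)⟩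
  have hrn : ∀ s, ∀ c ∈ rnComm X s, ∀ h : c ∈ lieP K p X,
      (φ ⟨c, h⟩ : A') ∈ growthSpan K p X' ((C + 1) * (s + 1)) := by
    intro s
    induction s with
    | zero =>
      intro c hc h
      exact growthSpan_mono p X' (by have := hC c hc; omega) (hf c h)
    | succ s ih =>
      rintro c ⟨x, hx, b, hb, rfl⟩ h
      have hx' := subset_lieP (K := K) (p := p) X hx
      have hb' := rnComm_subset_lieP (K := K) (p := p) X s hb
      have e : (⟨⁅x, b⁆, h⟩ : lieP K p X) = ⁅(⟨x, hx'⟩ : lieP K p X), ⟨b, hb'⟩⁆ := rfl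
      rw [e, LieEquiv.map_lie, LieSubalgebra.coe_bracket,
        show (C + 1) * (s + 1 + 1) = (C + 1) + (C + 1) * (s + 1) by ring]
      exact lie_mem_growthSpan
        (growthSpan_mono p X' (by have := hC x hx; omega) (hf x hx')) (ih b hb hb')
  have hpow : ∀ (a : lieP K p X) (k : ℕ),
      (φ ⟨(a : A) ^ p ^ k, pow_pow_mem_lieP a.2 k⟩ : A') = (φ a : A') ^ p ^ k := by
    intro a k
    induction k with
    | zero => simp
    | succ k ih =>
      have := LieEquiv.map_pow_char hc φ ⟨(a : A) ^ p ^ k, pow_pow_mem_lieP a.2 k⟩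
      simp only [ih, ← pow_mul, ← pow_succ] at this
      exact this
  refine ⟨C + 1, C.succ_pos, fun n => ?_⟩
  have hV : ∀ v : growthSpan K p X n,
      (φ ⟨v, growthSpan_le_lieP X n v.2⟩ : A') ∈ growthSpan K p X' ((C + 1) * n) := by
    rintro ⟨v, hv⟩
    suffices H : ∀ v ∈ growthSpan K p X n, ∀ h : v ∈ lieP K p X,
        (φ ⟨v, h⟩ : A') ∈ growthSpan K p X' ((C + 1) * n) from H v hv _
    intro v hv
    induction hv using Submodule.span_induction with
    | mem v hv =>
      obtain ⟨s, k, hs, c, hc, rfl⟩ := hv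
      intro h
      have hc' := rnComm_subset_lieP (K := K) (p := p) X s hc
      have h1 := hpow ⟨c, hc'⟩ k
      have h2 := pow_pow_mem_growthSpan (hrn s c hc hc') k
      rw [h1]
      refine growthSpan_mono p X' ?_ h2
      calc p ^ k * ((C + 1) * (s + 1)) = (C + 1) * ((s + 1) * p ^ k) := by ring
        _ ≤ _ := Nat.mul_le_mul_left _ hs
    | zero =>
      intro h
      have e : (⟨0, h⟩ : lieP K p X) = 0 := rfl
      rw [e, map_zero]
      exact zero_mem _
    | add x y hx hy ihx ihy =>
      intro h
      have hx' : x ∈ lieP K p X := growthSpan_le_lieP X n hx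
      have hy' : y ∈ lieP K p X := growthSpan_le_lieP X n hy
      have e : (⟨x + y, h⟩ : lieP K p X) = ⟨x, hx'⟩ + ⟨y, hy'⟩ := rfl
      rw [e, map_add]
      exact add_mem (ihx hx') (ihy hy')
    | smul c x hx ihx =>
      intro h
      have hx' : x ∈ lieP K p X := growthSpan_le_lieP X n hx
      have e : (⟨c • x, h⟩ : lieP K p X) = c • ⟨x, hx'⟩ := rfl
      rw [e, map_smul]
      exact Submodule.smul_mem _ c (ihx hx')
  have := growthSpan_finiteDimensional (K := K) (Fact.out : p.Prime).one_lt hX' ((C + 1) * n)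
  let ψ : growthSpan K p X n →ₗ[K] A' := (lieP K p X').toSubmodule.subtype ∘ₗ
    φ.toLinearEquiv.toLinearMap ∘ₗ Submodule.inclusion (growthSpan_le_lieP X n)
  have hψ : Function.Injective ψ := Subtype.val_injective.comp
    (φ.injective.comp (Submodule.inclusion_injective (growthSpan_le_lieP X n)))
  rw [growthLieP_eq, growthLieP_eq]
  refine LinearMap.finrank_le_finrank_of_injective (f := ψ.codRestrict _ hV) fun v w h => hψ ?_
  have h1 := congrArg Subtype.val h
  exact h1

end LieEquivGrowth

/-! ### Divided power algebras: homogeneous elements and special derivations -/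

namespace DPAlg

section Homogeneous

variable {Θ : Type*} {K : Type*} [Field K] {p : ℕ} {S : Θ → ℕ}

theorem monoZ_of_lt {γ : Θ →₀ ℕ} (h : ∀ a, γ a < p ^ S a) :
    monoZ K p S γ = mono K ⟨γ, h⟩ := dif_pos h

theorem monoZ_of_not {γ : Θ →₀ ℕ} (h : ¬ ∀ a, γ a < p ^ S a) : monoZ K p S γ = 0 := dif_neg h

theorem linearIndependent_mono : LinearIndependent K (mono (p := p) (S := S) K) :=
  (Finsupp.basisSingleOne (R := K) (ι := DPExponent p S)).linearIndependent

/-- The elements involving only the variables in `T` that are homogeneous of degree `k`, where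
the variable `t_a` has degree `ω a`. -/
noncomputable def homog (K : Type*) [Field K] (p : ℕ) (S : Θ → ℕ) (ω : Θ → ℕ) (T : Set Θ) (k : ℤ) :
    Submodule K (DPAlg K p S) :=
  Submodule.span K (mono K '' {α | (α.1.support : Set Θ) ⊆ T ∧ (Finsupp.weight ω α.1 : ℤ) = k})

variable {ω : Θ → ℕ} {T : Set Θ}

theorem monoZ_mem_homog {γ : Θ →₀ ℕ} {k : ℤ} (h : (γ.support : Set Θ) ⊆ T)
    (hk : (Finsupp.weight ω γ : ℤ) = k) : monoZ K p S γ ∈ homog K p S ω T k := by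
  by_cases hγ : ∀ a, γ a < p ^ S a
  · rw [monoZ_of_lt hγ]
    exact Submodule.subset_span ⟨_, ⟨h, hk⟩, rfl⟩
  · rw [monoZ_of_not hγ]
    exact zero_mem _

theorem homog_mono {T' : Set Θ} (h : T ⊆ T') (k : ℤ) :
    homog K p S ω T k ≤ homog K p S ω T' k :=
  Submodule.span_mono (Set.image_mono fun _ hα => ⟨hα.1.trans h, hα.2⟩)

theorem dpow_mem_homog {a : Θ} (ha : a ∈ T) (i : ℕ) :
    dpow K p S a i ∈ homog K p S ω T (i * ω a : ℤ) := by
  refine monoZ_mem_homog (fun b hb => ?_) ?_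
  · have := Finsupp.support_single_subset hb
    rw [Finset.mem_singleton] at this
    rwa [this]
  · rw [Finsupp.weight_single]
    simp

theorem mul_mem_homog {f g : DPAlg K p S} {k l : ℤ} (hf : f ∈ homog K p S ω T k)
    (hg : g ∈ homog K p S ω T l) : f * g ∈ homog K p S ω T (k + l) := by
  classical
  rw [mul_def]
  induction hf using Submodule.span_induction with
  | mem f hf =>
    obtain ⟨α, ⟨hα, hαk⟩, rfl⟩ := hf
    induction hg using Submodule.span_induction with
    | mem g hg =>
      obtain ⟨β, ⟨hβ, hβl⟩, rfl⟩ := hg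
      rw [← mul_def, mono_mul_mono]
      refine Submodule.smul_mem _ _ (monoZ_mem_homog (fun a ha => ?_) ?_)
      · rcases Finset.mem_union.1 (Finsupp.support_add ha) with h | h
        · exact hα h
        · exact hβ h
      · rw [map_add, Nat.cast_add, hαk, hβl]
    | zero => simp
    | add x y _ _ hx hy => rw [map_add]; exact add_mem hx hy
    | smul c x _ hx => rw [map_smul]; exact Submodule.smul_mem _ _ hx
  | zero => simp
  | add x y _ _ hx hy => rw [map_add]; exact add_mem hx hy
  | smul c x _ hx => rw [map_smul]; exact Submodule.smul_mem _ _ hx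

theorem dpow_eq_zero {a : Θ} {i : ℕ} (h : p ^ S a ≤ i) : dpow K p S a i = 0 :=
  monoZ_of_not fun h' => by
    have := h' a
    rw [Finsupp.single_eq_same] at this
    omega

theorem single_lt (hp : 0 < p) {a : Θ} {i : ℕ} (h : i < p ^ S a) :
    ∀ b, (Finsupp.single a i : Θ →₀ ℕ) b < p ^ S b := by
  intro b
  by_cases hb : b = a
  · subst hb; simpa using h
  · rw [Finsupp.single_eq_of_ne hb]; exact pow_pos hp _

theorem tsub_single_lt {γ : Θ →₀ ℕ} (h : ∀ a, γ a < p ^ S a) (a : Θ) :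
    ∀ b, (γ - Finsupp.single a 1 : Θ →₀ ℕ) b < p ^ S b := fun b =>
  (Nat.sub_le _ _).trans_lt (h b)

theorem dpow_of_lt (hp : 0 < p) {a : Θ} {i : ℕ} (h : i < p ^ S a) :
    dpow K p S a i = mono K ⟨Finsupp.single a i, single_lt hp h⟩ := monoZ_of_lt _

theorem dpow_mul_mono (a : Θ) (i : ℕ) (α : DPExponent p S) :
    dpow K p S a i * mono K α = (binom (Finsupp.single a i) α.1 : K) •
      monoZ K p S (Finsupp.single a i + α.1) := monoZ_mul_mono _ _

theorem dpow_mul_dpow_eq_zero (hp : 0 < p) {a : Θ} {i j : ℕ} (h : p ^ S a ≤ i + j) :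
    dpow K p S a i * dpow K p S a j = 0 := by
  by_cases hj : j < p ^ S a
  · rw [dpow_of_lt hp hj, dpow_mul_mono, monoZ_of_not, smul_zero]
    intro h'
    have := h' a
    simp only [Finsupp.add_apply, Finsupp.single_eq_same] at this
    omega
  · rw [dpow_eq_zero (not_lt.1 hj), mul_def, map_zero]

theorem dpow_mul_mono_of_apply_eq_zero (a : Θ) (i : ℕ) (α : DPExponent p S)
    (h : α.1 a = 0) : dpow K p S a i * mono K α = monoZ K p S (Finsupp.single a i + α.1) := by
  classical
  rw [dpow_mul_mono]
  have : binom (Finsupp.single a i) α.1 = 1 := by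
    rw [binom]
    refine Finset.prod_eq_one fun b _ => ?_
    by_cases hb : b = a
    · subst hb; simp [h]
    · simp [Finsupp.single_eq_of_ne hb]
  rw [this, Nat.cast_one, one_smul]

end Homogeneous

section Derivations

variable {Θ : Type*} {K : Type*} [Field K] {p : ℕ} [Fact p.Prime] {S : Θ → ℕ}
variable {ω : Θ → ℕ} {T : Set Θ}

instance : Nontrivial (DPAlg K p S) :=
  inferInstanceAs (Nontrivial (DPExponent p S →₀ K))

instance [CharP K p] : CharP (Module.End K (DPAlg K p S)) p :=
  charP_of_injective_algebraMap (algebraMap K (Module.End K (DPAlg K p S))).injective p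

theorem mono_zero : mono K (0 : DPExponent p S) = 1 := rfl

theorem dpow_zero (a : Θ) : dpow K p S a 0 = 1 := by
  rw [dpow_of_lt (Fact.out : p.Prime).pos (pow_pos (Fact.out : p.Prime).pos _), ← mono_zero]
  congr 1
  exact Subtype.ext (Finsupp.single_zero a)

theorem one_mem_homog : (1 : DPAlg K p S) ∈ homog K p S ω T 0 :=
  Submodule.subset_span ⟨0, ⟨by
    have : ((0 : DPExponent p S) : Θ →₀ ℕ) = 0 := rfl
    simp [this], by
    have : ((0 : DPExponent p S) : Θ →₀ ℕ) = 0 := rfl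
    simp [this]⟩, rfl⟩

open Classical in
theorem pd_mono (a : Θ) (α : DPExponent p S) : pd a (mono K α) =
    if α.1 a = 0 then 0 else monoZ K p S (α.1 - Finsupp.single a 1) := ext_mono _ _

open Classical in
theorem pd_monoZ (a : Θ) {γ : Θ →₀ ℕ} (h : ∀ a, γ a < p ^ S a) : pd a (monoZ K p S γ) =
    if γ a = 0 then 0 else monoZ K p S (γ - Finsupp.single a 1) := by
  rw [monoZ_of_lt h, pd_mono]

theorem pd_comm (a b : Θ) (f : DPAlg K p S) : pd a (pd b f) = pd b (pd a f) := by
  classical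
  suffices H : (pd a ∘ₗ pd b : DPAlg K p S →ₗ[K] DPAlg K p S) = pd b ∘ₗ pd a from
    LinearMap.congr_fun H f
  refine hom_ext fun α => ?_
  rw [LinearMap.comp_apply, LinearMap.comp_apply]
  by_cases hab : a = b
  · rw [hab]
  rw [pd_mono, pd_mono]
  have h1 := tsub_single_lt (p := p) (S := S) α.2 a
  have h2 := tsub_single_lt (p := p) (S := S) α.2 b
  have e1 : (α.1 - Finsupp.single b 1 : Θ →₀ ℕ) a = α.1 a := by
    rw [Finsupp.tsub_apply, Finsupp.single_eq_of_ne hab, Nat.sub_zero]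
  have e2 : (α.1 - Finsupp.single a 1 : Θ →₀ ℕ) b = α.1 b := by
    rw [Finsupp.tsub_apply, Finsupp.single_eq_of_ne (Ne.symm hab), Nat.sub_zero]
  by_cases hb : α.1 b = 0 <;> by_cases ha : α.1 a = 0
  · simp [ha, hb]
  · rw [if_pos hb, if_neg ha, map_zero, pd_monoZ _ h1, e2, if_pos hb]
  · rw [if_pos ha, if_neg hb, map_zero, pd_monoZ _ h2, e1, if_pos ha]
  · rw [if_neg ha, if_neg hb, pd_monoZ _ h1, pd_monoZ _ h2, e1, e2, if_neg ha, if_neg hb,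
      tsub_right_comm]

theorem pd_dpow_succ {a : Θ} {i : ℕ} (h : i + 1 < p ^ S a) :
    pd a (dpow K p S a (i + 1)) = dpow K p S a i := by
  classical
  rw [dpow, pd_monoZ _ (single_lt (Fact.out : p.Prime).pos h), if_neg (by simp), dpow,
    ← Finsupp.single_tsub]
  rfl

theorem pd_mem_homog {f : DPAlg K p S} {k : ℤ} (a : Θ) (hf : f ∈ homog K p S ω T k) :
    pd a f ∈ homog K p S ω T (k - ω a) := by
  classical
  induction hf using Submodule.span_induction with
  | mem f hf =>
    obtain ⟨α, ⟨hα, hαk⟩, rfl⟩ := hf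
    rw [pd_mono]
    split_ifs with h
    · exact zero_mem _
    · have h1 : Finsupp.single a 1 ≤ α.1 := by
        rw [Finsupp.single_le_iff]; omega
      refine monoZ_mem_homog (fun b hb => hα ?_) ?_
      · simp only [Finset.mem_coe, Finsupp.mem_support_iff, Finsupp.tsub_apply] at hb ⊢
        omega
      · have h2 := congrArg (Finsupp.weight ω) (tsub_add_cancel_of_le h1)
        rw [map_add, Finsupp.weight_single, one_smul] at h2
        rw [← hαk, ← h2]
        push_cast
        ring
  | zero => simp
  | add x y _ _ hx hy => rw [map_add]; exact add_mem hx hy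
  | smul c x _ hx => rw [map_smul]; exact Submodule.smul_mem _ _ hx

theorem pd_eq_zero_of_mem {f : DPAlg K p S} {k : ℤ} {a : Θ} (ha : a ∉ T)
    (hf : f ∈ homog K p S ω T k) : pd a f = 0 := by
  induction hf using Submodule.span_induction with
  | mem f hf =>
    obtain ⟨α, ⟨hα, hαk⟩, rfl⟩ := hf
    refine pd_mono_eq_zero a α ?_
    by_contra h
    exact ha (hα (Finsupp.mem_support_iff.2 h))
  | zero => simp
  | add x y _ _ hx hy => rw [map_add, hx, hy, add_zero]
  | smul c x _ hx => rw [map_smul, hx, smul_zero]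

theorem der_ext {D E : Derivation K (DPAlg K p S) (DPAlg K p S)}
    (h : ∀ α, D (mono K α) = E (mono K α)) : D = E := by
  have : (D : DPAlg K p S →ₗ[K] DPAlg K p S) = E := hom_ext h
  exact Derivation.ext fun x => LinearMap.congr_fun this x

variable [CharP K p]

theorem partialDer_apply (a : Θ) (f : DPAlg K p S) : partialDer a f = pd a f := by
  suffices H : ((partialDer a : Derivation K (DPAlg K p S) (DPAlg K p S)) :
      DPAlg K p S →ₗ[K] DPAlg K p S) = pd a from LinearMap.congr_fun H f
  exact hom_ext fun α => partialDer_mono a α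

theorem vecField_eq_zero_of_mem {f : Θ → DPAlg K p S} {g : DPAlg K p S} {k : ℤ}
    (hf : ∀ a ∈ T, f a = 0) (hg : g ∈ homog K p S ω T k) : vecField f g = 0 := by
  induction hg using Submodule.span_induction with
  | mem g hg =>
    obtain ⟨α, ⟨hα, hαk⟩, rfl⟩ := hg
    rw [vecField_mono]
    refine Finset.sum_eq_zero fun a ha => ?_
    rw [hf a (hα ha), zero_mul]
  | zero => simp
  | add x y _ _ hx hy => rw [map_add, hx, hy, add_zero]
  | smul c x _ hx => rw [Derivation.map_smul, hx, smul_zero]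

theorem vecField_mono_of_subset (f : Θ → DPAlg K p S) (α : DPExponent p S) {s : Finset Θ}
    (h : α.1.support ⊆ s) : vecField f (mono K α) = ∑ a ∈ s, f a * pd a (mono K α) :=
  vecFieldₗ_mono f α s h

theorem vecField_dpow (f : Θ → DPAlg K p S) (a : Θ) (i : ℕ) :
    vecField f (dpow K p S a i) = f a * pd a (dpow K p S a i) := by
  by_cases hi : i < p ^ S a
  · rw [dpow_of_lt (Fact.out : p.Prime).pos hi,
      vecField_mono_of_subset f _ (s := {a}) Finsupp.support_single_subset, Finset.sum_singleton]
  · rw [dpow_eq_zero (not_lt.1 hi), map_zero, map_zero, mul_zero]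

/-- The second-order terms cancel because partial derivations commute. Infinite families of
coefficients cause no trouble, since everything is tested on one monomial with finite support. -/
theorem vecField_lie (f g : Θ → DPAlg K p S) :
    ⁅(vecField f : Derivation K (DPAlg K p S) (DPAlg K p S)), vecField g⁆ =
      vecField fun a => vecField f (g a) - vecField g (f a) := by
  classical
  have key : ∀ (f g : Θ → DPAlg K p S) (α : DPExponent p S), vecField f (vecField g (mono K α)) =
      ∑ a ∈ α.1.support, vecField f (g a) * pd a (mono K α) +
      ∑ a ∈ α.1.support, ∑ b ∈ α.1.support, g a * f b * pd a (pd b (mono K α)) := by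
    intro f g α
    rw [vecField_mono, map_sum, ← Finset.sum_add_distrib]
    refine Finset.sum_congr rfl fun a _ => ?_
    have h1 : vecField f (pd a (mono K α)) =
        ∑ b ∈ α.1.support, f b * pd b (pd a (mono K α)) := by
      rw [pd_mono]
      split_ifs with h
      · simp
      · rw [monoZ_of_lt (tsub_single_lt α.2 a), vecField_mono_of_subset]
        intro b hb
        simp only [Finsupp.mem_support_iff, Finsupp.tsub_apply] at hb ⊢
        omega
    rw [Derivation.leibniz, h1, smul_eq_mul, smul_eq_mul, Finset.mul_sum, add_comm, mul_comm]
    congr 1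
    refine Finset.sum_congr rfl fun b _ => ?_
    rw [pd_comm, mul_assoc]
  refine der_ext fun α => ?_
  rw [Derivation.commutator_apply, key, key, vecField_mono, Finset.sum_comm
    (s := α.1.support) (t := α.1.support)
    (f := fun a b => f a * g b * pd a (pd b (mono K α)))]
  have : ∑ y ∈ α.1.support, ∑ x ∈ α.1.support, f x * g y * pd x (pd y (mono K α)) =
      ∑ a ∈ α.1.support, ∑ b ∈ α.1.support, g a * f b * pd a (pd b (mono K α)) :=
    Finset.sum_congr rfl fun a _ => Finset.sum_congr rfl fun b _ => by
      rw [pd_comm, mul_comm (f b)]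
  rw [this, add_sub_add_right_eq_sub, ← Finset.sum_sub_distrib]
  exact Finset.sum_congr rfl fun a _ => (sub_mul _ _ _).symm

theorem partialDer_lie_vecField (a : Θ) (f : Θ → DPAlg K p S) (h : ∀ b, pd a (f b) = 0) :
    ⁅(partialDer a : Derivation K (DPAlg K p S) (DPAlg K p S)), vecField f⁆ = 0 := by
  classical
  have h0 : (fun b => vecField (Pi.single a 1) (f b) -
      vecField f ((Pi.single a 1 : Θ → DPAlg K p S) b)) = fun _ => 0 := by
    funext b
    have h1 : vecField (Pi.single a 1) (f b) = 0 := by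
      have := partialDer_apply a (f b)
      rw [h] at this
      exact this
    have h2 : vecField f ((Pi.single a 1 : Θ → DPAlg K p S) b) = 0 := by
      by_cases hb : b = a
      · subst hb; simp
      · simp [Pi.single_eq_of_ne hb]
    rw [h1, h2, sub_zero]
  have h3 : partialDer a = (vecField (Pi.single a 1) :
      Derivation K (DPAlg K p S) (DPAlg K p S)) := rfl
  rw [h3, vecField_lie, h0]
  exact der_ext fun α => by simp [vecField_mono]

theorem partialDer_lie_partialDer (a b : Θ) :
    ⁅(partialDer a : Derivation K (DPAlg K p S) (DPAlg K p S)),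
      (partialDer b : Derivation K (DPAlg K p S) (DPAlg K p S))⁆ = 0 := by
  refine Derivation.ext fun f => ?_
  rw [Derivation.commutator_apply]
  simp only [partialDer_apply]
  rw [pd_comm, sub_self, Derivation.coe_zero, Pi.zero_apply]

end Derivations

end DPAlg

/-! ### Nilpotency of divided powers and `p`-th powers of special derivations. -/

namespace DPAlg

section Powers

variable {Θ : Type*} {K : Type*} [Field K] {p : ℕ} [Fact p.Prime] {S : Θ → ℕ}

/-- Absorption: `i * binom (p i) i = p i * binom (p i - 1) (i - 1)`. -/
theorem prime_dvd_choose_mul {p i : ℕ} (hp : 0 < p) (hi : 0 < i) : p ∣ (p * i).choose i := by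
  obtain ⟨j, rfl⟩ : ∃ j, i = j + 1 := ⟨i - 1, by omega⟩
  obtain ⟨n, hn⟩ : ∃ n, p * (j + 1) = n + 1 :=
    ⟨p * (j + 1) - 1, by have := Nat.mul_pos hp j.succ_pos; rw [Nat.sub_add_cancel this]⟩
  have h := Nat.add_one_mul_choose_eq n j
  rw [← hn] at h
  have h2 : p * n.choose j * (j + 1) = (p * (j + 1)).choose (j + 1) * (j + 1) := by
    rw [← h]; ring
  exact ⟨n.choose j, (Nat.eq_of_mul_eq_mul_right (Nat.succ_pos j) h2).symm⟩

/-- The last of the `p` multiplications brings in the factor `binom (p α_a) (α_a)` for a variable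
with `α_a ≠ 0`, and this is divisible by `p`. -/
theorem mono_pow_char [CharP K p] {α : DPExponent p S} (hα : α.1 ≠ 0) : mono K α ^ p = 0 := by
  have hp := (Fact.out : p.Prime).pos
  have h : ∀ n : ℕ, ∃ c : K, mono K α ^ n = c • monoZ K p S (n • α.1) := by
    intro n
    induction n with
    | zero =>
      refine ⟨1, ?_⟩
      rw [pow_zero, zero_smul, one_smul, ← mono_zero]
      exact (monoZ_coe (0 : DPExponent p S)).symm
    | succ n ih =>
      obtain ⟨c, hc⟩ := ih
      refine ⟨c * (binom (n • α.1) α.1 : K), ?_⟩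
      rw [pow_succ, hc, smul_mul_assoc, monoZ_mul_mono, smul_smul, succ_nsmul]
  obtain ⟨c, hc⟩ := h (p - 1)
  obtain ⟨a, ha⟩ : ∃ a, α.1 a ≠ 0 := by
    by_contra h'
    push Not at h'
    exact hα (Finsupp.ext h')
  have hd : p ∣ binom ((p - 1) • α.1) α.1 := by
    classical
    refine dvd_trans ?_ (Finset.dvd_prod_of_mem _
      (show a ∈ ((p - 1) • α.1 + α.1).support by
        simp only [Finsupp.mem_support_iff, Finsupp.add_apply]; omega))
    have e : ((p - 1) • α.1 : Θ →₀ ℕ) a + α.1 a = p * α.1 a := by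
      rw [Finsupp.smul_apply, smul_eq_mul, ← Nat.succ_mul, Nat.succ_eq_add_one,
        Nat.sub_add_cancel hp]
    rw [Nat.choose_symm_add, e]
    exact prime_dvd_choose_mul hp (Nat.pos_of_ne_zero ha)
  have h1 : mono K α ^ p = mono K α ^ (p - 1) * mono K α := by
    rw [← pow_succ, Nat.sub_add_cancel hp]
  rw [h1, hc, smul_mul_assoc, monoZ_mul_mono, (CharP.cast_eq_zero_iff K p _).2 hd, zero_smul,
    smul_zero]

theorem dpow_pow_char [CharP K p] {a : Θ} {i : ℕ} (hi : 0 < i) : dpow K p S a i ^ p = 0 := by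
  by_cases h : i < p ^ S a
  · rw [dpow_of_lt (Fact.out : p.Prime).pos h]
    refine mono_pow_char fun h0 => ?_
    have := DFunLike.congr_fun h0 a
    simp at this
    omega
  · rw [dpow_eq_zero (not_lt.1 h), zero_pow (Fact.out : p.Prime).ne_zero]

theorem pd_iterate_dpow {a : Θ} {i n : ℕ} (h : i < p ^ S a) (hn : n ≤ i) :
    (pd a)^[n] (dpow K p S a i) = dpow K p S a (i - n) := by
  induction n generalizing i with
  | zero => rfl
  | succ n ih =>
    obtain ⟨j, rfl⟩ : ∃ j, i = j + 1 := ⟨i - 1, by omega⟩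
    rw [Function.iterate_succ_apply, pd_dpow_succ h, ih (by omega) (by omega),
      Nat.add_sub_add_right]

theorem pd_iterate_eq_zero (a : Θ) (f : DPAlg K p S) : (pd a)^[p ^ S a] f = 0 := by
  classical
  suffices H : (pd a : Module.End K (DPAlg K p S)) ^ (p ^ S a) = 0 by
    rw [← Module.End.pow_apply, H, LinearMap.zero_apply]
  have key : ∀ (n : ℕ) (γ : DPExponent p S), γ.1 a < n → (pd a)^[n] (mono K γ) = 0 := by
    intro n
    induction n with
    | zero => intro γ h; omega
    | succ n ih =>
      intro γ h
      rw [Function.iterate_succ_apply, pd_mono]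
      split_ifs with h0
      · rw [← Module.End.pow_apply, map_zero]
      · rw [monoZ_of_lt (tsub_single_lt γ.2 a)]
        refine ih _ ?_
        simp only [Finsupp.tsub_apply, Finsupp.single_eq_same]
        omega
  refine hom_ext fun α => ?_
  rw [Module.End.pow_apply, key _ _ (α.2 a), LinearMap.zero_apply]

section DerivationCalculus

variable {R : Type*} [CommRing R] [Algebra K R]

theorem lie_smul_der (D E : Derivation K R R) (f : R) : ⁅D, f • E⁆ = D f • E + f • ⁅D, E⁆ := by
  ext x
  simp only [Derivation.commutator_apply, Derivation.smul_apply, Derivation.leibniz,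
    Derivation.add_apply, smul_eq_mul]
  ring

theorem smul_lie_der (D E : Derivation K R R) (f : R) : ⁅f • D, E⁆ = f • ⁅D, E⁆ - E f • D := by
  rw [← lie_skew, lie_smul_der, ← lie_skew]
  simp only [smul_neg, neg_add, neg_neg]
  abel

/-- The function `f` is a constant for `E`, so it can be pulled out at each step. -/
theorem smul_der_pow_apply (E : Derivation K R R) {f : R} (hf : E f = 0) (n : ℕ) (x : R) :
    ((((f • E : Derivation K R R) : Module.End K R)) ^ n) x =
      f ^ n * (((E : Module.End K R)) ^ n) x := by
  induction n with
  | zero => simp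
  | succ n ih =>
    have h : E (f ^ n) = 0 := by rw [Derivation.leibniz_pow, hf]; simp
    rw [pow_succ', Module.End.mul_apply, ih, pow_succ' (E : Module.End K R), Module.End.mul_apply]
    simp only [Derivation.coeFn_coe, Derivation.smul_apply, Derivation.leibniz, smul_eq_mul, h]
    ring

theorem adIter_coe_smul_der (D E : Derivation K R R) (hDE : ⁅D, E⁆ = 0) (f : R) (n : ℕ) :
    adIter (D : Module.End K R) n ((f • E : Derivation K R R) : Module.End K R) =
      (((D^[n] f) • E : Derivation K R R) : Module.End K R) := by
  induction n with
  | zero => rfl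
  | succ n ih =>
    rw [adIter_succ, ih, ← Derivation.commutator_coe_linear_map, lie_smul_der, hDE, smul_zero,
      add_zero, Function.iterate_succ_apply']

theorem der_apply_iterate_eq_zero (D E : Derivation K R R) (hDE : ⁅D, E⁆ = 0) {f : R}
    (hf : E f = 0) (n : ℕ) : E (D^[n] f) = 0 := by
  induction n with
  | zero => exact hf
  | succ n ih =>
    have := congrArg (fun F : Derivation K R R => F (D^[n] f)) hDE
    simp only [Derivation.commutator_apply, Derivation.coe_zero, Pi.zero_apply, ih, map_zero,
      zero_sub, neg_eq_zero] at this
    rw [Function.iterate_succ_apply', this]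

end DerivationCalculus

variable [CharP K p]

/-- If `E` commutes with `∂_a` and kills `t_a` and `h`, and `h` does not involve `t_a`, then
`(∂_a + t_a^(top) h E) ^ (p ^ S a) = h E`. -/
theorem partialDer_add_top_pow {a : Θ} {h : DPAlg K p S}
    {E : Derivation K (DPAlg K p S) (DPAlg K p S)}
    (hcomm : ⁅(partialDer a : Derivation K (DPAlg K p S) (DPAlg K p S)), E⁆ = 0)
    (hE : ∀ i, E (dpow K p S a i) = 0) (hEh : E h = 0) (hh : pd a h = 0) :
    (((partialDer a + (dpow K p S a (p ^ S a - 1) * h) • E :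
      Derivation K (DPAlg K p S) (DPAlg K p S)) : Module.End K (DPAlg K p S))) ^ p ^ S a =
      ((h • E : Derivation K (DPAlg K p S) (DPAlg K p S)) : Module.End K (DPAlg K p S)) := by
  have hp := (Fact.out : p.Prime)
  let D : Derivation K (DPAlg K p S) (DPAlg K p S) := partialDer a
  have hD : ∀ (n : ℕ) (f : DPAlg K p S), D^[n] f = (pd a)^[n] f := by
    intro n f
    have : (D : DPAlg K p S → DPAlg K p S) = pd a := funext (partialDer_apply a)
    rw [this]
  have hmul : ∀ (n : ℕ) (f : DPAlg K p S), (pd a)^[n] (f * h) = (pd a)^[n] f * h := by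
    intro n f
    induction n with
    | zero => rfl
    | succ n ih =>
      rw [Function.iterate_succ_apply', ih, Function.iterate_succ_apply', ← partialDer_apply,
        Derivation.leibniz, partialDer_apply, hh, smul_zero, zero_add, smul_eq_mul, mul_comm,
        partialDer_apply]
  have hD0 : (D : Module.End K (DPAlg K p S)) ^ p ^ S a = 0 := by
    refine LinearMap.ext fun f => ?_
    rw [Module.End.pow_apply]
    exact (hD _ f).trans (pd_iterate_eq_zero a f)
  -- Induction on `k`: each `p`-th power lowers the exponent from `p ^ S a - p ^ k` to `p ^ S a - p
  -- ^ (k + 1)`. At `k = S a` the exponent is zero and the pure power of `∂_a` vanishes.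
  have key : ∀ k ≤ S a, ((D + (dpow K p S a (p ^ S a - 1) * h) • E :
      Derivation K (DPAlg K p S) (DPAlg K p S)) : Module.End K (DPAlg K p S)) ^ p ^ k =
      (D : Module.End K (DPAlg K p S)) ^ p ^ k +
      (((dpow K p S a (p ^ S a - p ^ k) * h) • E :
        Derivation K (DPAlg K p S) (DPAlg K p S)) : Module.End K (DPAlg K p S)) := by
    intro k
    induction k with
    | zero => intro _; simp
    | succ k ih =>
      intro hk
      have hlt : p ^ k < p ^ S a := Nat.pow_lt_pow_right hp.one_lt (by omega)
      have hpk : 0 < p ^ k := pow_pos hp.pos k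
      have hle : p ^ (k + 1) ≤ p ^ S a := Nat.pow_le_pow_right hp.pos hk
      set g := dpow K p S a (p ^ S a - p ^ k) * h with hg
      have hEg : E g = 0 := by rw [hg, Derivation.leibniz, hE, hEh]; simp
      have hiter : ∀ j, adIter ((D : Module.End K (DPAlg K p S)) ^ p ^ k) j
          ((g • E : Derivation K (DPAlg K p S) (DPAlg K p S)) : Module.End K (DPAlg K p S)) =
          ((((D^[p ^ k * j] g) • E : Derivation K (DPAlg K p S) (DPAlg K p S))) :
            Module.End K (DPAlg K p S)) := by
        intro j
        induction j with
        | zero => rfl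
        | succ j ihj =>
          -- `ad (D ^ (p ^ k)) = (ad D) ^ (p ^ k)`, and `D` commutes with `E`, so only the
          -- coefficient is differentiated.
          rw [adIter_succ, ihj, lie_pow_char_pow, adIter_coe_smul_der D E hcomm,
            ← Function.iterate_add_apply, Nat.mul_succ, add_comm (p ^ k)]
      have hEiter : ∀ n, E (D^[n] g) = 0 := der_apply_iterate_eq_zero D E hcomm hEg
      -- The exponent `p ^ S a - p ^ k` is positive because `k < S a`.
      have hgp : g ^ p = 0 := by
        rw [hg, mul_pow, dpow_pow_char (by omega), zero_mul]
      rw [pow_succ, pow_mul, ih (by omega), add_pow_char_of_lie_adIter (K := K) (p := p), hiter]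
      · have h1 : ((g • E : Derivation K (DPAlg K p S) (DPAlg K p S)) :
            Module.End K (DPAlg K p S)) ^ p = 0 := by
          refine LinearMap.ext fun x => ?_
          rw [smul_der_pow_apply E hEg, hgp, zero_mul, LinearMap.zero_apply]
        have h2 : p ^ k * (p - 1) = p ^ (k + 1) - p ^ k := by
          rw [Nat.mul_sub, mul_one, pow_succ]
        rw [h1, add_zero, ← pow_mul, hD, hg, hmul, pd_iterate_dpow (by omega) (by omega)]
        have h3 : p ^ k ≤ p ^ (k + 1) := Nat.pow_le_pow_right hp.pos (Nat.le_succ k)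
        have h4 : p ^ S a - p ^ k - (p ^ (k + 1) - p ^ k) = p ^ S a - p ^ (k + 1) := by omega
        rw [← h2, pow_succ] at h4
        rw [h4]
      · intro j
        rw [hiter, ← Derivation.commutator_coe_linear_map, lie_smul_der, Derivation.smul_apply,
          hEiter, smul_lie_der, hEg]
        simp
  have := key (S a) le_rfl
  rw [hD0, Nat.sub_self, dpow_zero, one_mul, zero_add] at this
  exact this

end Powers

end DPAlg

/-! ### The pivot elements of a clover algebra -/

namespace Clover

open DPAlg

/-- The variable `x n`, `y n`, `z n` differentiated by `v n`, `w n`, `u n`, respectively. -/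
def var : Fin 3 → ℕ → CloverVar
  | 0 => .x
  | 1 => .y
  | 2 => .z

/-- The second variable in the recursion for `v n`, `w n`, `u n`. -/
def partner : Fin 3 → ℕ → CloverVar
  | 0 => .y
  | 1 => .x
  | 2 => .x

/-- The level `n` of the variables `x n`, `y n`, `z n`. -/
def level : CloverVar → ℕ
  | .x n => n
  | .y n => n
  | .z n => n

@[simp] theorem level_var (l : Fin 3) (n : ℕ) : level (var l n) = n := by
  fin_cases l <;> rfl

@[simp] theorem level_partner (l : Fin 3) (n : ℕ) : level (partner l n) = n := by
  fin_cases l <;> rfl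

theorem var_ne_partner (l : Fin 3) (n : ℕ) : var l n ≠ partner l n := by
  fin_cases l <;> exact CloverVar.noConfusion

/-- The weight of the pivot elements of level `n` when all `R n` are `1`. -/
def wt (p : ℕ) (Ξ : CloverTuple) : ℕ → ℕ
  | 0 => 1
  | n + 1 => (p ^ Ξ.S n + p - 1) * wt p Ξ n

/-- The degrees of the variables. -/
def varDeg (p : ℕ) (Ξ : CloverTuple) (a : CloverVar) : ℕ := wt p Ξ (level a)

theorem height_pos (Ξ : CloverTuple) (a : CloverVar) : 0 < Ξ.height a := by
  cases a with
  | x n => exact Ξ.S_pos n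
  | y n => exact Ξ.R_pos n
  | z n => exact Ξ.R_pos n

section Pivots

variable (K : Type*) [Field K] (p : ℕ) (Ξ : CloverTuple)

/-- The elements that only involve variables of level `< n` and have degree `k`. -/
noncomputable def lowHomog (n : ℕ) (k : ℤ) : Submodule K (CloverRing K p Ξ) :=
  homog K p Ξ.height (varDeg p Ξ) {a | level a < n} k

variable {K p Ξ}

theorem lowHomog_mono {m n : ℕ} (h : m ≤ n) (k : ℤ) : lowHomog K p Ξ m k ≤ lowHomog K p Ξ n k :=
  homog_mono (fun _ ha => lt_of_lt_of_le ha h) k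

theorem dpow_mem_lowHomog {a : CloverVar} {n : ℕ} (h : level a < n) (i : ℕ) :
    dpow K p Ξ.height a i ∈ lowHomog K p Ξ n (i * wt p Ξ (level a) : ℤ) :=
  dpow_mem_homog (T := {a | level a < n}) h i

variable (K p Ξ)

/-- The highest nonzero divided power of a variable. -/
noncomputable def top (a : CloverVar) : CloverRing K p Ξ :=
  dpow K p Ξ.height a (p ^ Ξ.height a - 1)

/-- The coefficient of the pivot element of level `n + 1` in the one of level `n`. -/
noncomputable def tail (l : Fin 3) (n : ℕ) : CloverRing K p Ξ :=
  top K p Ξ (var l n) * top K p Ξ (partner l n)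

variable {K p Ξ}

theorem top_mem_lowHomog (a : CloverVar) {n : ℕ} (h : level a < n) :
    top K p Ξ a ∈ lowHomog K p Ξ n (((p ^ Ξ.height a - 1 : ℕ) : ℤ) * wt p Ξ (level a)) :=
  dpow_mem_lowHomog h _

variable [Fact p.Prime]

theorem pd_dpow_of_ne {a b : CloverVar} (h : b ≠ a) (i : ℕ) :
    pd a (dpow K p Ξ.height b i) = 0 :=
  pd_eq_zero_of_mem (ω := varDeg p Ξ) (T := {b}) (fun h' => h (Set.mem_singleton_iff.1 h').symm)
    (dpow_mem_homog (Set.mem_singleton b) i)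

theorem two_le_prime_pow_height (a : CloverVar) : 2 ≤ p ^ Ξ.height a :=
  (Fact.out : p.Prime).two_le.trans (Nat.le_self_pow (height_pos Ξ a).ne' p)

/-- All three tails of level `n` contain the top divided power of `x n`, whose square is zero. -/
theorem tail_mul_tail (l l' : Fin 3) (n : ℕ) : tail K p Ξ l n * tail K p Ξ l' n = 0 := by
  have h : ∀ l, ∃ g, tail K p Ξ l n = top K p Ξ (.x n) * g := by
    intro l
    fin_cases l
    · exact ⟨_, rfl⟩
    · exact ⟨_, mul_comm _ _⟩
    · exact ⟨_, mul_comm _ _⟩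
  have h2 := two_le_prime_pow_height (p := p) (Ξ := Ξ) (.x n)
  have h0 : top K p Ξ (.x n) * top K p Ξ (.x n) = 0 :=
    dpow_mul_dpow_eq_zero (Fact.out : p.Prime).pos (show p ^ Ξ.height (.x n) ≤
      p ^ Ξ.height (.x n) - 1 + (p ^ Ξ.height (.x n) - 1) by omega)
  obtain ⟨g, hg⟩ := h l
  obtain ⟨g', hg'⟩ := h l'
  rw [hg, hg', mul_mul_mul_comm, h0, zero_mul]

theorem wt_pos (n : ℕ) : 0 < wt p Ξ n := by
  induction n with
  | zero => exact Nat.one_pos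
  | succ n ih =>
    have h1 := (Fact.out : p.Prime).two_le
    exact Nat.mul_pos (by omega) ih

/-- The two exponents add up to `p ^ S n + p - 2`, one less than the ratio of consecutive weights.
This makes both summands in the recursion of a pivot homogeneous of the same degree. -/
theorem tail_mem_lowHomog (hR : ∀ n, Ξ.R n = 1) (l : Fin 3) (n : ℕ) :
    tail K p Ξ l n ∈ lowHomog K p Ξ (n + 1) ((wt p Ξ (n + 1) : ℤ) - wt p Ξ n) := by
  have h1 := mul_mem_homog
    (top_mem_lowHomog (K := K) (p := p) (Ξ := Ξ) (var l n) (n := n + 1) (by simp))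
    (top_mem_lowHomog (K := K) (p := p) (Ξ := Ξ) (partner l n) (n := n + 1) (by simp))
  have hp := (Fact.out : p.Prime).pos
  have hS : 0 < p ^ Ξ.S n := pow_pos hp _
  have e : (((p ^ Ξ.height (var l n) - 1 : ℕ) : ℤ) * wt p Ξ (level (var l n)) +
      ((p ^ Ξ.height (partner l n) - 1 : ℕ) : ℤ) * wt p Ξ (level (partner l n))) =
      (wt p Ξ (n + 1) : ℤ) - wt p Ξ n := by
    rw [level_var, level_partner, wt, Nat.cast_mul]
    have h2 : (((p ^ Ξ.height (var l n) - 1 : ℕ) : ℤ) +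
      ((p ^ Ξ.height (partner l n) - 1 : ℕ) : ℤ)) = ((p ^ Ξ.S n + p - 1 : ℕ) : ℤ) - 1 := by
      fin_cases l <;> simp only [var, partner, CloverTuple.height, hR, pow_one] <;> omega
    rw [← add_mul, h2]
    ring
  rw [e] at h1
  exact h1

variable (K p Ξ) [CharP K p]

/-- `v n`, `w n` and `u n`. -/
noncomputable def pivot : Fin 3 → ℕ → Derivation K (CloverRing K p Ξ) (CloverRing K p Ξ)
  | 0 => v K p Ξ
  | 1 => w K p Ξ
  | 2 => u K p Ξ

theorem pivot_eq (l : Fin 3) (n : ℕ) : pivot K p Ξ l n =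
    partialDer (var l n) + tail K p Ξ l n • pivot K p Ξ l (n + 1) := by
  fin_cases l
  · exact v_eq K p Ξ n
  · exact w_eq K p Ξ n
  · exact u_eq K p Ξ n

variable {K p Ξ}

theorem pd_mul_eq_zero {a : CloverVar} {f g : CloverRing K p Ξ} (hf : pd a f = 0) (hg : pd a g = 0) :
    pd a (f * g) = 0 := by
  rw [← partialDer_apply] at *
  rw [Derivation.leibniz, hf, hg, smul_zero, smul_zero, add_zero]

/-- Collects what later arguments need of the coefficients, so that the three families can be
treated uniformly in `l`. -/
theorem pivot_eq_vecField (l : Fin 3) (n : ℕ) : ∃ f, pivot K p Ξ l n = vecField f ∧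
    (∀ a, level a < n → f a = 0) ∧ (∀ a, level a < n → ∀ b, pd a (f b) = 0) ∧
    f (var l n) = 1 ∧ ∀ l' ≠ l, ∀ j, f (var l' j) = 0 := by
  have key : ∀ (a : CloverVar) (b c : ℕ → CloverVar) (j : ℕ), level a < n →
      (∀ l, level (b l) = l) → (∀ l, level (c l) = l) →
      pd a (if n ≤ j then ∏ l ∈ Finset.Ico n j, (top K p Ξ (b l) * top K p Ξ (c l)) else 0) = 0 := by
    intro a b c j ha hb hc
    split_ifs with h
    · refine Finset.prod_induction _ (fun g => pd a g = 0) (fun f g hf hg => pd_mul_eq_zero hf hg)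
        ?_ fun l hl => ?_
      · rw [← partialDer_apply, Derivation.map_one_eq_zero]
      · have hl' := (Finset.mem_Ico.1 hl).1
        refine pd_mul_eq_zero (pd_dpow_of_ne ?_ _) (pd_dpow_of_ne ?_ _)
        · rintro rfl; rw [hb] at ha; omega
        · rintro rfl; rw [hc] at ha; omega
    · rw [map_zero]
  fin_cases l
  · refine ⟨_, rfl, ?_, ?_, ?_, ?_⟩
    · rintro (j | j | j) h
      · exact if_neg (not_le.2 h)
      · rfl
      · rfl
    · rintro a ha (j | j | j)
      · exact key a .x .y j ha (fun _ => rfl) (fun _ => rfl)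
      · exact map_zero _
      · exact map_zero _
    · exact (if_pos le_rfl).trans (by rw [Finset.Ico_self, Finset.prod_empty])
    · intro l' hl' j
      fin_cases l'
      · exact absurd rfl hl'
      · rfl
      · rfl
  · refine ⟨_, rfl, ?_, ?_, ?_, ?_⟩
    · rintro (j | j | j) h
      · rfl
      · exact if_neg (not_le.2 h)
      · rfl
    · rintro a ha (j | j | j)
      · exact map_zero _
      · exact key a .y .x j ha (fun _ => rfl) (fun _ => rfl)
      · exact map_zero _
    · exact (if_pos le_rfl).trans (by rw [Finset.Ico_self, Finset.prod_empty])
    · intro l' hl' j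
      fin_cases l'
      · rfl
      · exact absurd rfl hl'
      · rfl
  · refine ⟨_, rfl, ?_, ?_, ?_, ?_⟩
    · rintro (j | j | j) h
      · rfl
      · rfl
      · exact if_neg (not_le.2 h)
    · rintro a ha (j | j | j)
      · exact map_zero _
      · exact map_zero _
      · exact key a .z .x j ha (fun _ => rfl) (fun _ => rfl)
    · exact (if_pos le_rfl).trans (by rw [Finset.Ico_self, Finset.prod_empty])
    · intro l' hl' j
      fin_cases l'
      · rfl
      · rfl
      · exact absurd rfl hl'

theorem pivot_apply_of_mem {n : ℕ} {k : ℤ} {g : CloverRing K p Ξ} (l : Fin 3)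
    (hg : g ∈ lowHomog K p Ξ n k) : pivot K p Ξ l n g = 0 := by
  obtain ⟨f, hf, h0, -⟩ := pivot_eq_vecField (K := K) (p := p) (Ξ := Ξ) l n
  rw [hf]
  exact vecField_eq_zero_of_mem h0 hg

theorem partialDer_lie_pivot {a : CloverVar} {n : ℕ} (h : level a < n) (l : Fin 3) :
    ⁅(partialDer a : Derivation K (CloverRing K p Ξ) (CloverRing K p Ξ)), pivot K p Ξ l n⁆ = 0 := by
  obtain ⟨f, hf, -, h0, -⟩ := pivot_eq_vecField (K := K) (p := p) (Ξ := Ξ) l n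
  rw [hf]
  exact partialDer_lie_vecField a f (h0 a h)

theorem pivot_apply_var (l : Fin 3) (n : ℕ) :
    pivot K p Ξ l n (dpow K p Ξ.height (var l n) 1) = 1 := by
  obtain ⟨f, hf, -, -, h1, -⟩ := pivot_eq_vecField (K := K) (p := p) (Ξ := Ξ) l n
  have h2 := two_le_prime_pow_height (p := p) (Ξ := Ξ) (var l n)
  rw [hf, vecField_dpow, h1, one_mul, pd_dpow_succ (i := 0) (by omega), dpow_zero]

theorem pivot_apply_var_of_ne {l l' : Fin 3} (h : l' ≠ l) (n m i : ℕ) :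
    pivot K p Ξ l n (dpow K p Ξ.height (var l' m) i) = 0 := by
  obtain ⟨f, hf, -, -, -, h1⟩ := pivot_eq_vecField (K := K) (p := p) (Ξ := Ξ) l n
  rw [hf, vecField_dpow, h1 l' h, zero_mul]

/-- Expand both pivots by the recursion. The bracket of the two higher pivots carries a product of
two tails, hence vanishes, and nothing beyond level `n + 1` appears. -/
theorem lie_pivot_same_level (l l' : Fin 3) (n : ℕ) :
    ⁅pivot K p Ξ l n, pivot K p Ξ l' n⁆ =
      pd (var l n) (tail K p Ξ l' n) • pivot K p Ξ l' (n + 1) -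
        pd (var l' n) (tail K p Ξ l n) • pivot K p Ξ l (n + 1) := by
  have hz : ∀ l l', pivot K p Ξ l (n + 1) (tail K p Ξ l' n) = 0 := fun l l' => by
    rw [tail, Derivation.leibniz, pivot_apply_of_mem l (top_mem_lowHomog _ (by simp)),
      pivot_apply_of_mem l (top_mem_lowHomog _ (by simp)), smul_zero, smul_zero, add_zero]
  have hc : ∀ l l', ⁅(partialDer (var l n) :
      Derivation K (CloverRing K p Ξ) (CloverRing K p Ξ)), pivot K p Ξ l' (n + 1)⁆ = 0 := fun l l' =>
    partialDer_lie_pivot (by simp) l'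
  have hc' : ⁅pivot K p Ξ l (n + 1), (partialDer (var l' n) :
      Derivation K (CloverRing K p Ξ) (CloverRing K p Ξ))⁆ = 0 := by
    rw [← lie_skew, hc, neg_zero]
  rw [pivot_eq K p Ξ l n, pivot_eq K p Ξ l' n]
  simp only [add_lie, lie_add, partialDer_lie_partialDer, lie_smul_der, smul_lie_der, hc, hc', hz,
    partialDer_apply, Derivation.smul_apply, smul_zero, zero_smul, add_zero, zero_add, zero_sub,
    smul_smul, sub_zero, tail_mul_tail]
  abel

/-- A partial derivation of level below `n` commutes with the pivots of level `n`, so climbing from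
`m` to `n` only collects a product of tails. -/
theorem lie_pivot_of_le (hR : ∀ n, Ξ.R n = 1) (l l' : Fin 3) {m n : ℕ} (h : m ≤ n) :
    ∃ c ∈ lowHomog K p Ξ n ((wt p Ξ n : ℤ) - wt p Ξ m),
      ⁅pivot K p Ξ l m, pivot K p Ξ l' n⁆ = c • ⁅pivot K p Ξ l n, pivot K p Ξ l' n⁆ := by
  induction h using Nat.decreasingInduction with
  | self => exact ⟨1, by rw [sub_self]; exact one_mem_homog, (one_smul _ _).symm⟩
  | of_succ m h ih =>
    obtain ⟨c, hc, e⟩ := ih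
    have ht := lowHomog_mono h _ (tail_mem_lowHomog (K := K) (p := p) hR l m)
    refine ⟨tail K p Ξ l m * c, ?_, ?_⟩
    · have := mul_mem_homog ht hc
      rwa [sub_add_sub_cancel'] at this
    · rw [pivot_eq K p Ξ l m, add_lie, partialDer_lie_pivot (by simpa using h), smul_lie_der, e,
        pivot_apply_of_mem l' ht, zero_smul, sub_zero, zero_add, smul_smul]

/-- A pivot of level `m` is homogeneous of degree `-wt m`. The recursion is followed up to level
`n`, where pivots kill `g`. -/
theorem pivot_apply_mem (hR : ∀ n, Ξ.R n = 1) (l : Fin 3) {m n : ℕ} (h : m ≤ n)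
    {k : ℤ} {g : CloverRing K p Ξ} (hg : g ∈ lowHomog K p Ξ n k) :
    pivot K p Ξ l m g ∈ lowHomog K p Ξ n (k - wt p Ξ m) := by
  induction h using Nat.decreasingInduction with
  | self => rw [pivot_apply_of_mem l hg]; exact zero_mem _
  | of_succ m h ih =>
    have ht := lowHomog_mono h _ (tail_mem_lowHomog (K := K) (p := p) hR l m)
    rw [pivot_eq, Derivation.add_apply, Derivation.smul_apply, partialDer_apply, smul_eq_mul]
    refine add_mem ?_ ?_
    · have := pd_mem_homog (var l m) hg
      rwa [varDeg, level_var] at this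
    · have := mul_mem_homog ht ih
      have e : (wt p Ξ (m + 1) : ℤ) - wt p Ξ m + (k - wt p Ξ (m + 1)) = k - wt p Ξ m := by ring
      rwa [e] at this

/-- The recursion has the shape required by `partialDer_add_top_pow`, with the top power of the
partner variable as `h`. -/
theorem pivot_pow (l : Fin 3) (n : ℕ) :
    ((pivot K p Ξ l n : Derivation K (CloverRing K p Ξ) (CloverRing K p Ξ)) :
      Module.End K (CloverRing K p Ξ)) ^ p ^ Ξ.height (var l n) =
    ((top K p Ξ (partner l n) • pivot K p Ξ l (n + 1) :
      Derivation K (CloverRing K p Ξ) (CloverRing K p Ξ)) : Module.End K (CloverRing K p Ξ)) := by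
  rw [pivot_eq]
  exact partialDer_add_top_pow (partialDer_lie_pivot (by simp) l)
    (fun i => pivot_apply_of_mem l (dpow_mem_lowHomog (by simp) i))
    (pivot_apply_of_mem l (top_mem_lowHomog _ (by simp)))
    (pd_dpow_of_ne (var_ne_partner l n).symm _)

end Pivots

end Clover

/-! ### A filtration bounding a clover algebra from above -/

namespace Clover

open DPAlg

section Weights

variable {p : ℕ} {Ξ : CloverTuple}

theorem var_injective : Function.Injective fun q : Fin 3 × ℕ => var q.1 q.2 := by
  rintro ⟨l, n⟩ ⟨l', n'⟩ h
  fin_cases l <;> fin_cases l' <;> simp [var] at h <;> simp [h]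

theorem exists_var (a : CloverVar) : ∃ l, var l (level a) = a := by
  cases a with
  | x n => exact ⟨0, rfl⟩
  | y n => exact ⟨1, rfl⟩
  | z n => exact ⟨2, rfl⟩

theorem weight_eq_sum {α : CloverVar →₀ ℕ} {n : ℕ}
    (h : (α.support : Set CloverVar) ⊆ {a | level a < n}) :
    Finsupp.weight (varDeg p Ξ) α =
      ∑ i ∈ Finset.range n, (α (.x i) + α (.y i) + α (.z i)) * wt p Ξ i := by
  classical
  have hs : α.support ⊆ (Finset.univ ×ˢ Finset.range n).image
      fun q : Fin 3 × ℕ => var q.1 q.2 := by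
    intro a ha
    obtain ⟨l, hl⟩ := exists_var a
    exact Finset.mem_image.2 ⟨(l, level a), by simpa using h ha, hl⟩
  rw [Finsupp.weight_apply, Finsupp.sum_of_support_subset _ hs _ (by simp),
    Finset.sum_image var_injective.injOn, Finset.sum_product_right]
  refine Finset.sum_congr rfl fun i _ => ?_
  simp only [Fin.sum_univ_three, varDeg, level, smul_eq_mul, var]
  ring

theorem wt_succ (n : ℕ) : wt p Ξ (n + 1) = (p ^ Ξ.S n + p - 1) * wt p Ξ n := rfl

theorem le_pow_S (n : ℕ) : p ≤ p ^ Ξ.S n := Nat.le_self_pow (Ξ.S_pos n).ne' p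

variable [Fact p.Prime]

/-- The full exponents of level `n` contribute `p ^ S n - 1 + 2 * (p - 1)`, which is at most `3/2 *
(p ^ S n + p - 2)` because `p ≤ p ^ S n`. The constant `3/2`, being less than `2`, keeps brackets
out of too high a level. -/
theorem two_mul_weight_lt (hR : ∀ n, Ξ.R n = 1) {α : DPExponent p Ξ.height} {n : ℕ}
    (h : (α.1.support : Set CloverVar) ⊆ {a | level a < n}) :
    2 * Finsupp.weight (varDeg p Ξ) α.1 < 3 * wt p Ξ n := by
  rw [weight_eq_sum h]
  have hp := (Fact.out : p.Prime).two_le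
  -- The added `3` is exactly the slack `3 * wt 0` and makes the induction telescope.
  suffices H : 2 * ∑ i ∈ Finset.range n, (α.1 (.x i) + α.1 (.y i) + α.1 (.z i)) * wt p Ξ i + 3 ≤
      3 * wt p Ξ n by omega
  clear h
  induction n with
  | zero => simp [wt]
  | succ n ih =>
    have hx : α.1 (.x n) < p ^ Ξ.S n := α.2 (.x n)
    have hy : α.1 (.y n) < p := by
      have := α.2 (.y n)
      rwa [CloverTuple.height, hR, pow_one] at this
    have hz : α.1 (.z n) < p := by
      have := α.2 (.z n)
      rwa [CloverTuple.height, hR, pow_one] at this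
    have hS := le_pow_S (p := p) (Ξ := Ξ) n
    rw [Finset.sum_range_succ, wt_succ]
    have h1 : 2 * (α.1 (.x n) + α.1 (.y n) + α.1 (.z n)) + 3 ≤ 3 * (p ^ Ξ.S n + p - 1) := by omega
    have h2 := Nat.mul_le_mul_right (wt p Ξ n) h1
    linarith

theorem three_mul_wt_le (n : ℕ) : 3 * wt p Ξ n ≤ wt p Ξ (n + 1) := by
  have hp := (Fact.out : p.Prime).two_le
  have hS := le_pow_S (p := p) (Ξ := Ξ) n
  exact Nat.mul_le_mul_right _ (by omega)

theorem wt_strictMono : StrictMono (wt p Ξ) :=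
  strictMono_nat_of_lt_succ fun n => by
    have := three_mul_wt_le (p := p) (Ξ := Ξ) n
    have := wt_pos (p := p) (Ξ := Ξ) n
    omega

theorem pow_mul_wt_lt {i j : ℕ} (h : j ≤ Ξ.S i) : p ^ j * wt p Ξ i < wt p Ξ (i + 1) := by
  have hp := (Fact.out : p.Prime)
  have h1 : p ^ j ≤ p ^ Ξ.S i := Nat.pow_le_pow_right hp.pos h
  have h2 := hp.two_le
  exact Nat.mul_lt_mul_of_pos_right (by omega) (wt_pos i)

theorem sum_mul_wt_lt {a : ℕ → ℕ} (ha : ∀ i, a i < p ^ Ξ.S i) (n : ℕ) :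
    ∑ i ∈ Finset.range n, a i * wt p Ξ i < wt p Ξ n := by
  induction n with
  | zero => simp [wt]
  | succ n ih =>
    have h1 := pow_mul_wt_lt (p := p) (Ξ := Ξ) (le_refl (Ξ.S n))
    have h2 := Nat.mul_le_mul_right (wt p Ξ n) (Nat.succ_le_of_lt (ha n))
    rw [Nat.succ_mul] at h2
    rw [Finset.sum_range_succ]
    omega

/-- Uniqueness of mixed radix digits: `a i < p ^ S i` stays below the ratio `wt (i + 1) / wt i`, so
the top digit is a quotient with remainder. -/
theorem eq_of_sum_mul_wt_eq {a b : ℕ → ℕ} (ha : ∀ i, a i < p ^ Ξ.S i) (hb : ∀ i, b i < p ^ Ξ.S i)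
    {n : ℕ} (h : ∑ i ∈ Finset.range n, a i * wt p Ξ i = ∑ i ∈ Finset.range n, b i * wt p Ξ i) :
    ∀ i < n, a i = b i := by
  induction n with
  | zero => intro i hi; omega
  | succ n ih =>
    rw [Finset.sum_range_succ, Finset.sum_range_succ] at h
    have h1 := sum_mul_wt_lt ha n
    have h2 := sum_mul_wt_lt hb n
    have h3 : a n = b n := by
      have e1 := congrArg (· / wt p Ξ n) h
      simpa only [Nat.add_mul_div_right _ _ (wt_pos n), Nat.div_eq_of_lt h1, Nat.div_eq_of_lt h2,
        zero_add] using e1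
    intro i hi
    rcases Nat.lt_succ_iff_lt_or_eq.1 hi with h4 | rfl
    · rw [h3] at h
      exact ih (Nat.add_right_cancel h) i h4
    · exact h3

end Weights

/-- The weight of the preceding level. -/
def prevWt (p : ℕ) (Ξ : CloverTuple) : ℕ → ℕ
  | 0 => 0
  | n + 1 => wt p Ξ n

/-! ### A restricted filtration containing the standard one. -/

section UpperFiltration

variable (K : Type*) [Field K] (p : ℕ) [Fact p.Prime] (Ξ : CloverTuple)

variable {K p Ξ} in
theorem eq_zero_or_of_mem_lowHomog (hR : ∀ n, Ξ.R n = 1) {n : ℕ} {k : ℤ} {f : CloverRing K p Ξ}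
    (hf : f ∈ lowHomog K p Ξ n k) : f = 0 ∨ 2 * k < 3 * wt p Ξ n := by
  by_cases hk : 2 * k < 3 * wt p Ξ n
  · exact Or.inr hk
  · left
    have : lowHomog K p Ξ n k ≤ ⊥ := by
      refine Submodule.span_le.2 ?_
      rintro _ ⟨α, ⟨hα, hk'⟩, rfl⟩
      have := two_mul_weight_lt hR hα
      omega
    exact (Submodule.mem_bot K).1 (this hf)

variable [CharP K p]

/-- The pivot elements as linear operators. -/
noncomputable def pivotEnd (l : Fin 3) (n : ℕ) : Module.End K (CloverRing K p Ξ) :=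
  (pivot K p Ξ l n : Derivation K (CloverRing K p Ξ) (CloverRing K p Ξ))

/-- The operator `f • pivot l n`. -/
noncomputable def smulPivot (l : Fin 3) (n : ℕ) :
    CloverRing K p Ξ →ₗ[K] Module.End K (CloverRing K p Ξ) where
  toFun f := (f • pivot K p Ξ l n : Derivation K (CloverRing K p Ξ) (CloverRing K p Ξ))
  map_add' f g := by rw [add_smul, Derivation.coe_add_linearMap]
  map_smul' c f := by rw [smul_assoc, Derivation.coe_smul_linearMap]; rfl

/-- Monomial multiples of pivot elements of weight at most `d`; at level `n + 1` only those of
weight exceeding half the weight of level `n` are admitted. -/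
def lowSet (d : ℕ) : Set (Module.End K (CloverRing K p Ξ)) :=
  {T | ∃ (l : Fin 3) (n : ℕ) (α : DPExponent p Ξ.height) (e : ℕ),
    (α.1.support : Set CloverVar) ⊆ {a | level a < n} ∧
    Finsupp.weight (varDeg p Ξ) α.1 + e = wt p Ξ n ∧ prevWt p Ξ n < 2 * e ∧ e ≤ d ∧
    T = smulPivot K p Ξ l n (mono K α)}

/-- The powers `v_i ^ (p ^ j)`, `j < S i`, of weight at most `d`. -/
def vPowSet (d : ℕ) : Set (Module.End K (CloverRing K p Ξ)) :=
  {T | ∃ i j : ℕ, j < Ξ.S i ∧ p ^ j * wt p Ξ i ≤ d ∧ T = pivotEnd K p Ξ 0 i ^ p ^ j}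

/-- The span of `lowSet`. -/
noncomputable def lowSpan (d : ℕ) : Submodule K (Module.End K (CloverRing K p Ξ)) :=
  Submodule.span K (lowSet K p Ξ d)

/-- The span of `lowSet` and `vPowSet`. -/
noncomputable def upSpan (d : ℕ) : Submodule K (Module.End K (CloverRing K p Ξ)) :=
  Submodule.span K (lowSet K p Ξ d ∪ vPowSet K p Ξ d)

variable {K p Ξ}

theorem smulPivot_one (l : Fin 3) (n : ℕ) : smulPivot K p Ξ l n 1 = pivotEnd K p Ξ l n := by
  change ((((1 : CloverRing K p Ξ) • pivot K p Ξ l n :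
    Derivation K (CloverRing K p Ξ) (CloverRing K p Ξ))) : Module.End K (CloverRing K p Ξ)) = _
  rw [one_smul]
  rfl

theorem lowSpan_mono : Monotone (lowSpan K p Ξ) := by
  intro c d h
  refine Submodule.span_mono ?_
  rintro T ⟨l, n, α, e, h1, h2, h3, h4, rfl⟩
  exact ⟨l, n, α, e, h1, h2, h3, h4.trans h, rfl⟩

theorem upSpan_mono : Monotone (upSpan K p Ξ) := by
  intro c d h
  refine Submodule.span_mono ?_
  rintro T (⟨l, n, α, e, h1, h2, h3, h4, rfl⟩ | ⟨i, j, h1, h2, rfl⟩)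
  · exact Or.inl ⟨l, n, α, e, h1, h2, h3, h4.trans h, rfl⟩
  · exact Or.inr ⟨i, j, h1, h2.trans h, rfl⟩

theorem lowSpan_le_upSpan (d : ℕ) : lowSpan K p Ξ d ≤ upSpan K p Ξ d :=
  Submodule.span_mono Set.subset_union_left

theorem smulPivot_mem (l : Fin 3) {n e d : ℕ} {f : CloverRing K p Ξ}
    (hf : f ∈ lowHomog K p Ξ n ((wt p Ξ n : ℤ) - e)) (he : prevWt p Ξ n < 2 * e) (hd : e ≤ d) :
    smulPivot K p Ξ l n f ∈ lowSpan K p Ξ d := by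
  have : lowHomog K p Ξ n ((wt p Ξ n : ℤ) - e) ≤ (lowSpan K p Ξ d).comap (smulPivot K p Ξ l n) := by
    refine Submodule.span_le.2 ?_
    rintro _ ⟨α, ⟨hα, hk⟩, rfl⟩
    exact Submodule.subset_span ⟨l, n, α, e, hα, by omega, he, hd, rfl⟩
  exact this hf

/-- The bracket has a term in which the lower pivot differentiates `g`, still at level `n`, and
terms at level `n + 1` from the bracket of the pivots. Homogeneity gives the weights; what needs
proof is that the level `n + 1` terms meet the lower bound on the weight imposed in `lowSet`. -/
theorem lie_smulPivot_mem (hR : ∀ n, Ξ.R n = 1) (l l' : Fin 3) {m n c d : ℕ} (hmn : m ≤ n)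
    {f g : CloverRing K p Ξ} (hf : f ∈ lowHomog K p Ξ m ((wt p Ξ m : ℤ) - c))
    (hg : g ∈ lowHomog K p Ξ n ((wt p Ξ n : ℤ) - d)) (hd : prevWt p Ξ n < 2 * d) :
    ⁅smulPivot K p Ξ l m f, smulPivot K p Ξ l' n g⁆ ∈ lowSpan K p Ξ (c + d) := by
  have hf' := lowHomog_mono hmn _ hf
  obtain ⟨r, hr, he⟩ := lie_pivot_of_le (K := K) (p := p) hR l l' hmn
  have e : ⁅f • pivot K p Ξ l m, g • pivot K p Ξ l' n⁆ =
      (f * pivot K p Ξ l m g) • pivot K p Ξ l' n +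
      ((f * g * r * pd (var l n) (tail K p Ξ l' n)) • pivot K p Ξ l' (n + 1) -
        (f * g * r * pd (var l' n) (tail K p Ξ l n)) • pivot K p Ξ l (n + 1)) := by
    rw [smul_lie_der, Derivation.smul_apply, pivot_apply_of_mem l' hf', smul_zero, zero_smul,
      sub_zero, lie_smul_der, he, lie_pivot_same_level]
    simp only [smul_add, smul_sub, smul_smul, mul_assoc]
  have h1 : f * pivot K p Ξ l m g ∈ lowHomog K p Ξ n ((wt p Ξ n : ℤ) - (c + d : ℕ)) := by
    have := mul_mem_homog hf' (pivot_apply_mem hR l hmn hg)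
    have e1 : (wt p Ξ m : ℤ) - c + (wt p Ξ n - d - wt p Ξ m) = wt p Ξ n - (c + d : ℕ) := by
      push_cast; ring
    rwa [e1] at this
  have h2 : f * g * r ∈ lowHomog K p Ξ n (2 * (wt p Ξ n : ℤ) - (c + d : ℕ)) := by
    have := mul_mem_homog (mul_mem_homog hf' hg) hr
    have e1 : (wt p Ξ m : ℤ) - c + (wt p Ξ n - d) + (wt p Ξ n - wt p Ξ m) =
        2 * wt p Ξ n - (c + d : ℕ) := by
      push_cast; ring
    rwa [e1] at this
  have h3 : ∀ l l' l'' : Fin 3, smulPivot K p Ξ l'' (n + 1)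
      (f * g * r * pd (var l n) (tail K p Ξ l' n)) ∈ lowSpan K p Ξ (c + d) := by
    intro l l' l''
    -- Either the coefficient vanishes or its degree satisfies `2 * (2 * wt n - (c + d)) < 3 * wt
    -- n`, which is precisely `wt n < 2 * (c + d)`.
    rcases eq_zero_or_of_mem_lowHomog hR h2 with h0 | h0
    · rw [h0, zero_mul, map_zero]
      exact zero_mem _
    · refine smulPivot_mem l'' (e := c + d) ?_ ?_ le_rfl
      · have ht := pd_mem_homog (var l n) (tail_mem_lowHomog (K := K) (p := p) hR l' n)
        have := mul_mem_homog (lowHomog_mono (Nat.le_succ n) _ h2) ht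
        rw [varDeg, level_var] at this
        have e1 : 2 * (wt p Ξ n : ℤ) - (c + d : ℕ) + (wt p Ξ (n + 1) - wt p Ξ n - wt p Ξ n) =
            wt p Ξ (n + 1) - (c + d : ℕ) := by ring
        rwa [e1] at this
      · rw [prevWt]
        omega
  have e2 : ⁅smulPivot K p Ξ l m f, smulPivot K p Ξ l' n g⁆ =
      smulPivot K p Ξ l' n (f * pivot K p Ξ l m g) +
      (smulPivot K p Ξ l' (n + 1) (f * g * r * pd (var l n) (tail K p Ξ l' n)) -
        smulPivot K p Ξ l (n + 1) (f * g * r * pd (var l' n) (tail K p Ξ l n))) := by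
    change ⁅((f • pivot K p Ξ l m : Derivation K (CloverRing K p Ξ) (CloverRing K p Ξ)) :
      Module.End K (CloverRing K p Ξ)), ((g • pivot K p Ξ l' n :
      Derivation K (CloverRing K p Ξ) (CloverRing K p Ξ)) : Module.End K (CloverRing K p Ξ))⁆ = _
    rw [← Derivation.commutator_coe_linear_map, e]
    rfl
  rw [e2]
  exact add_mem (smulPivot_mem l' h1 (by omega) le_rfl) (sub_mem (h3 _ _ _) (h3 _ _ _))

theorem lie_mem_lowSpan (hR : ∀ n, Ξ.R n = 1) {c d : ℕ} {x y : Module.End K (CloverRing K p Ξ)}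
    (hx : x ∈ lowSpan K p Ξ c) (hy : y ∈ lowSpan K p Ξ d) : ⁅x, y⁆ ∈ lowSpan K p Ξ (c + d) := by
  refine lie_mem_of_span ?_ hx hy
  rintro _ ⟨l, m, α, e, h1, h2, h3, h4, rfl⟩ _ ⟨l', n, β, e', h1', h2', h3', h4', rfl⟩
  have hα : mono K α ∈ lowHomog K p Ξ m ((wt p Ξ m : ℤ) - e) :=
    Submodule.subset_span ⟨α, ⟨h1, by omega⟩, rfl⟩
  have hβ : mono K β ∈ lowHomog K p Ξ n ((wt p Ξ n : ℤ) - e') :=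
    Submodule.subset_span ⟨β, ⟨h1', by omega⟩, rfl⟩
  refine lowSpan_mono (add_le_add h4 h4') ?_
  rcases le_total m n with h | h
  · exact lie_smulPivot_mem hR l l' h hα hβ h3'
  · rw [← lie_skew, add_comm e]
    exact neg_mem (lie_smulPivot_mem hR l' l h hβ hα h3)

theorem adIter_mem_lowSpan (hR : ∀ n, Ξ.R n = 1) {c d : ℕ}
    {x y : Module.End K (CloverRing K p Ξ)} (hx : x ∈ lowSpan K p Ξ c) (hy : y ∈ lowSpan K p Ξ d)
    (n : ℕ) : adIter x n y ∈ lowSpan K p Ξ (n * c + d) := by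
  induction n with
  | zero => simpa using hy
  | succ n ih =>
    rw [adIter_succ, show (n + 1) * c + d = c + (n * c + d) by ring]
    exact lie_mem_lowSpan hR hx ih

theorem prevWt_lt (n : ℕ) : prevWt p Ξ n < 2 * wt p Ξ n := by
  cases n with
  | zero => simp [prevWt, wt]
  | succ n =>
    have h1 := wt_strictMono (p := p) (Ξ := Ξ) (Nat.lt_succ_self n)
    rw [prevWt, ← Nat.succ_eq_add_one]
    omega

theorem pivotEnd_mem (l : Fin 3) (n : ℕ) : pivotEnd K p Ξ l n ∈ lowSpan K p Ξ (wt p Ξ n) := by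
  rw [← smulPivot_one]
  refine smulPivot_mem l (e := wt p Ξ n) ?_ (prevWt_lt n) le_rfl
  rw [sub_self]
  exact one_mem_homog

/-- The powers of `v i` act by iterated brackets with a pivot, so all brackets even land in
`lowSpan`. -/
theorem lie_mem_upSpan (hR : ∀ n, Ξ.R n = 1) {c d : ℕ} {x y : Module.End K (CloverRing K p Ξ)}
    (hx : x ∈ upSpan K p Ξ c) (hy : y ∈ upSpan K p Ξ d) : ⁅x, y⁆ ∈ upSpan K p Ξ (c + d) := by
  have hvl : ∀ {c d : ℕ}, ∀ x ∈ vPowSet K p Ξ c, ∀ y ∈ lowSet K p Ξ d,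
      ⁅x, y⁆ ∈ lowSpan K p Ξ (c + d) := by
    rintro c d _ ⟨i, j, hj, hc, rfl⟩ y hy
    rw [lie_pow_char_pow]
    exact lowSpan_mono (by omega)
      (adIter_mem_lowSpan hR (pivotEnd_mem 0 i) (Submodule.subset_span hy) (p ^ j))
  refine lowSpan_le_upSpan _ (lie_mem_of_span ?_ hx hy)
  rintro x (hx | hx) y (hy | hy)
  · exact lie_mem_lowSpan hR (Submodule.subset_span hx) (Submodule.subset_span hy)
  · rw [← lie_skew, add_comm]
    exact neg_mem (hvl y hy x hx)
  · exact hvl x hx y hy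
  · obtain ⟨i, j, hj, hc, rfl⟩ := hx
    obtain ⟨i', j', hj', hd, rfl⟩ := hy
    obtain ⟨n, hn⟩ : ∃ n, p ^ j = n + 1 :=
      ⟨p ^ j - 1, by have := pow_pos (Fact.out : p.Prime).pos j; omega⟩
    have h1 := pivotEnd_mem (K := K) (p := p) (Ξ := Ξ) 0 i
    have h2 := pivotEnd_mem (K := K) (p := p) (Ξ := Ξ) 0 i'
    have h := adIter_mem_lowSpan hR h1 (neg_mem (adIter_mem_lowSpan hR h2 h1 (p ^ j'))) n
    rw [lie_pow_char_pow, hn, adIter_succ', ← lie_skew, lie_pow_char_pow]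
    refine lowSpan_mono ?_ h
    rw [hn, Nat.succ_mul] at hc
    omega

/-- By `pivot_pow` this is a top divided power times a pivot of level `n + 1`, and removing the
degree of that divided power from `wt (n + 1)` leaves the stated weight. -/
theorem pivotEnd_pow_mem (hR : ∀ n, Ξ.R n = 1) (l : Fin 3) (n : ℕ) :
    pivotEnd K p Ξ l n ^ p ^ Ξ.height (var l n) ∈
      lowSpan K p Ξ (p ^ Ξ.height (var l n) * wt p Ξ n) := by
  have e : pivotEnd K p Ξ l n ^ p ^ Ξ.height (var l n) =
      smulPivot K p Ξ l (n + 1) (top K p Ξ (partner l n)) := pivot_pow l n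
  have hp := (Fact.out : p.Prime).pos
  have hS : 0 < p ^ Ξ.S n := pow_pos hp _
  have hh : 0 < p ^ Ξ.height (var l n) := pow_pos hp _
  rw [e]
  refine smulPivot_mem l (e := p ^ Ξ.height (var l n) * wt p Ξ n) ?_ ?_ le_rfl
  · have h1 := top_mem_lowHomog (K := K) (p := p) (Ξ := Ξ) (partner l n) (n := n + 1) (by simp)
    have e1 : (((p ^ Ξ.height (partner l n) - 1 : ℕ) : ℤ) * wt p Ξ (level (partner l n))) =
        (wt p Ξ (n + 1) : ℤ) - (p ^ Ξ.height (var l n) * wt p Ξ n : ℕ) := by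
      have h2 : (((p ^ Ξ.height (partner l n) - 1 : ℕ) : ℤ)) =
          ((p ^ Ξ.S n + p - 1 : ℕ) : ℤ) - (p ^ Ξ.height (var l n) : ℕ) := by
        fin_cases l <;> simp only [var, partner, CloverTuple.height, hR, pow_one] <;> omega
      rw [level_partner, h2, wt_succ]
      push_cast
      ring
    rwa [e1] at h1
  · have := wt_pos (p := p) (Ξ := Ξ) n
    rw [prevWt]
    nlinarith

/-- By Jacobson's formula spanning elements suffice. Multiples by a nonconstant monomial have zero
`p`-th power. Those of `w n` and `u n` fall back into `lowSpan`, their variables having height `1`.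
Only the `v n` need their intermediate powers as extra elements. -/
theorem pow_mem_upSpan (hR : ∀ n, Ξ.R n = 1) {d : ℕ} {x : Module.End K (CloverRing K p Ξ)}
    (hx : x ∈ upSpan K p Ξ d) : x ^ p ∈ upSpan K p Ξ (p * d) := by
  have hv : ∀ i j, j < Ξ.S i → p ^ j * wt p Ξ i ≤ d →
      (pivotEnd K p Ξ 0 i ^ p ^ j) ^ p ∈ upSpan K p Ξ (p * d) := by
    intro i j hj hd
    have hd' : p ^ (j + 1) * wt p Ξ i ≤ p * d := by
      rw [pow_succ']
      nlinarith
    rw [← pow_mul, ← pow_succ]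
    -- The chain of powers of `v i` stops at exponent `p ^ S i`, where it re-enters `lowSpan` at
    -- level `i + 1`.
    rcases Nat.lt_or_ge (j + 1) (Ξ.S i) with h | h
    · exact Submodule.subset_span (Or.inr ⟨i, j + 1, h, hd', rfl⟩)
    · have e : Ξ.height (var 0 i) = j + 1 := le_antisymm h hj
      have h1 := pivotEnd_pow_mem (K := K) (p := p) hR 0 i
      rw [e] at h1
      exact lowSpan_le_upSpan _ (lowSpan_mono hd' h1)
  refine pow_char_mem_of_span (F := upSpan K p Ξ) (lie_mem_upSpan hR) rfl ?_ hx
  rintro _ (⟨l, n, α, e, h1, h2, h3, h4, rfl⟩ | ⟨i, j, hj, hd, rfl⟩)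
  · by_cases h0 : α.1 = 0
    · have hα : α = 0 := Subtype.ext h0
      rw [h0, map_zero, zero_add] at h2
      subst h2
      rw [hα, mono_zero, smulPivot_one]
      by_cases hl : l = 0
      · subst hl
        simpa using hv n 0 (Ξ.S_pos n) (by simpa using h4)
      · have e : Ξ.height (var l n) = 1 := by
          fin_cases l
          · exact absurd rfl hl
          · exact hR n
          · exact hR n
        have h1 := pivotEnd_pow_mem (K := K) (p := p) hR l n
        rw [e, pow_one] at h1
        exact lowSpan_le_upSpan _ (lowSpan_mono (Nat.mul_le_mul_left p h4) h1)
    · have hz : smulPivot K p Ξ l n (mono K α) ^ p = 0 := by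
        refine LinearMap.ext fun y => ?_
        have hm : mono K α ∈ lowHomog K p Ξ n (Finsupp.weight (varDeg p Ξ) α.1 : ℤ) :=
          Submodule.subset_span ⟨α, ⟨h1, rfl⟩, rfl⟩
        have := smul_der_pow_apply (pivot K p Ξ l n) (pivot_apply_of_mem l hm) p y
        rw [mono_pow_char h0, zero_mul] at this
        exact this
      rw [hz]
      exact zero_mem _
  · exact hv i j hj hd

theorem gens_eq : gens K p Ξ = Set.range fun l => pivotEnd K p Ξ l 0 := by
  ext T
  constructor
  · rintro (rfl | rfl | rfl)
    · exact ⟨0, rfl⟩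
    · exact ⟨1, rfl⟩
    · exact ⟨2, rfl⟩
  · rintro ⟨l, rfl⟩
    fin_cases l
    · exact Or.inl rfl
    · exact Or.inr (Or.inl rfl)
    · exact Or.inr (Or.inr rfl)

theorem growthSpan_le_upSpan (hR : ∀ n, Ξ.R n = 1) (d : ℕ) :
    growthSpan K p (gens K p Ξ) d ≤ upSpan K p Ξ d := by
  have hg : ∀ x ∈ gens K p Ξ, x ∈ upSpan K p Ξ 1 := by
    rw [gens_eq]
    rintro _ ⟨l, rfl⟩
    exact lowSpan_le_upSpan _ (pivotEnd_mem l 0)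
  have hrn : ∀ s, ∀ c ∈ rnComm (gens K p Ξ) s, c ∈ upSpan K p Ξ (s + 1) := by
    intro s
    induction s with
    | zero => exact hg
    | succ s ih =>
      rintro c ⟨x, hx, b, hb, rfl⟩
      rw [add_comm (s + 1)]
      exact lie_mem_upSpan hR (hg x hx) (ih b hb)
  refine Submodule.span_le.2 ?_
  rintro _ ⟨s, k, hs, c, hc, rfl⟩
  have hk : ∀ k, c ^ p ^ k ∈ upSpan K p Ξ (p ^ k * (s + 1)) := by
    intro k
    induction k with
    | zero => simpa using hrn s c hc
    | succ k ih =>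
      rw [pow_succ, pow_mul, mul_comm (p ^ k), mul_assoc]
      exact pow_mem_upSpan hR ih
  exact upSpan_mono (by linarith) (hk k)

end UpperFiltration

end Clover

/-! ### The upper bound for the growth -/

/-- Counting by codes: `r x b` says that `b` is a code of `x`, every element has a code in `t`, and
a code determines its element. -/
theorem exists_finset_of_rel {V β : Type*} {S : Set V} {t : Finset β}
    (r : V → β → Prop) (h1 : ∀ x ∈ S, ∃ b ∈ t, r x b)
    (h2 : ∀ x ∈ S, ∀ y ∈ S, ∀ b ∈ t, r x b → r y b → x = y) :
    ∃ s : Finset V, (s : Set V) = S ∧ s.card ≤ t.card := by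
  classical
  rcases S.eq_empty_or_nonempty with rfl | ⟨x₀, hx₀⟩
  · exact ⟨∅, by simp, by simp⟩
  have : Nonempty β := ⟨(h1 x₀ hx₀).choose⟩
  choose! f hf hr using h1
  have hinj : Set.InjOn f S := fun x hx y hy hxy =>
    h2 x hx y hy (f x) (hf x hx) (hr x hx) (hxy ▸ hr y hy)
  have hfin : S.Finite := Set.Finite.of_finite_image
    (t.finite_toSet.subset (Set.image_subset_iff.2 fun x hx => hf x hx)) hinj
  refine ⟨hfin.toFinset, hfin.coe_toFinset, Finset.card_le_card_of_injOn f ?_ ?_⟩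
  · intro x hx
    exact hf x (hfin.mem_toFinset.1 hx)
  · rwa [hfin.coe_toFinset]

namespace Clover

open DPAlg

section UpperBound

theorem sum_pow_two_mul_le {p : ℕ} (hp : 2 ≤ p) (N : ℕ) :
    ∑ n ∈ Finset.range (N + 1), (p * p) ^ n ≤ 2 * (p * p) ^ N := by
  induction N with
  | zero => simp
  | succ N ih =>
    rw [Finset.sum_range_succ, pow_succ]
    have : 2 * (p * p) ^ N ≤ (p * p) ^ N * (p * p) := by
      rw [mul_comm]
      exact Nat.mul_le_mul_left _ (by nlinarith)
    omega

variable {K : Type*} [Field K] {p : ℕ} [Fact p.Prime] [CharP K p] {Ξ : CloverTuple}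

theorem exists_finset_lowSet (hR : ∀ n, Ξ.R n = 1) {d N : ℕ} (hd : 2 * d ≤ wt p Ξ N) :
    ∃ s : Finset (Module.End K (CloverRing K p Ξ)), (s : Set _) = lowSet K p Ξ d ∧
      s.card ≤ 6 * d * (p * p) ^ N := by
  have hp := (Fact.out : p.Prime).two_le
  -- A code consists of the family, the weight, the level and the exponents of the `y` and `z`; the
  -- exponents of the `x` are left out.
  let t : Finset (Fin 3 × ℕ × (Σ n : ℕ, Fin n → Fin p × Fin p)) :=
    Finset.univ ×ˢ Finset.Icc 1 d ×ˢ (Finset.range (N + 1)).sigma fun _ => Finset.univ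
  have ht : t.card ≤ 6 * d * (p * p) ^ N := by
    have h1 : t.card = 3 * (d * ∑ n ∈ Finset.range (N + 1), (p * p) ^ n) := by
      simp [t, Finset.card_product, Finset.card_sigma]
    rw [h1]
    calc 3 * (d * ∑ n ∈ Finset.range (N + 1), (p * p) ^ n)
        ≤ 3 * (d * (2 * (p * p) ^ N)) :=
          Nat.mul_le_mul_left _ (Nat.mul_le_mul_left _ (sum_pow_two_mul_le hp N))
      _ = _ := by ring
  suffices H : ∃ s : Finset (Module.End K (CloverRing K p Ξ)), (s : Set _) = lowSet K p Ξ d ∧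
      s.card ≤ t.card from H.imp fun s hs => ⟨hs.1, hs.2.trans ht⟩
  refine exists_finset_of_rel
    (fun T c => ∃ (α : DPExponent p Ξ.height),
      (α.1.support : Set CloverVar) ⊆ {a | level a < c.2.2.1} ∧
      Finsupp.weight (varDeg p Ξ) α.1 + c.2.1 = wt p Ξ c.2.2.1 ∧
      (∀ i : Fin c.2.2.1, α.1 (.y i) = (c.2.2.2 i).1 ∧ α.1 (.z i) = (c.2.2.2 i).2) ∧
      T = smulPivot K p Ξ c.1 c.2.2.1 (mono K α)) ?_ ?_
  · rintro _ ⟨l, n, α, e, h1, h2, h3, h4, rfl⟩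
    have hy : ∀ i, α.1 (.y i) < p := fun i => by
      have := α.2 (.y i)
      rwa [CloverTuple.height, hR, pow_one] at this
    have hz : ∀ i, α.1 (.z i) < p := fun i => by
      have := α.2 (.z i)
      rwa [CloverTuple.height, hR, pow_one] at this
    refine ⟨⟨l, e, n, fun i => (⟨_, hy i⟩, ⟨_, hz i⟩)⟩, ?_, α, h1, h2, fun i => ⟨rfl, rfl⟩, rfl⟩
    have hn : n < N + 1 := by
      cases n with
      | zero => omega
      | succ n =>
        rw [prevWt] at h3
        -- The lower bound on weights limits the level: `wt n < 2 * e ≤ 2 * d ≤ wt N`.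
        have : n < N := (wt_strictMono (p := p) (Ξ := Ξ)).lt_iff_lt.1 (by omega)
        omega
    simp only [t, Finset.mem_product, Finset.mem_univ, Finset.mem_Icc, Finset.mem_sigma,
      Finset.mem_range, true_and, and_true]
    exact ⟨⟨by omega, h4⟩, hn⟩
  · rintro _ - _ - ⟨l, e, n, f⟩ - ⟨α, h1, h2, h3, rfl⟩ ⟨β, h1', h2', h3', rfl⟩
    dsimp only at *
    suffices α = β by rw [this]
    rw [weight_eq_sum h1] at h2
    rw [weight_eq_sum h1'] at h2'
    have hyz : ∀ i < n, α.1 (.y i) = β.1 (.y i) ∧ α.1 (.z i) = β.1 (.z i) := by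
      intro i hi
      have e1 := h3 ⟨i, hi⟩
      have e2 := h3' ⟨i, hi⟩
      exact ⟨e1.1.trans e2.1.symm, e1.2.trans e2.2.symm⟩
    have hsplit : ∀ γ : DPExponent p Ξ.height,
        ∑ i ∈ Finset.range n, (γ.1 (.x i) + γ.1 (.y i) + γ.1 (.z i)) * wt p Ξ i =
        ∑ i ∈ Finset.range n, γ.1 (.x i) * wt p Ξ i +
        ∑ i ∈ Finset.range n, (γ.1 (.y i) + γ.1 (.z i)) * wt p Ξ i := by
      intro γ
      rw [← Finset.sum_add_distrib]
      exact Finset.sum_congr rfl fun i _ => by ring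
    have hyz' : ∑ i ∈ Finset.range n, (α.1 (.y i) + α.1 (.z i)) * wt p Ξ i =
        ∑ i ∈ Finset.range n, (β.1 (.y i) + β.1 (.z i)) * wt p Ξ i :=
      Finset.sum_congr rfl fun i hi => by
        rw [(hyz i (Finset.mem_range.1 hi)).1, (hyz i (Finset.mem_range.1 hi)).2]
    rw [hsplit] at h2 h2'
    -- After the known `y` and `z` contributions are subtracted, the total weight determines the `x`
    -- exponents as digits.
    have hx := eq_of_sum_mul_wt_eq (p := p) (Ξ := Ξ) (a := fun i => α.1 (.x i))
      (b := fun i => β.1 (.x i)) (fun i => α.2 (.x i)) (fun i => β.2 (.x i)) (n := n) (by omega)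
    refine Subtype.ext (Finsupp.ext fun a => ?_)
    by_cases ha : level a < n
    · cases a with
      | x i => exact hx i ha
      | y i => exact (hyz i ha).1
      | z i => exact (hyz i ha).2
    · have e1 : α.1 a = 0 := by
        by_contra h
        exact ha (h1 (Finsupp.mem_support_iff.2 h))
      have e2 : β.1 a = 0 := by
        by_contra h
        exact ha (h1' (Finsupp.mem_support_iff.2 h))
      rw [e1, e2]

/-- The weight `p ^ j * wt i` determines the operator, because it stays below `wt (i + 1)`. -/
theorem exists_finset_vPowSet (d : ℕ) :
    ∃ s : Finset (Module.End K (CloverRing K p Ξ)), (s : Set _) = vPowSet K p Ξ d ∧ s.card ≤ d := by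
  have hp := (Fact.out : p.Prime)
  suffices H : ∃ s : Finset (Module.End K (CloverRing K p Ξ)), (s : Set _) = vPowSet K p Ξ d ∧
      s.card ≤ (Finset.Icc 1 d).card by rwa [Nat.card_Icc, Nat.add_sub_cancel] at H
  refine exists_finset_of_rel
    (fun T c => ∃ i j : ℕ, j < Ξ.S i ∧ p ^ j * wt p Ξ i = c ∧ T = pivotEnd K p Ξ 0 i ^ p ^ j) ?_ ?_
  · rintro _ ⟨i, j, h1, h2, rfl⟩
    have := Nat.mul_pos (pow_pos hp.pos j) (wt_pos (p := p) (Ξ := Ξ) i)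
    exact ⟨_, Finset.mem_Icc.2 ⟨this, h2⟩, i, j, h1, rfl, rfl⟩
  · rintro _ - _ - c - ⟨i, j, h1, h2, rfl⟩ ⟨i', j', h1', h2', rfl⟩
    have key : ∀ {i j i' j' : ℕ}, j < Ξ.S i → i < i' →
        p ^ j * wt p Ξ i < p ^ j' * wt p Ξ i' := by
      intro i j i' j' hj hi
      calc p ^ j * wt p Ξ i < wt p Ξ (i + 1) := pow_mul_wt_lt hj.le
        _ ≤ wt p Ξ i' := wt_strictMono.monotone hi
        _ ≤ _ := Nat.le_mul_of_pos_left _ (pow_pos hp.pos _)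
    rcases lt_trichotomy i i' with h | rfl | h
    · have := key (j' := j') h1 h
      omega
    · have h3 := Nat.eq_of_mul_eq_mul_right (wt_pos i) (h2.trans h2'.symm)
      rw [h3]
    · have := key (j' := j) h1' h
      omega

theorem cloverGrowth_le (hR : ∀ n, Ξ.R n = 1) {d N : ℕ} (hd : 2 * d ≤ wt p Ξ N) :
    cloverGrowth K p Ξ d ≤ 7 * d * (p * p) ^ N := by
  classical
  obtain ⟨s, hs, hsc⟩ := exists_finset_lowSet (K := K) hR hd
  obtain ⟨t, ht, htc⟩ := exists_finset_vPowSet (K := K) (p := p) (Ξ := Ξ) d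
  have h1 : upSpan K p Ξ d = Submodule.span K ((s ∪ t : Finset _) : Set _) := by
    rw [upSpan, ← hs, ← ht, Finset.coe_union]
  have hfin : FiniteDimensional K (upSpan K p Ξ d) := by
    rw [h1]
    exact FiniteDimensional.span_finset K _
  have h2 : cloverGrowth K p Ξ d ≤ Module.finrank K (upSpan K p Ξ d) :=
    Submodule.finrank_mono (growthSpan_le_upSpan hR d)
  have h3 : Module.finrank K (upSpan K p Ξ d) ≤ (s ∪ t).card := by
    rw [h1]
    exact finrank_span_finset_le_card _
  have h4 := Finset.card_union_le s t
  have h5 : d ≤ d * (p * p) ^ N :=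
    Nat.le_mul_of_pos_right _ (pow_pos (Nat.mul_pos (Fact.out : p.Prime).pos
      (Fact.out : p.Prime).pos) _)
  linarith

end UpperBound

end Clover

/-! ### Elements of clover algebras -/

namespace DPAlg

section Erase

variable {Θ : Type*} {K : Type*} [Field K] {p : ℕ} [Fact p.Prime] {S : Θ → ℕ}

/-- Set the exponent of one variable to zero. -/
noncomputable def eraseExp (α : DPExponent p S) (a : Θ) : DPExponent p S :=
  ⟨α.1.erase a, fun b => by
    classical
    rw [Finsupp.erase_apply]
    split_ifs
    · exact pow_pos (Fact.out : p.Prime).pos _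
    · exact α.2 b⟩

theorem eraseExp_same (α : DPExponent p S) (a : Θ) : (eraseExp α a).1 a = 0 :=
  Finsupp.erase_same

theorem eraseExp_ne (α : DPExponent p S) {a b : Θ} (h : b ≠ a) : (eraseExp α a).1 b = α.1 b :=
  Finsupp.erase_ne h

theorem single_add_eraseExp (α : DPExponent p S) (a : Θ) :
    Finsupp.single a (α.1 a) + (eraseExp α a).1 = α.1 := Finsupp.single_add_erase a α.1

theorem mono_eq_dpow_mul (α : DPExponent p S) (a : Θ) :
    mono K α = dpow K p S a (α.1 a) * mono K (eraseExp α a) := by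
  rw [dpow_mul_mono_of_apply_eq_zero _ _ _ (eraseExp_same α a), single_add_eraseExp]
  exact (monoZ_coe α).symm

theorem support_eraseExp (α : DPExponent p S) (a : Θ) :
    ((eraseExp α a).1.support : Set Θ) ⊆ α.1.support := by
  classical
  have : (eraseExp α a).1.support = α.1.support.erase a := Finsupp.support_erase
  rw [this]
  exact_mod_cast Finset.erase_subset _ _

theorem weight_eraseExp (ω : Θ → ℕ) (α : DPExponent p S) (a : Θ) :
    α.1 a * ω a + Finsupp.weight ω (eraseExp α a).1 = Finsupp.weight ω α.1 := by
  conv_rhs => rw [← single_add_eraseExp α a]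
  rw [map_add, Finsupp.weight_single, smul_eq_mul]

end Erase

end DPAlg

/-! ### Monomial multiples of pivots inside the algebra. -/

namespace Clover

open DPAlg

section Elements

variable {K : Type*} [Field K] {p : ℕ} {Ξ : CloverTuple}

theorem mono_mem_lowHomog {n : ℕ} {α : DPExponent p Ξ.height}
    (h : (α.1.support : Set CloverVar) ⊆ {a | level a < n}) :
    mono K α ∈ lowHomog K p Ξ n (Finsupp.weight (varDeg p Ξ) α.1) :=
  Submodule.subset_span ⟨α, ⟨h, rfl⟩, rfl⟩

/-- Exponents of level `< n` with the exponents of the variables `x i` less than `p ^ S i - 1`. -/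
def IsSmall (n : ℕ) (α : DPExponent p Ξ.height) : Prop :=
  (α.1.support : Set CloverVar) ⊆ {a | level a < n} ∧ ∀ i, α.1 (.x i) + 2 ≤ p ^ Ξ.S i

theorem IsSmall.of_succ {n : ℕ} {γ : DPExponent p Ξ.height} (h : IsSmall (n + 1) γ)
    (hx : γ.1 (.x n) = 0) (hy : γ.1 (.y n) = 0) (hz : γ.1 (.z n) = 0) : IsSmall n γ := by
  refine ⟨fun a ha => ?_, h.2⟩
  have h1 : level a < n + 1 := h.1 ha
  rcases Nat.lt_succ_iff_lt_or_eq.1 h1 with h2 | h2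
  · exact h2
  · have h3 : γ.1 a ≠ 0 := Finsupp.mem_support_iff.1 ha
    cases a <;> simp only [level] at h2 <;> subst h2 <;> contradiction

variable [Fact p.Prime]

theorem dpow_succ_mul_top (a : CloverVar) (i : ℕ) :
    dpow K p Ξ.height a (i + 1) * top K p Ξ a = 0 := by
  have h2 := two_le_prime_pow_height (p := p) (Ξ := Ξ) a
  exact dpow_mul_dpow_eq_zero (Fact.out : p.Prime).pos
    (show p ^ Ξ.height a ≤ i + 1 + (p ^ Ξ.height a - 1) by omega)

theorem wt_succ_eq (hR : ∀ n, Ξ.R n = 1) (l : Fin 3) (n : ℕ) :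
    wt p Ξ (n + 1) = p ^ Ξ.height (var l n) * wt p Ξ n +
      (p ^ Ξ.height (partner l n) - 1) * wt p Ξ n := by
  have hp := (Fact.out : p.Prime).pos
  have hS : 0 < p ^ Ξ.S n := pow_pos hp _
  rw [wt_succ, ← add_mul]
  congr 1
  fin_cases l <;> simp only [var, partner, CloverTuple.height, hR, pow_one] <;> omega

theorem IsSmall.erase {n : ℕ} {α : DPExponent p Ξ.height} (h : IsSmall n α) (a : CloverVar) :
    IsSmall n (eraseExp α a) := by
  refine ⟨(support_eraseExp α a).trans h.1, fun i => ?_⟩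
  by_cases hi : .x i = a
  · rw [hi, eraseExp_same, zero_add]
    exact two_le_prime_pow_height (.x i)
  · rw [eraseExp_ne α hi]
    exact h.2 i

theorem mono_eq_x_mul_z_mul {n : ℕ} {γ : DPExponent p Ξ.height} :
    mono K γ = mono K (eraseExp (eraseExp γ (.x n)) (.z n)) *
      (dpow K p Ξ.height (.x n) (γ.1 (.x n)) * dpow K p Ξ.height (.z n) (γ.1 (.z n))) := by
  rw [mono_eq_dpow_mul γ (.x n), mono_eq_dpow_mul (eraseExp γ (.x n)) (.z n),
    eraseExp_ne γ (by simp : CloverVar.z n ≠ .x n)]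
  ring

theorem small_weight_eq (hR : ∀ n, Ξ.R n = 1) {n : ℕ} {γ : DPExponent p Ξ.height}
    (hγ : IsSmall (n + 1) γ) (hy : γ.1 (.y n) = 0) :
    IsSmall n (eraseExp (eraseExp γ (.x n)) (.z n)) ∧
    Finsupp.weight (varDeg p Ξ) γ.1 = (γ.1 (.x n) + γ.1 (.z n)) * wt p Ξ n +
      Finsupp.weight (varDeg p Ξ) (eraseExp (eraseExp γ (.x n)) (.z n)).1 ∧
    Finsupp.weight (varDeg p Ξ) (eraseExp (eraseExp γ (.x n)) (.z n)).1 < 2 * wt p Ξ n := by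
  have hzx : (eraseExp γ (.x n)).1 (.z n) = γ.1 (.z n) := eraseExp_ne γ (by simp)
  have hβs : IsSmall n (eraseExp (eraseExp γ (.x n)) (.z n)) := by
    refine ((hγ.erase (.x n)).erase (.z n)).of_succ ?_ ?_ (eraseExp_same _ _)
    · rw [eraseExp_ne _ (by simp), eraseExp_same]
    · rw [eraseExp_ne _ (by simp), eraseExp_ne _ (by simp), hy]
  refine ⟨hβs, ?_, ?_⟩
  · rw [← weight_eraseExp _ γ (.x n), ← weight_eraseExp _ (eraseExp γ (.x n)) (.z n), hzx]
    simp only [varDeg, level]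
    ring
  · have := two_mul_weight_lt hR hβs.1
    have := wt_pos (p := p) (Ξ := Ξ) n
    omega

/-- The exponents of level `n` sum to at most `p ^ S n + p - 3`. The missing `2 * wt n` absorbs all
lower levels, so `wt (n + 1)` minus this degree is a genuine difference. -/
theorem small_weight_le (hR : ∀ n, Ξ.R n = 1) {n : ℕ} {γ : DPExponent p Ξ.height}
    (hγ : IsSmall (n + 1) γ) (hy : γ.1 (.y n) = 0) :
    Finsupp.weight (varDeg p Ξ) γ.1 ≤ wt p Ξ (n + 1) := by
  obtain ⟨-, h1, h2⟩ := small_weight_eq hR hγ hy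
  have hx := hγ.2 n
  have hz : γ.1 (.z n) < p := by
    have := γ.2 (.z n)
    rwa [CloverTuple.height, hR, pow_one] at this
  have h3 : (γ.1 (.x n) + γ.1 (.z n) + 2) * wt p Ξ n ≤ wt p Ξ (n + 1) := by
    rw [wt_succ]
    exact Nat.mul_le_mul_right _ (by omega)
  rw [add_mul] at h3
  omega

variable [CharP K p]

/-- The remaining term would be `f` times the tail times a bracket of level `n + 1`. Either
alternative kills it, so bracketing with a pivot merely differentiates the coefficient. -/
theorem lie_pivotEnd_smulPivot (l l' : Fin 3) (n : ℕ) {f : CloverRing K p Ξ}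
    (h : l = l' ∨ f * tail K p Ξ l n = 0) :
    ⁅pivotEnd K p Ξ l n, smulPivot K p Ξ l' (n + 1) f⁆ =
      smulPivot K p Ξ l' (n + 1) (pivot K p Ξ l n f) := by
  have e : ⁅pivot K p Ξ l n, pivot K p Ξ l' (n + 1)⁆ =
      tail K p Ξ l n • ⁅pivot K p Ξ l (n + 1), pivot K p Ξ l' (n + 1)⁆ := by
    have hz : pivot K p Ξ l' (n + 1) (tail K p Ξ l n) = 0 := by
      rw [tail, Derivation.leibniz, pivot_apply_of_mem l' (top_mem_lowHomog _ (by simp)),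
        pivot_apply_of_mem l' (top_mem_lowHomog _ (by simp)), smul_zero, smul_zero, add_zero]
    conv_lhs => rw [pivot_eq K p Ξ l n]
    rw [add_lie, partialDer_lie_pivot (by simp), smul_lie_der, hz, zero_smul, sub_zero, zero_add]
  have e2 : ⁅pivot K p Ξ l n, f • pivot K p Ξ l' (n + 1)⁆ =
      pivot K p Ξ l n f • pivot K p Ξ l' (n + 1) := by
    rw [lie_smul_der, e, smul_smul]
    rcases h with rfl | h
    · rw [lie_self, smul_zero, add_zero]
    · rw [h, zero_smul, add_zero]
  have e3 := congrArg (fun D : Derivation K (CloverRing K p Ξ) (CloverRing K p Ξ) =>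
    (D : Module.End K (CloverRing K p Ξ))) e2
  rw [Derivation.commutator_coe_linear_map] at e3
  exact e3

theorem pivot_apply_dpow_succ (l : Fin 3) (n : ℕ) {i : ℕ} (hi : i + 1 < p ^ Ξ.height (var l n)) :
    pivot K p Ξ l n (dpow K p Ξ.height (var l n) (i + 1)) = dpow K p Ξ.height (var l n) i := by
  obtain ⟨f, hf, -, -, h1, -⟩ := pivot_eq_vecField (K := K) (p := p) (Ξ := Ξ) l n
  rw [hf, vecField_dpow, h1, one_mul, pd_dpow_succ hi]

/-- The standard filtration of the clover algebra. -/
noncomputable abbrev cloverSpan (K : Type*) [Field K] (p : ℕ) [Fact p.Prime] [CharP K p]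
    (Ξ : CloverTuple) (d : ℕ) : Submodule K (Module.End K (CloverRing K p Ξ)) :=
  growthSpan K p (gens K p Ξ) d

/-- `pivot_pow` supplies the top divided power of the partner variable; each bracket with the pivot
of that variable lowers the exponent by one at the cost of `wt n`. Membership at level `n` is a
hypothesis because exponent `0` is the induction step of `pivotEnd_mem_cloverSpan`. -/
theorem dpow_partner_mem_of_pivotEnd_mem (hR : ∀ n, Ξ.R n = 1) {n : ℕ}
    (h : ∀ l, pivotEnd K p Ξ l n ∈ cloverSpan K p Ξ (wt p Ξ n)) (l : Fin 3) {i : ℕ}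
    (hi : i < p ^ Ξ.height (partner l n)) {e : ℕ} (he : e + i * wt p Ξ n = wt p Ξ (n + 1)) :
    smulPivot K p Ξ l (n + 1) (dpow K p Ξ.height (partner l n) i) ∈ cloverSpan K p Ξ e := by
  have key : ∀ j < p ^ Ξ.height (partner l n),
      smulPivot K p Ξ l (n + 1) (dpow K p Ξ.height (partner l n)
        (p ^ Ξ.height (partner l n) - 1 - j)) ∈
      cloverSpan K p Ξ (p ^ Ξ.height (var l n) * wt p Ξ n + j * wt p Ξ n) := by
    intro j
    induction j with
    | zero =>
      intro _
      have e1 : pivotEnd K p Ξ l n ^ p ^ Ξ.height (var l n) =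
        smulPivot K p Ξ l (n + 1) (top K p Ξ (partner l n)) := pivot_pow l n
      have := pow_pow_mem_growthSpan (h l) (Ξ.height (var l n))
      rw [e1] at this
      rw [zero_mul, add_zero, Nat.sub_zero]
      exact this
    | succ j ih =>
      intro hj
      obtain ⟨l', hl'⟩ : ∃ l', var l' n = partner l n := by
        have := exists_var (partner l n)
        rwa [level_partner] at this
      obtain ⟨k, hk⟩ : ∃ k, p ^ Ξ.height (partner l n) - 1 - j = k + 1 :=
        ⟨p ^ Ξ.height (partner l n) - 1 - j - 1, by omega⟩
      have hk' : p ^ Ξ.height (partner l n) - 1 - (j + 1) = k := by omega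
      have h1 := lie_mem_growthSpan (h l') (ih (by omega))
      rw [hk, lie_pivotEnd_smulPivot, ← hl', pivot_apply_dpow_succ _ _ (by rw [hl']; omega), hl']
        at h1
      · rw [hk', show p ^ Ξ.height (var l n) * wt p Ξ n + (j + 1) * wt p Ξ n =
          wt p Ξ n + (p ^ Ξ.height (var l n) * wt p Ξ n + j * wt p Ξ n) by ring]
        exact h1
      · right
        -- A positive divided power times the top one of the same variable is zero.
        rw [tail, ← mul_assoc, hl', dpow_succ_mul_top, zero_mul]
  have h2 := wt_succ_eq (p := p) hR l n
  have h3 := key (p ^ Ξ.height (partner l n) - 1 - i) (by omega)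
  rw [show p ^ Ξ.height (partner l n) - 1 - (p ^ Ξ.height (partner l n) - 1 - i) = i by omega]
    at h3
  have h4 : (p ^ Ξ.height (partner l n) - 1 - i) * wt p Ξ n + i * wt p Ξ n =
      (p ^ Ξ.height (partner l n) - 1) * wt p Ξ n := by
    rw [← add_mul, Nat.sub_add_cancel (by omega)]
  rw [show e = p ^ Ξ.height (var l n) * wt p Ξ n +
    (p ^ Ξ.height (partner l n) - 1 - i) * wt p Ξ n by omega]
  exact h3

theorem pivotEnd_mem_cloverSpan (hR : ∀ n, Ξ.R n = 1) (n : ℕ) (l : Fin 3) :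
    pivotEnd K p Ξ l n ∈ cloverSpan K p Ξ (wt p Ξ n) := by
  induction n generalizing l with
  | zero =>
    refine subset_growthSpan p ?_
    rw [gens_eq]
    exact ⟨l, rfl⟩
  | succ n ih =>
    have := dpow_partner_mem_of_pivotEnd_mem hR ih l
      (pow_pos (Fact.out : p.Prime).pos _) (i := 0) (e := wt p Ξ (n + 1)) (by simp)
    rwa [dpow_zero, smulPivot_one] at this

theorem dpow_partner_mem (hR : ∀ n, Ξ.R n = 1) (l : Fin 3) {n i : ℕ}
    (hi : i < p ^ Ξ.height (partner l n)) {e : ℕ} (he : e + i * wt p Ξ n = wt p Ξ (n + 1)) :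
    smulPivot K p Ξ l (n + 1) (dpow K p Ξ.height (partner l n) i) ∈ cloverSpan K p Ξ e :=
  dpow_partner_mem_of_pivotEnd_mem hR (pivotEnd_mem_cloverSpan hR n) l hi he

/-- The tail of `v n` does not involve `z n`, so only one of the two terms survives. For `v n` and
`w n` each tail involves both variables, which is why the third generator yields single monomial
multiples. -/
theorem lie_v_u (n : ℕ) : ⁅pivot K p Ξ 0 n, pivot K p Ξ 2 n⁆ =
    (dpow K p Ξ.height (.x n) (p ^ Ξ.S n - 2) * dpow K p Ξ.height (.z n) (p ^ Ξ.R n - 1)) •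
      pivot K p Ξ 2 (n + 1) := by
  have h2 : 2 ≤ p ^ Ξ.S n := two_le_prime_pow_height (.x n)
  have e1 : pd (.z n) (tail K p Ξ 0 n) = 0 :=
    pd_mul_eq_zero (pd_dpow_of_ne (by simp [var]) _) (pd_dpow_of_ne (by simp [partner]) _)
  have e2 : pd (.x n) (tail K p Ξ 2 n) =
      dpow K p Ξ.height (.x n) (p ^ Ξ.S n - 2) * dpow K p Ξ.height (.z n) (p ^ Ξ.R n - 1) := by
    have e3 : pd (.x n) (top K p Ξ (.z n)) = 0 := pd_dpow_of_ne (by simp) _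
    have e4 : pd (.x n) (top K p Ξ (.x n)) = dpow K p Ξ.height (.x n) (p ^ Ξ.S n - 2) := by
      have : p ^ Ξ.S n - 1 = p ^ Ξ.S n - 2 + 1 := by omega
      change pd (.x n) (dpow K p Ξ.height (.x n) (p ^ Ξ.S n - 1)) = _
      rw [this]
      exact pd_dpow_succ (S := Ξ.height) (a := .x n)
        (show p ^ Ξ.S n - 2 + 1 < p ^ Ξ.S n by omega)
    change pd (.x n) (top K p Ξ (.z n) * top K p Ξ (.x n)) = _
    rw [← partialDer_apply] at e3 e4 ⊢
    rw [Derivation.leibniz, e3, e4, smul_zero, add_zero, smul_eq_mul, mul_comm]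
    rfl
  rw [lie_pivot_same_level]
  change pd (.x n) (tail K p Ξ 2 n) • pivot K p Ξ 2 (n + 1) -
    pd (.z n) (tail K p Ξ 0 n) • pivot K p Ξ 0 (n + 1) = _
  rw [e1, e2, zero_smul, sub_zero]

/-- `ad (v n)` lowers the exponent of `x n` and `ad (u n)` that of `z n`. Neither affects the other
variable or `f`, and each step costs `wt n`. -/
theorem lower_u_mem_of_top_mem (hR : ∀ n, Ξ.R n = 1) {n : ℕ} {f : CloverRing K p Ξ} {k : ℤ}
    (hf : f ∈ lowHomog K p Ξ n k) {e : ℕ}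
    (h : smulPivot K p Ξ 2 (n + 1) (f * (dpow K p Ξ.height (.x n) (p ^ Ξ.S n - 2) *
      dpow K p Ξ.height (.z n) (p ^ Ξ.R n - 1))) ∈ cloverSpan K p Ξ e) {i j : ℕ}
    (hi : i + 2 ≤ p ^ Ξ.S n) (hj : j < p) :
    smulPivot K p Ξ 2 (n + 1) (f * (dpow K p Ξ.height (.x n) (p ^ Ξ.S n - 2 - i) *
      dpow K p Ξ.height (.z n) (p - 1 - j))) ∈ cloverSpan K p Ξ (e + (i + j) * wt p Ξ n) := by
  rw [hR, pow_one] at h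
  have hv := pivotEnd_mem_cloverSpan (K := K) (p := p) hR n 0
  have hu := pivotEnd_mem_cloverSpan (K := K) (p := p) hR n 2
  have hf0 := fun l => pivot_apply_of_mem l hf
  have h1 : ∀ i, i + 2 ≤ p ^ Ξ.S n →
      smulPivot K p Ξ 2 (n + 1) (f * (dpow K p Ξ.height (.x n) (p ^ Ξ.S n - 2 - i) *
      dpow K p Ξ.height (.z n) (p - 1))) ∈ cloverSpan K p Ξ (e + i * wt p Ξ n) := by
    intro i
    induction i with
    | zero =>
      intro _
      simpa using h
    | succ i ih =>
      intro hi
      obtain ⟨k, hk⟩ : ∃ k, p ^ Ξ.S n - 2 - i = k + 1 := ⟨p ^ Ξ.S n - 2 - i - 1, by omega⟩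
      have hk' : p ^ Ξ.S n - 2 - (i + 1) = k := by omega
      have h2 := lie_mem_growthSpan hv (ih (by omega))
      have e1 : pivot K p Ξ 0 n (dpow K p Ξ.height (.x n) (k + 1)) =
          dpow K p Ξ.height (.x n) k :=
        pivot_apply_dpow_succ 0 n (show k + 1 < p ^ Ξ.S n by omega)
      have e2 : pivot K p Ξ 0 n (dpow K p Ξ.height (.z n) (p - 1)) = 0 :=
        pivot_apply_var_of_ne (l' := 2) (by decide) n n _
      rw [hk, lie_pivotEnd_smulPivot] at h2
      · rw [hk']
        rw [Derivation.leibniz, Derivation.leibniz, hf0, e1, e2] at h2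
        simp only [mul_zero, zero_add, add_zero, smul_eq_mul] at h2
        rw [mul_comm (dpow K p Ξ.height (.z n) _)] at h2
        rw [show e + (i + 1) * wt p Ξ n = wt p Ξ n + (e + i * wt p Ξ n) by ring]
        exact h2
      · right
        have e3 : dpow K p Ξ.height (.x n) (k + 1) * top K p Ξ (.x n) = 0 := dpow_succ_mul_top _ _
        change _ * (top K p Ξ (.x n) * top K p Ξ (.y n)) = 0
        calc _ = f * dpow K p Ξ.height (.z n) (p - 1) * top K p Ξ (.y n) *
            (dpow K p Ξ.height (.x n) (k + 1) * top K p Ξ (.x n)) := by ring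
          _ = 0 := by rw [e3, mul_zero]
  induction j with
  | zero => simpa using h1 i hi
  | succ j ih =>
    obtain ⟨k, hk⟩ : ∃ k, p - 1 - j = k + 1 := ⟨p - 1 - j - 1, by omega⟩
    have hk' : p - 1 - (j + 1) = k := by omega
    have h2 := lie_mem_growthSpan hu (ih (by omega))
    have e1 : pivot K p Ξ 2 n (dpow K p Ξ.height (.z n) (k + 1)) =
        dpow K p Ξ.height (.z n) k :=
      pivot_apply_dpow_succ 2 n (show k + 1 < p ^ Ξ.R n by rw [hR, pow_one]; omega)
    have e2 : pivot K p Ξ 2 n (dpow K p Ξ.height (.x n) (p ^ Ξ.S n - 2 - i)) = 0 :=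
      pivot_apply_var_of_ne (l' := 0) (by decide) n n _
    rw [hk, lie_pivotEnd_smulPivot _ _ _ (Or.inl rfl), Derivation.leibniz, Derivation.leibniz, hf0,
      e1, e2] at h2
    simp only [mul_zero, add_zero, smul_eq_mul] at h2
    rw [hk', show e + (i + (j + 1)) * wt p Ξ n = wt p Ξ n + (e + (i + j) * wt p Ξ n) by ring]
    exact h2

/-- The monomial is the product of its lower part and powers of `x n` and `z n`. The hypothesis
gives these at exponents `p ^ S n - 2` and `p - 1`, and they are lowered to the required ones. -/
theorem small_u_mem_of_lie_mem (hR : ∀ n, Ξ.R n = 1) {n : ℕ}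
    (H : ∀ (β : DPExponent p Ξ.height) (e : ℕ), IsSmall n β →
      e + Finsupp.weight (varDeg p Ξ) β.1 = 2 * wt p Ξ n →
      smulPivot K p Ξ 2 (n + 1) (mono K β * (dpow K p Ξ.height (.x n) (p ^ Ξ.S n - 2) *
        dpow K p Ξ.height (.z n) (p ^ Ξ.R n - 1))) ∈ cloverSpan K p Ξ e)
    {γ : DPExponent p Ξ.height} {e : ℕ} (hγ : IsSmall (n + 1) γ) (hy : γ.1 (.y n) = 0)
    (he : e + Finsupp.weight (varDeg p Ξ) γ.1 = wt p Ξ (n + 1)) :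
    smulPivot K p Ξ 2 (n + 1) (mono K γ) ∈ cloverSpan K p Ξ e := by
  have hp := (Fact.out : p.Prime).two_le
  have hx2 := hγ.2 n
  have hz : γ.1 (.z n) < p := by
    have := γ.2 (.z n)
    rwa [CloverTuple.height, hR, pow_one] at this
  obtain ⟨hβs, hw, hβw⟩ := small_weight_eq hR hγ hy
  set β := eraseExp (eraseExp γ (.x n)) (.z n) with hβ
  have h1 := H β (2 * wt p Ξ n - Finsupp.weight (varDeg p Ξ) β.1) hβs (by omega)
  have h2 := lower_u_mem_of_top_mem hR (mono_mem_lowHomog (K := K) hβs.1) h1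
    (i := p ^ Ξ.S n - 2 - γ.1 (.x n)) (j := p - 1 - γ.1 (.z n)) (by omega) (by omega)
  rw [show p ^ Ξ.S n - 2 - (p ^ Ξ.S n - 2 - γ.1 (.x n)) = γ.1 (.x n) by omega,
    show p - 1 - (p - 1 - γ.1 (.z n)) = γ.1 (.z n) by omega, ← mono_eq_x_mul_z_mul] at h2
  have h3 : (p ^ Ξ.S n - 2 - γ.1 (.x n) + (p - 1 - γ.1 (.z n))) * wt p Ξ n +
      (γ.1 (.x n) + γ.1 (.z n)) * wt p Ξ n + 2 * wt p Ξ n = wt p Ξ (n + 1) := by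
    rw [← add_mul, ← add_mul, wt_succ]
    congr 1
    omega
  refine growthSpan_mono p _ ?_ h2
  omega

theorem smulPivot_lie_v_u (n : ℕ) (f : CloverRing K p Ξ) : smulPivot K p Ξ 2 (n + 1) (f *
      (dpow K p Ξ.height (.x n) (p ^ Ξ.S n - 2) * dpow K p Ξ.height (.z n) (p ^ Ξ.R n - 1))) =
      ((f • ⁅pivot K p Ξ 0 n, pivot K p Ξ 2 n⁆ : Derivation K (CloverRing K p Ξ)
        (CloverRing K p Ξ)) : Module.End K (CloverRing K p Ξ)) := by
  rw [lie_v_u, smul_smul]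
  rfl

/-- Multiples of `u (n + 1)` reached so far lack `y n`. That power is put on the other factor:
`[y_n^(b) v_{n+1}, m u_{n+1}] = y_n^(b) m [v_{n+1}, u_{n+1}]`, as neither pivot differentiates level
`n`. -/
theorem small_lie_v_u_mem (hR : ∀ n, Ξ.R n = 1) (n : ℕ) {β : DPExponent p Ξ.height} {e : ℕ}
    (hβ : IsSmall n β) (he : e + Finsupp.weight (varDeg p Ξ) β.1 = 2 * wt p Ξ n) :
    smulPivot K p Ξ 2 (n + 1) (mono K β * (dpow K p Ξ.height (.x n) (p ^ Ξ.S n - 2) *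
        dpow K p Ξ.height (.z n) (p ^ Ξ.R n - 1))) ∈ cloverSpan K p Ξ e := by
  induction n generalizing β e with
  | zero =>
    have h0 : β = 0 := by
      refine Subtype.ext (Finsupp.ext fun a => ?_)
      by_contra h
      exact absurd (hβ.1 (Finsupp.mem_support_iff.2 h)) (Nat.not_lt_zero _)
    have h1 := lie_mem_growthSpan (pivotEnd_mem_cloverSpan (K := K) (p := p) hR 0 0)
      (pivotEnd_mem_cloverSpan (K := K) (p := p) hR 0 2)
    have h2 : Finsupp.weight (varDeg p Ξ) β.1 = 0 := by
      rw [h0]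
      exact map_zero _
    rw [h2, add_zero, two_mul] at he
    rw [smulPivot_lie_v_u, h0, mono_zero, one_smul, Derivation.commutator_coe_linear_map, he]
    exact h1
  | succ n ih =>
    have hb : β.1 (.y n) < p := by
      have := β.2 (.y n)
      rwa [CloverTuple.height, hR, pow_one] at this
    have hγ := hβ.erase (.y n)
    have hγ0 := eraseExp_same β (.y n)
    have hw := weight_eraseExp (varDeg p Ξ) β (.y n)
    simp only [varDeg, level] at hw
    change β.1 (.y n) * wt p Ξ n + Finsupp.weight (varDeg p Ξ) _ =
      Finsupp.weight (varDeg p Ξ) _ at hw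
    have hle := small_weight_le hR hγ hγ0
    have hle' : β.1 (.y n) * wt p Ξ n ≤ wt p Ξ (n + 1) := by
      rw [wt_succ]
      exact Nat.mul_le_mul_right _ (by have := pow_pos (Fact.out : p.Prime).pos (Ξ.S n); omega)
    have h1 := small_u_mem_of_lie_mem (K := K) hR (fun β e => ih) hγ hγ0
      (Nat.sub_add_cancel hle)
    have h2 := dpow_partner_mem (K := K) (p := p) hR 0 (n := n) (i := β.1 (.y n)) (β.2 (.y n))
      (Nat.sub_add_cancel hle')
    have h3 := lie_mem_growthSpan h2 h1
    have e1 : ⁅dpow K p Ξ.height (.y n) (β.1 (.y n)) • pivot K p Ξ 0 (n + 1),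
        mono K (eraseExp β (.y n)) • pivot K p Ξ 2 (n + 1)⁆ =
        mono K β • ⁅pivot K p Ξ 0 (n + 1), pivot K p Ξ 2 (n + 1)⁆ := by
      rw [smul_lie_der, Derivation.smul_apply, pivot_apply_of_mem 2 (dpow_mem_lowHomog
        (by simp [level]) _), smul_zero, zero_smul, sub_zero, lie_smul_der,
        pivot_apply_of_mem 0 (mono_mem_lowHomog hγ.1), zero_smul, zero_add, smul_smul,
        ← mono_eq_dpow_mul]
    rw [smulPivot_lie_v_u, ← e1, Derivation.commutator_coe_linear_map]
    refine growthSpan_mono p _ ?_ h3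
    omega

/-- Multiples of `u (n + 1)` by small monomials lie in the clover algebra. -/
theorem small_u_mem (hR : ∀ n, Ξ.R n = 1) {n : ℕ} {γ : DPExponent p Ξ.height} {e : ℕ}
    (hγ : IsSmall (n + 1) γ) (hy : γ.1 (.y n) = 0)
    (he : e + Finsupp.weight (varDeg p Ξ) γ.1 = wt p Ξ (n + 1)) :
    smulPivot K p Ξ 2 (n + 1) (mono K γ) ∈ cloverSpan K p Ξ e :=
  small_u_mem_of_lie_mem hR (fun _ _ => small_lie_v_u_mem hR n) hγ hy he

end Elements

end Clover

/-! ### The centre of a clover algebra is zero -/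

/-! ### Derivations among the linear operators. -/

section DerivationOperators

variable (K : Type*) [Field K] (R : Type*) [CommRing R] [Algebra K R]

/-- The derivations among the linear operators on `R`: those `T` with `[T, a] = T a` for all
multiplication operators `a`. -/
def derSubalgebra : LieSubalgebra K (Module.End K R) where
  carrier := {T | ∀ a, ⁅T, LinearMap.mulLeft K a⁆ = LinearMap.mulLeft K (T a)}
  add_mem' {T U} hT hU a := by
    have hT' := hT a
    have hU' := hU a
    rw [add_lie, hT', hU', LinearMap.add_apply]
    exact LinearMap.ext fun b => (add_mul _ _ _).symm
  zero_mem' a := by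
    rw [zero_lie, LinearMap.zero_apply, LinearMap.mulLeft_zero_eq_zero]
  smul_mem' c T hT a := by
    have hT' := hT a
    rw [smul_lie, hT', LinearMap.smul_apply]
    exact LinearMap.ext fun b => (smul_mul_assoc _ _ _).symm
  lie_mem' {T U} hT hU a := by
    have hT' := hT
    have hU' := hU
    rw [lie_lie, hU' a, hT' a, hT' (U a), hU' (T a)]
    exact LinearMap.ext fun b => (sub_mul _ _ _).symm

variable {K R}

theorem coe_mem_derSubalgebra (D : Derivation K R R) :
    (D : Module.End K R) ∈ derSubalgebra K R := by
  intro a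
  refine LinearMap.ext fun b => ?_
  change D (a * b) - a * D b = D a * b
  rw [Derivation.leibniz, smul_eq_mul, smul_eq_mul]
  ring

/-- Iterated brackets of `T` with multiplication by `a` are multiplication by `T ^ n a`; in
characteristic `p` the `p`-fold one is the bracket with `T ^ p`. -/
theorem pow_mem_derSubalgebra {p : ℕ} [Fact p.Prime] [CharP (Module.End K R) p]
    {T : Module.End K R} (hT : T ∈ derSubalgebra K R) : T ^ p ∈ derSubalgebra K R := by
  intro a
  have h : ∀ n, adIter T n (LinearMap.mulLeft K a) = LinearMap.mulLeft K ((T ^ n) a) := by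
    intro n
    induction n with
    | zero => rfl
    | succ n ih =>
      rw [adIter_succ, ih, hT ((T ^ n) a), pow_succ', Module.End.mul_apply]
  rw [lie_pow_char, h]

theorem apply_mul_of_mem_derSubalgebra {T : Module.End K R} (hT : T ∈ derSubalgebra K R)
    (a b : R) : T (a * b) = a * T b + T a * b := by
  have h : T (a * b) - a * T b = T a * b := LinearMap.congr_fun (hT a) b
  rw [← h]
  ring

theorem apply_one_of_mem_derSubalgebra {T : Module.End K R} (hT : T ∈ derSubalgebra K R) :
    T 1 = 0 := by
  have h := apply_mul_of_mem_derSubalgebra hT 1 1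
  simpa using h

end DerivationOperators

namespace Clover

open DPAlg

section Centre

variable {K : Type*} [Field K] {p : ℕ} [Fact p.Prime] [CharP K p] {Ξ : CloverTuple}

theorem lieP_gens_le_derSubalgebra :
    lieP K p (gens K p Ξ) ≤ derSubalgebra K (CloverRing K p Ξ) := by
  intro T hT
  refine mem_lieP.1 hT _ ?_ fun U hU => pow_mem_derSubalgebra hU
  rw [gens_eq]
  rintro _ ⟨l, rfl⟩
  exact coe_mem_derSubalgebra _

/-- If `T` commutes with `D` and `f D`, then `T f • D = 0`, and `D` takes the value `1` at its own
variable. -/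
theorem apply_eq_zero_of_commute {T : Module.End K (CloverRing K p Ξ)}
    (hT : T ∈ derSubalgebra K (CloverRing K p Ξ)) {l : Fin 3} {n : ℕ} {f : CloverRing K p Ξ}
    (h1 : ⁅T, pivotEnd K p Ξ l n⁆ = 0) (h2 : ⁅T, smulPivot K p Ξ l n f⁆ = 0) : T f = 0 := by
  set t := dpow K p Ξ.height (var l n) 1 with ht
  have hone : pivotEnd K p Ξ l n t = 1 := pivot_apply_var l n
  have e1 : T (pivotEnd K p Ξ l n t) - pivotEnd K p Ξ l n (T t) = 0 := LinearMap.congr_fun h1 t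
  have e2 : T (f * pivotEnd K p Ξ l n t) - f * pivotEnd K p Ξ l n (T t) = 0 :=
    LinearMap.congr_fun h2 t
  rw [hone, apply_one_of_mem_derSubalgebra hT, zero_sub, neg_eq_zero] at e1
  rwa [hone, e1, mul_one, mul_zero, sub_zero] at e2

/-- Every divided power `f` of a variable occurs as coefficient of some `f D` in the algebra with
`D` also there. A central derivation therefore kills these divided powers, and by the Leibniz rule
all monomials. -/
theorem centre_eq_zero (hR : ∀ n, Ξ.R n = 1) (T : Module.End K (CloverRing K p Ξ))
    (hT : T ∈ lieP K p (gens K p Ξ)) (h : ∀ y ∈ lieP K p (gens K p Ξ), ⁅T, y⁆ = 0) : T = 0 := by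
  have hd := lieP_gens_le_derSubalgebra hT
  have hp := (Fact.out : p.Prime)
  have hmem : ∀ {e : ℕ} {U : Module.End K (CloverRing K p Ξ)}, U ∈ cloverSpan K p Ξ e →
      ⁅T, U⁆ = 0 := fun hU => h _ (growthSpan_le_lieP _ _ hU)
  have hpartner : ∀ (l : Fin 3) (n i : ℕ), i < p ^ Ξ.height (partner l n) →
      T (dpow K p Ξ.height (partner l n) i) = 0 := by
    intro l n i hi
    refine apply_eq_zero_of_commute hd (hmem (pivotEnd_mem_cloverSpan hR (n + 1) l))
      (hmem (dpow_partner_mem hR l hi (e := wt p Ξ (n + 1) - i * wt p Ξ n)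
        (Nat.sub_add_cancel ?_)))
    rw [wt_succ_eq hR l n]
    have : i * wt p Ξ n ≤ (p ^ Ξ.height (partner l n) - 1) * wt p Ξ n :=
      Nat.mul_le_mul_right _ (by omega)
    omega
  have hvar : ∀ (a : CloverVar) (i : ℕ), i < p ^ Ξ.height a → T (dpow K p Ξ.height a i) = 0 := by
    intro a i hi
    cases a with
    | x n => exact hpartner 1 n i hi
    | y n => exact hpartner 0 n i hi
    -- No pivot has `z n` as partner, so the multiples of `u (n + 1)` by small monomials are used
    -- instead.
    | z n =>
      let γ : DPExponent p Ξ.height := ⟨Finsupp.single (.z n) i, single_lt hp.pos hi⟩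
      have hγ0 : ∀ a ≠ CloverVar.z n, γ.1 a = 0 := fun a ha => Finsupp.single_eq_of_ne ha
      have hγ : IsSmall (n + 1) γ := by
        refine ⟨fun a ha => ?_, fun j => ?_⟩
        · have ha' : a = .z n := by
            by_contra h
            exact Finsupp.mem_support_iff.1 ha (hγ0 a h)
          rw [ha']
          exact Nat.lt_succ_self n
        · rw [hγ0 _ (by simp), zero_add]
          exact two_le_prime_pow_height (.x j)
      have hy : γ.1 (.y n) = 0 := hγ0 _ (by simp)
      rw [dpow_of_lt hp.pos hi]
      exact apply_eq_zero_of_commute hd (hmem (pivotEnd_mem_cloverSpan hR (n + 1) 2))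
        (hmem (small_u_mem hR hγ hy (Nat.sub_add_cancel (small_weight_le hR hγ hy))))
  refine hom_ext fun α => ?_
  rw [LinearMap.zero_apply]
  obtain ⟨m, hm⟩ : ∃ m, α.1.support.card = m := ⟨_, rfl⟩
  induction m generalizing α with
  | zero =>
    have h0 : α = 0 := Subtype.ext (Finsupp.support_eq_empty.1 (Finset.card_eq_zero.1 hm))
    rw [h0, mono_zero]
    exact apply_one_of_mem_derSubalgebra hd
  | succ m ih =>
    classical
    obtain ⟨a, ha⟩ : α.1.support.Nonempty := Finset.card_pos.1 (by omega)
    have hs : (eraseExp α a).1.support = α.1.support.erase a := Finsupp.support_erase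
    rw [mono_eq_dpow_mul α a, apply_mul_of_mem_derSubalgebra hd, hvar a _ (α.2 a), zero_mul,
      add_zero, ih, mul_zero]
    rw [hs, Finset.card_erase_of_mem ha, hm]
    rfl

theorem gens_finite : (gens K p Ξ).Finite := by
  rw [gens_eq]
  exact Set.finite_range _

theorem cloverGrowth_le_of_lieEquiv {Ξ' : CloverTuple} (hR' : ∀ n, Ξ'.R n = 1)
    (φ : CloverLie K p Ξ ≃ₗ⁅K⁆ CloverLie K p Ξ') :
    ∃ C : ℕ, 0 < C ∧ ∀ n, cloverGrowth K p Ξ n ≤ cloverGrowth K p Ξ' (C * n) :=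
  growthLieP_le_of_lieEquiv gens_finite gens_finite (centre_eq_zero hR') φ

end Centre

end Clover

/-! ### The lower bound for the growth -/

namespace Clover

open DPAlg

section LowerBound

variable {K : Type*} [Field K] {p : ℕ} {Ξ : CloverTuple}

/-- Parameters for the exponents used in the lower bound. -/
abbrev CountIndex (p : ℕ) (Ξ : CloverTuple) (n k : ℕ) : Type :=
  Fin (k - 1) × ((i : Fin n) → Fin (p ^ Ξ.S i - 1) × Fin p × Fin p)

/-- The exponent with given parameters, as a function. -/
def countFun {n k : ℕ} (q : CountIndex p Ξ n k) : CloverVar → ℕ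
  | .x i => if h : i < n then (q.2 ⟨i, h⟩).1 else if i = n then p ^ Ξ.S n - 2 - q.1 else 0
  | .y i => if h : i < n then (q.2 ⟨i, h⟩).2.1 else 0
  | .z i => if h : i < n then (q.2 ⟨i, h⟩).2.2 else if i = n then p - 1 else 0

theorem countFun_eq_zero {n k : ℕ} (q : CountIndex p Ξ n k) {a : CloverVar} (h : ¬ level a < n + 1) :
    countFun q a = 0 := by
  cases a <;> simp only [level] at h <;> simp only [countFun] <;>
    rw [dif_neg (by omega)] <;> rw [if_neg (by omega)]

theorem finite_level_lt (n : ℕ) : {a : CloverVar | level a < n}.Finite := by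
  refine (Set.finite_range fun q : Fin 3 × Fin n => var q.1 q.2).subset fun a ha => ?_
  obtain ⟨l, hl⟩ := exists_var a
  exact ⟨(l, ⟨level a, ha⟩), hl⟩

variable [Fact p.Prime]

theorem countFun_lt (hR : ∀ n, Ξ.R n = 1) {n k : ℕ} (q : CountIndex p Ξ n k) (a : CloverVar) :
    countFun q a < p ^ Ξ.height a := by
  have hp := (Fact.out : p.Prime).two_le
  cases a with
  | x i =>
    have h2 : 2 ≤ p ^ Ξ.S i := two_le_prime_pow_height (.x i)
    change countFun q (.x i) < p ^ Ξ.S i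
    simp only [countFun]
    split_ifs with h1 h3
    · have := (q.2 ⟨i, h1⟩).1.2
      dsimp only at this
      omega
    · subst h3
      omega
    · omega
  | y i =>
    change countFun q (.y i) < p ^ Ξ.R i
    rw [hR, pow_one]
    simp only [countFun]
    split_ifs with h1
    · exact (q.2 ⟨i, h1⟩).2.1.2
    · omega
  | z i =>
    change countFun q (.z i) < p ^ Ξ.R i
    rw [hR, pow_one]
    simp only [countFun]
    split_ifs with h1 h3
    · exact (q.2 ⟨i, h1⟩).2.2.2
    · omega
    · omega

/-- The exponent with given parameters. -/
noncomputable def countExp (hR : ∀ n, Ξ.R n = 1) {n k : ℕ} (q : CountIndex p Ξ n k) :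
    DPExponent p Ξ.height :=
  ⟨Finsupp.ofSupportFinite (countFun q) ((finite_level_lt (n + 1)).subset fun a ha => by
    by_contra h
    exact ha (countFun_eq_zero q h)), countFun_lt hR q⟩

theorem countExp_injective (hR : ∀ n, Ξ.R n = 1) {n k : ℕ} (hk : k ≤ p ^ Ξ.S n) :
    Function.Injective (countExp (p := p) hR (n := n) (k := k)) := by
  intro q q' h
  have h' : ∀ a, countFun q a = countFun q' a := fun a =>
    DFunLike.congr_fun (congrArg Subtype.val h) a
  refine Prod.ext (Fin.ext ?_) (funext fun i => Prod.ext (Fin.ext ?_)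
    (Prod.ext (Fin.ext ?_) (Fin.ext ?_)))
  -- Since `q.1 < k - 1` and `k ≤ p ^ S n`, the subtraction in the exponent of `x n` does not
  -- truncate, hence is injective.
  · have h1 := h' (.x n)
    have h2 := q.1.2
    have h3 := q'.1.2
    simp only [countFun, lt_irrefl, dif_neg, not_false_eq_true, if_true] at h1
    omega
  · have h1 := h' (.x i)
    simpa only [countFun, i.2, dif_pos] using h1
  · have h1 := h' (.y i)
    simpa only [countFun, i.2, dif_pos] using h1
  · have h1 := h' (.z i)
    simpa only [countFun, i.2, dif_pos] using h1

theorem countExp_isSmall (hR : ∀ n, Ξ.R n = 1) {n k : ℕ} (q : CountIndex p Ξ n k) :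
    IsSmall (n + 1) (countExp hR q) := by
  refine ⟨fun a ha => ?_, fun i => ?_⟩
  · by_contra h
    exact Finsupp.mem_support_iff.1 ha (countFun_eq_zero q h)
  · have h2 : 2 ≤ p ^ Ξ.S i := two_le_prime_pow_height (.x i)
    change countFun q (.x i) + 2 ≤ p ^ Ξ.S i
    simp only [countFun]
    split_ifs with h1 h3
    · have := (q.2 ⟨i, h1⟩).1.2
      dsimp only at this
      omega
    · subst h3
      omega
    · omega

variable [CharP K p]

theorem smulPivot_apply_var (l : Fin 3) (n : ℕ) (f : CloverRing K p Ξ) :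
    smulPivot K p Ξ l n f (dpow K p Ξ.height (var l n) 1) = f := by
  change f * pivot K p Ξ l n _ = f
  rw [pivot_apply_var, mul_one]

theorem smulPivot_injective (l : Fin 3) (n : ℕ) : Function.Injective (smulPivot K p Ξ l n) := by
  intro f g h
  rw [← smulPivot_apply_var l n f, h, smulPivot_apply_var]

/-- At level `n` the exponent of `z n` is maximal and that of `x n` is within `k - 2` of the largest
admissible one; the lower levels are free apart from the bound on the `x i`. The resulting multiples
of `u (n + 1)` are independent and of weight at most `k * wt n`. -/
theorem le_cloverGrowth (hR : ∀ n, Ξ.R n = 1) {n k d : ℕ} (hk : k ≤ p ^ Ξ.S n)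
    (hd : k * wt p Ξ n ≤ d) :
    (k - 1) * ∏ i ∈ Finset.range n, ((p ^ Ξ.S i - 1) * (p * p)) ≤ cloverGrowth K p Ξ d := by
  have hp := (Fact.out : p.Prime)
  have hmem : ∀ q : CountIndex p Ξ n k,
      smulPivot K p Ξ 2 (n + 1) (mono K (countExp hR q)) ∈ cloverSpan K p Ξ d := by
    intro q
    have hs := countExp_isSmall hR q
    have hy : (countExp hR q).1 (.y n) = 0 := by
      change countFun q (.y n) = 0
      simp [countFun]
    have hx : (countExp hR q).1 (.x n) = p ^ Ξ.S n - 2 - q.1 := by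
      change countFun q (.x n) = _
      simp [countFun]
    have hz : (countExp hR q).1 (.z n) = p - 1 := by
      change countFun q (.z n) = _
      simp [countFun]
    have hle := small_weight_le hR hs hy
    refine growthSpan_mono p _ ?_ (small_u_mem hR hs hy (Nat.sub_add_cancel hle))
    refine le_trans ?_ hd
    obtain ⟨-, h1, -⟩ := small_weight_eq hR hs hy
    rw [hx, hz] at h1
    have h2 : 2 ≤ p ^ Ξ.S n := two_le_prime_pow_height (.x n)
    have h3 := q.1.2
    -- Level `n` alone leaves the weight `(q.1 + 2) * wt n`, and `q.1 + 2 ≤ k`.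
    have h4 : p ^ Ξ.S n + p - 1 ≤ k + (p ^ Ξ.S n - 2 - q.1 + (p - 1)) := by
      have := hp.two_le
      omega
    have h5 := Nat.mul_le_mul_right (wt p Ξ n) h4
    rw [add_mul] at h5
    rw [wt_succ]
    omega
  have hfin : FiniteDimensional K (cloverSpan K p Ξ d) :=
    growthSpan_finiteDimensional hp.one_lt gens_finite d
  have hli : LinearIndependent K fun q : CountIndex p Ξ n k =>
      (⟨_, hmem q⟩ : cloverSpan K p Ξ d) := by
    refine LinearIndependent.of_comp (cloverSpan K p Ξ d).subtype ?_
    have h1 := (linearIndependent_mono (K := K) (p := p) (S := Ξ.height)).comp _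
      (countExp_injective hR hk)
    exact h1.map' (smulPivot K p Ξ 2 (n + 1)) (LinearMap.ker_eq_bot.2 (smulPivot_injective _ _))
  have h1 := hli.fintype_card_le_finrank
  have h2 : Fintype.card (CountIndex p Ξ n k) =
      (k - 1) * ∏ i ∈ Finset.range n, ((p ^ Ξ.S i - 1) * (p * p)) := by
    rw [Fintype.card_prod, Fintype.card_fin, Fintype.card_pi, Finset.prod_range]
    simp
  rw [← h2]
  exact h1

end LowerBound

end Clover

/-! ### Iterated logarithms and quasi-linear growth -/

section Analysis

theorem iterLog_succ (q : ℕ) (x : ℝ) : iterLog (q + 1) x = Real.log (iterLog q x) :=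
  Function.iterate_succ_apply' _ _ _

theorem iterLog_succ' (q : ℕ) (x : ℝ) : iterLog (q + 1) x = iterLog q (Real.log x) :=
  Function.iterate_succ_apply _ _ _

theorem iterLog_add (q r : ℕ) (x : ℝ) : iterLog (q + r) x = iterLog q (iterLog r x) :=
  Function.iterate_add_apply _ _ _ _

theorem iterExp_succ (q : ℕ) (x : ℝ) : iterExp (q + 1) x = Real.exp (iterExp q x) :=
  Function.iterate_succ_apply' _ _ _

theorem tendsto_iterLog (q : ℕ) : Tendsto (iterLog q) atTop atTop :=
  Real.tendsto_log_atTop.iterate q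

theorem tendsto_iterLog_natCast (q : ℕ) : Tendsto (fun m : ℕ => iterLog q m) atTop atTop :=
  (tendsto_iterLog q).comp tendsto_natCast_atTop_atTop

theorem isLittleO_iterLog (q : ℕ) : (iterLog (q + 1)) =o[atTop] (id : ℝ → ℝ) := by
  induction q with
  | zero => exact Real.isLittleO_log_id_atTop
  | succ q ih =>
    have h1 : (fun x => iterLog (q + 1) (Real.log x)) =o[atTop] fun x => Real.log x :=
      ih.comp_tendsto Real.tendsto_log_atTop
    have h2 : iterLog (q + 1 + 1) = fun x => iterLog (q + 1) (Real.log x) :=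
      funext fun x => iterLog_succ' _ _
    rw [h2]
    exact h1.trans Real.isLittleO_log_id_atTop

theorem le_iterLog {q : ℕ} {s y : ℝ} (h : iterExp q s ≤ y) : s ≤ iterLog q y := by
  induction q generalizing y with
  | zero => exact h
  | succ q ih =>
    rw [iterExp_succ] at h
    rw [iterLog_succ']
    exact ih ((Real.le_log_iff_exp_le ((Real.exp_pos _).trans_le h)).2 h)

/-- The lower bound on `y` keeps the arguments of the successive logarithms positive, so that the
upper bound can be passed through them. -/
theorem iterLog_le {q : ℕ} {s t y : ℝ} (h : iterExp q s ≤ y) (h' : y ≤ iterExp q t) :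
    iterLog q y ≤ t := by
  induction q generalizing y with
  | zero => exact h'
  | succ q ih =>
    rw [iterExp_succ] at h h'
    rw [iterLog_succ']
    have hy := (Real.exp_pos _).trans_le h
    exact ih ((Real.le_log_iff_exp_le hy).2 h) ((Real.log_le_iff_le_exp hy).2 h')

theorem exp_le_iterExp (q : ℕ) (x : ℝ) : Real.exp x ≤ iterExp (q + 1) x := by
  induction q with
  | zero => exact le_rfl
  | succ q ih =>
    rw [iterExp_succ]
    have := Real.add_one_le_exp (iterExp (q + 1) x)
    linarith

theorem one_le_iterExp (q : ℕ) {x : ℝ} (hx : 0 ≤ x) : 1 ≤ iterExp (q + 1) x :=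
  (Real.one_le_exp hx).trans (exp_le_iterExp q x)

/-- A constant factor is absorbed by shifting the argument. The induction step uses `D + E ≤ (1 + D)
* E` for `E ≥ 1`. -/
theorem exp_mul_iterExp_le (q : ℕ) {D t : ℝ} (hD : 0 ≤ D) (ht : 0 ≤ t) :
    Real.exp D * iterExp (q + 1) t ≤ iterExp (q + 1) (t + D) := by
  induction q with
  | zero =>
    change Real.exp D * Real.exp t ≤ Real.exp (t + D)
    rw [← Real.exp_add, add_comm]
  | succ q ih =>
    rw [iterExp_succ, iterExp_succ (q + 1), ← Real.exp_add]
    refine Real.exp_le_exp.2 (le_trans ?_ ih)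
    have h1 := Real.add_one_le_exp D
    have h2 := one_le_iterExp q ht
    nlinarith

/-- Rescaling the argument costs a bounded additive term, so comparisons up to `n ↦ C n` do not
change the leading behaviour. -/
theorem iterLog_mul_le (q : ℕ) {C : ℝ} (hC : 1 ≤ C) :
    ∀ᶠ x in atTop, iterLog (q + 1) (C * x) ≤ iterLog (q + 1) x + Real.log C := by
  induction q with
  | zero =>
    filter_upwards [eventually_gt_atTop 0] with x hx
    change Real.log (C * x) ≤ Real.log x + Real.log C
    rw [Real.log_mul (by linarith) hx.ne', add_comm]
  | succ q ih =>
    have hCx : Tendsto (fun x : ℝ => C * x) atTop atTop :=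
      tendsto_id.const_mul_atTop (by linarith)
    filter_upwards [ih, (tendsto_iterLog (q + 1)).eventually_ge_atTop 1,
      ((tendsto_iterLog (q + 1)).comp hCx).eventually_ge_atTop 1] with x h1 h2 h3
    rw [iterLog_succ (q + 1), iterLog_succ (q + 1)]
    set a := iterLog (q + 1) x
    have ha : 0 < a := by linarith
    have hl := Real.log_nonneg hC
    calc Real.log (iterLog (q + 1) (C * x)) ≤ Real.log (a + Real.log C) :=
          Real.log_le_log (by simp only [Function.comp_apply] at h3; linarith) h1
      _ = Real.log a + Real.log (1 + Real.log C / a) := by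
          rw [← Real.log_mul ha.ne' (by positivity)]
          congr 1
          field_simp
      _ ≤ Real.log a + Real.log C := by
          have h4 := Real.log_le_sub_one_of_pos (show 0 < 1 + Real.log C / a by positivity)
          have h5 : Real.log C / a ≤ Real.log C := div_le_self hl h2
          linarith

theorem iterLog_natCast_mul_le (q : ℕ) {C : ℕ} (hC : 0 < C) :
    ∀ᶠ n : ℕ in atTop,
      iterLog (q + 1) ((C * n : ℕ) : ℝ) ≤ iterLog (q + 1) n + Real.log C := by
  have := tendsto_natCast_atTop_atTop.eventually
    (iterLog_mul_le q (C := C) (by exact_mod_cast hC))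
  filter_upwards [this] with n hn
  rwa [Nat.cast_mul]

theorem tendsto_natCast_mul {C : ℕ} (hC : 0 < C) : Tendsto (fun n : ℕ => C * n) atTop atTop :=
  tendsto_id.const_mul_atTop' hC

/-- `γ m` lies between constant multiples of `m (ln^(q) m)^κ`. -/
def HasQuasiLinearGrowth (q : ℕ) (κ : ℝ) (γ : ℕ → ℕ) : Prop :=
  ∃ B : ℝ, ∀ᶠ m : ℕ in atTop, 0 < γ m ∧
    |Real.log (γ m / m) - κ * iterLog (q + 1) m| ≤ B

theorem not_eventually_mul_iterLog_le {c B : ℝ} (hc : 0 < c) (q : ℕ) :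
    ¬ ∀ᶠ m : ℕ in atTop, c * iterLog q m ≤ B := by
  intro h
  have h1 := ((tendsto_iterLog_natCast q).const_mul_atTop hc).eventually_gt_atTop B
  obtain ⟨m, hm, hm'⟩ := (h.and h1).exists
  linarith

theorem quasiLinear_eq_exp {q : ℕ} {β : ℝ} {m : ℕ} (h : 0 < iterLog q m) :
    quasiLinear q β m = m * Real.exp (β * iterLog (q + 1) m) := by
  rw [quasiLinear, Real.rpow_def_of_pos h, iterLog_succ, mul_comm β]

theorem eventually_quasiLinear_eq (q : ℕ) (β : ℝ) : ∀ᶠ m : ℕ in atTop,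
    quasiLinear q β m = m * Real.exp (β * iterLog (q + 1) m) := by
  filter_upwards [(tendsto_iterLog_natCast q).eventually_gt_atTop 0] with m hm
  exact quasiLinear_eq_exp hm

/-! ### Dimensions and comparison of quasi-linear growth functions. -/

namespace HasQuasiLinearGrowth

variable {q : ℕ} {κ : ℝ} {γ : ℕ → ℕ}

/-- The growth in exponential form. -/
theorem exists_bounds (h : HasQuasiLinearGrowth q κ γ) : ∃ B : ℝ, ∀ᶠ m : ℕ in atTop,
    (m : ℝ) * Real.exp (κ * iterLog (q + 1) m - B) ≤ γ m ∧
    (γ m : ℝ) ≤ m * Real.exp (κ * iterLog (q + 1) m + B) := by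
  obtain ⟨B, hB⟩ := h
  refine ⟨B, ?_⟩
  filter_upwards [hB, eventually_gt_atTop 0] with m ⟨hm, h1⟩ hm0
  have hm0' : (0 : ℝ) < m := by exact_mod_cast hm0
  have hγ : (0 : ℝ) < γ m := by exact_mod_cast hm
  have e : (γ m : ℝ) = m * Real.exp (Real.log (γ m / m)) := by
    rw [Real.exp_log (by positivity)]
    field_simp
  obtain ⟨h2, h3⟩ := abs_le.1 h1
  constructor
  · rw [e]
    refine mul_le_mul_of_nonneg_left (Real.exp_le_exp.2 ?_) hm0'.le
    linarith
  · rw [e]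
    refine mul_le_mul_of_nonneg_left (Real.exp_le_exp.2 ?_) hm0'.le
    linarith

/-- The bounded error is divided by `ln^(q+1) m`, which tends to infinity. -/
theorem exists_eps (h : HasQuasiLinearGrowth q κ γ) : ∃ ε : ℕ → ℝ, Tendsto ε atTop (𝓝 0) ∧
    ∀ᶠ m : ℕ in atTop, (γ m : ℝ) = m * iterLog q m ^ (κ + ε m) := by
  obtain ⟨B, hB⟩ := h
  refine ⟨fun m => Real.log (γ m / m) / iterLog (q + 1) m - κ, ?_, ?_⟩
  · have h1 : Tendsto (fun m : ℕ => B / iterLog (q + 1) m) atTop (𝓝 0) :=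
      (tendsto_iterLog_natCast (q + 1)).const_div_atTop B
    refine squeeze_zero_norm' ?_ h1
    filter_upwards [hB, (tendsto_iterLog_natCast (q + 1)).eventually_gt_atTop 0] with m hm hL
    rw [Real.norm_eq_abs, le_div_iff₀ hL]
    nth_rewrite 2 [← abs_of_pos hL]
    rw [← abs_mul, sub_mul, div_mul_cancel₀ _ hL.ne']
    exact hm.2
  · filter_upwards [hB, (tendsto_iterLog_natCast (q + 1)).eventually_gt_atTop 0,
      (tendsto_iterLog_natCast q).eventually_gt_atTop 0, eventually_gt_atTop 0] with m hm hL hL' hm0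
    have hm0' : (0 : ℝ) < m := by exact_mod_cast hm0
    have hγ : (0 : ℝ) < γ m := by exact_mod_cast hm.1
    rw [Real.rpow_def_of_pos hL', ← iterLog_succ, add_sub_cancel, mul_div_cancel₀ _ hL.ne',
      Real.exp_log (by positivity)]
    field_simp

/-- For `q ≥ 1` the correction `κ * ln^(q+1) n` is negligible against `ln n`. -/
theorem tendsto_log_div_log (h : HasQuasiLinearGrowth q κ γ) (hq : 1 ≤ q) :
    Tendsto (fun n : ℕ => Real.log (γ n) / Real.log n) atTop (𝓝 1) := by
  obtain ⟨B, hB⟩ := h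
  obtain ⟨r, rfl⟩ : ∃ r, q = r + 1 := ⟨q - 1, by omega⟩
  have hlog : Tendsto (fun n : ℕ => Real.log n) atTop atTop :=
    Real.tendsto_log_atTop.comp tendsto_natCast_atTop_atTop
  have h1 : Tendsto (fun n : ℕ => iterLog (r + 1 + 1) n / Real.log n) atTop (𝓝 0) := by
    have := ((isLittleO_iterLog r).tendsto_div_nhds_zero).comp hlog
    refine this.congr fun n => ?_
    rw [Function.comp_apply, iterLog_succ' (r + 1)]
    rfl
  have h2 : Tendsto (fun n : ℕ => B / Real.log n) atTop (𝓝 0) := hlog.const_div_atTop B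
  have h3 : Tendsto (fun n : ℕ => (Real.log (γ n / n) - κ * iterLog (r + 1 + 1) n) / Real.log n)
      atTop (𝓝 0) := by
    refine squeeze_zero_norm' ?_ h2
    filter_upwards [hB, hlog.eventually_gt_atTop 0] with m hm hL
    rw [norm_div, Real.norm_eq_abs, Real.norm_eq_abs, abs_of_pos hL]
    exact div_le_div_of_nonneg_right hm.2 hL.le
  have h4 := (h3.add (h1.const_mul κ)).add_const 1
  rw [mul_zero, add_zero, zero_add] at h4
  refine h4.congr' ?_
  filter_upwards [hB, hlog.eventually_gt_atTop 0, eventually_gt_atTop 0] with m hm hL hm0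
  have hm0' : (0 : ℝ) < m := by exact_mod_cast hm0
  have hγ : (0 : ℝ) < γ m := by exact_mod_cast hm.1
  rw [Real.log_div hγ.ne' hm0'.ne']
  field_simp
  ring

theorem gkDim_eq (h : HasQuasiLinearGrowth q κ γ) (hq : 1 ≤ q) : gkDim γ = 1 := by
  have h1 : Tendsto (fun n : ℕ => ((Real.log (γ n) / Real.log n : ℝ) : EReal)) atTop
      (𝓝 ((1 : ℝ) : EReal)) :=
    (continuous_coe_real_ereal.tendsto 1).comp (h.tendsto_log_div_log hq)
  exact h1.limsup_eq

theorem lowerGKDim_eq (h : HasQuasiLinearGrowth q κ γ) (hq : 1 ≤ q) : lowerGKDim γ = 1 := by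
  have h1 : Tendsto (fun n : ℕ => ((Real.log (γ n) / Real.log n : ℝ) : EReal)) atTop
      (𝓝 ((1 : ℝ) : EReal)) :=
    (continuous_coe_real_ereal.tendsto 1).comp (h.tendsto_log_div_log hq)
  exact h1.liminf_eq

theorem growthLE_of_lt (h : HasQuasiLinearGrowth q κ γ) {β : ℝ} (hβ : κ < β) :
    GrowthLE (fun n => γ n) (quasiLinear q β) := by
  obtain ⟨B, hB⟩ := h.exists_bounds
  have h1 := (hB.and (eventually_quasiLinear_eq q β)).and
    (((tendsto_iterLog_natCast (q + 1)).const_mul_atTop (sub_pos.2 hβ)).eventually_ge_atTop B)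
  obtain ⟨N, hN⟩ := eventually_atTop.1 h1
  refine ⟨N + 1, 1, N.succ_pos, one_pos, fun n hn => ?_⟩
  obtain ⟨⟨h2, h3⟩, h4⟩ := hN n (by omega)
  rw [one_mul, h3]
  refine h2.2.trans (mul_le_mul_of_nonneg_left (Real.exp_le_exp.2 ?_) (Nat.cast_nonneg n))
  linarith

theorem growthLE_of_gt (h : HasQuasiLinearGrowth q κ γ) {β : ℝ} (hβ : β < κ) :
    GrowthLE (quasiLinear q β) (fun n => γ n) := by
  obtain ⟨B, hB⟩ := h.exists_bounds
  have h1 := (hB.and (eventually_quasiLinear_eq q β)).and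
    (((tendsto_iterLog_natCast (q + 1)).const_mul_atTop (sub_pos.2 hβ)).eventually_ge_atTop B)
  obtain ⟨N, hN⟩ := eventually_atTop.1 h1
  refine ⟨N + 1, 1, N.succ_pos, one_pos, fun n hn => ?_⟩
  obtain ⟨⟨h2, h3⟩, h4⟩ := hN n (by omega)
  rw [one_mul, h3]
  refine le_trans (mul_le_mul_of_nonneg_left (Real.exp_le_exp.2 ?_) (Nat.cast_nonneg n)) h2.1
  linarith

/-- Comparison of growth bounds in exponential form. -/
theorem _root_.eventually_mul_iterLog_le {q q' : ℕ} {κ κ' B B' : ℝ} (hκ' : 0 ≤ κ') {C : ℕ}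
    (hC : 0 < C)
    (h : ∀ᶠ n : ℕ in atTop, (n : ℝ) * Real.exp (κ * iterLog (q + 1) n - B) ≤
      ((C * n : ℕ) : ℝ) * Real.exp (κ' * iterLog (q' + 1) ((C * n : ℕ) : ℝ) + B')) :
    ∃ D, ∀ᶠ n : ℕ in atTop, κ * iterLog (q + 1) n ≤ κ' * iterLog (q' + 1) n + D := by
  refine ⟨B + B' + (κ' + 1) * Real.log C, ?_⟩
  filter_upwards [h, iterLog_natCast_mul_le q' hC, eventually_gt_atTop 0] with n h1 h2 hn
  have hn' : (0 : ℝ) < n := by exact_mod_cast hn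
  have hC' : (0 : ℝ) < C := by exact_mod_cast hC
  rw [Nat.cast_mul, mul_comm (C : ℝ), mul_assoc] at h1
  have h3 := le_of_mul_le_mul_left h1 hn'
  rw [← Real.exp_log hC', ← Real.exp_add, Real.exp_le_exp, Real.exp_log hC'] at h3
  rw [Nat.cast_mul, mul_comm (C : ℝ)] at h2
  have h4 := mul_le_mul_of_nonneg_left h2 hκ'
  linarith

theorem le_of_growthLE (h : HasQuasiLinearGrowth q κ γ) {β : ℝ} (hβ : 0 ≤ β)
    (hγ : GrowthLE (fun n => γ n) (quasiLinear q β)) : κ ≤ β := by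
  obtain ⟨B, hB⟩ := h.exists_bounds
  obtain ⟨N, C, -, hC, hN⟩ := hγ
  obtain ⟨D, hD⟩ := eventually_mul_iterLog_le (q := q) (q' := q) (κ := κ) (B := B) (B' := 0) hβ hC (by
    filter_upwards [hB, (tendsto_natCast_mul hC).eventually (eventually_quasiLinear_eq q β),
      eventually_ge_atTop N] with n h1 h2 h3
    have h4 := hN n h3
    rw [h2] at h4
    rw [add_zero]
    exact h1.1.trans h4)
  by_contra hlt
  refine not_eventually_mul_iterLog_le (sub_pos.2 (not_le.1 hlt)) (q + 1) (B := D) ?_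
  filter_upwards [hD] with n hn
  linarith

theorem le_of_growthLE' (h : HasQuasiLinearGrowth q κ γ) (hκ : 0 ≤ κ) {β : ℝ}
    (hγ : GrowthLE (quasiLinear q β) (fun n => γ n)) : β ≤ κ := by
  obtain ⟨B, hB⟩ := h.exists_bounds
  obtain ⟨N, C, -, hC, hN⟩ := hγ
  obtain ⟨D, hD⟩ := eventually_mul_iterLog_le (q := q) (q' := q) (κ := β) (B := 0) (B' := B) hκ hC (by
    filter_upwards [(tendsto_natCast_mul hC).eventually hB, eventually_quasiLinear_eq q β,
      eventually_ge_atTop N] with n h1 h2 h3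
    have h4 := hN n h3
    rw [h2] at h4
    rw [sub_zero]
    exact h4.trans h1.2)
  by_contra hlt
  refine not_eventually_mul_iterLog_le (sub_pos.2 (not_le.1 hlt)) (q + 1) (B := D) ?_
  filter_upwards [hD] with n hn
  linarith

theorem lDim_eq (h : HasQuasiLinearGrowth q κ γ) (hκ : 0 < κ) : lDim q γ = ENNReal.ofReal κ := by
  refine le_antisymm ?_ (le_sInf ?_)
  · refine le_of_forall_gt fun c hc => ?_
    obtain ⟨β, hβ0, hβ1, hβ2⟩ := ENNReal.lt_iff_exists_real_btwn.1 hc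
    have hβ : κ < β := (ENNReal.ofReal_lt_ofReal_iff_of_nonneg hκ.le).1 hβ1
    have h1 : lDim q γ ≤ ENNReal.ofReal β :=
      sInf_le ⟨β, hκ.trans hβ, h.growthLE_of_lt hβ, rfl⟩
    exact h1.trans_lt hβ2
  · rintro _ ⟨β, hβ, hle, rfl⟩
    exact ENNReal.ofReal_le_ofReal (h.le_of_growthLE hβ.le hle)

theorem lowerLDim_eq (h : HasQuasiLinearGrowth q κ γ) (hκ : 0 < κ) :
    lowerLDim q γ = ENNReal.ofReal κ := by
  refine le_antisymm (sSup_le ?_) ?_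
  · rintro _ ⟨β, -, hle, rfl⟩
    exact ENNReal.ofReal_le_ofReal (h.le_of_growthLE' hκ.le hle)
  · refine le_of_forall_lt fun c hc => ?_
    obtain ⟨β, hβ0, hβ1, hβ2⟩ := ENNReal.lt_iff_exists_real_btwn.1 hc
    have hβ : β < κ := (ENNReal.ofReal_lt_ofReal_iff hκ).1 hβ2
    have hβ' : 0 < β := ENNReal.ofReal_pos.1 (bot_le.trans_lt hβ1)
    have h1 : ENNReal.ofReal β ≤ lowerLDim q γ := le_sSup ⟨β, hβ', h.growthLE_of_gt hβ, rfl⟩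
    exact hβ1.trans_le h1

theorem not_growthLE_linear (h : HasQuasiLinearGrowth q κ γ) (hκ : 0 < κ) :
    ¬ GrowthLE (fun n => γ n) (fun n => n) := by
  rintro ⟨N, C, -, hC, hN⟩
  obtain ⟨B, hB⟩ := h.exists_bounds
  obtain ⟨D, hD⟩ := eventually_mul_iterLog_le (q := q) (q' := q) (κ := κ) (κ' := 0) (B := B) (B' := 0)
    le_rfl hC (by
      filter_upwards [hB, eventually_ge_atTop N] with n h1 h3
      simpa using h1.1.trans (hN n h3))
  refine not_eventually_mul_iterLog_le hκ (q + 1) (B := D) ?_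
  filter_upwards [hD] with n hn
  linarith

/-- The comparison reduces to `κ * ln^(q+1) n ≤ κ' * ln^(q'+1) n + D`. If `q' > q` the right side is
of smaller order than the left; if `q' = q`, compare the coefficients. -/
theorem le_and_le_of_le (h : HasQuasiLinearGrowth q κ γ) (hκ : 0 < κ) {q' : ℕ} {κ' : ℝ}
    {γ' : ℕ → ℕ} (h' : HasQuasiLinearGrowth q' κ' γ') (hκ' : 0 < κ') {C : ℕ} (hC : 0 < C)
    (hle : ∀ n, γ n ≤ γ' (C * n)) : q' ≤ q ∧ (q' = q → κ ≤ κ') := by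
  obtain ⟨B, hB⟩ := h.exists_bounds
  obtain ⟨B', hB'⟩ := h'.exists_bounds
  obtain ⟨D, hD⟩ := eventually_mul_iterLog_le (q := q) (q' := q') (κ := κ) (B := B) (B' := B')
    hκ'.le hC (by
      filter_upwards [hB, (tendsto_natCast_mul hC).eventually hB'] with n h1 h2
      exact (h1.1.trans (by exact_mod_cast hle n)).trans h2.2)
  constructor
  · by_contra! hlt
    obtain ⟨r, rfl⟩ : ∃ r, q' = r + 1 + q := ⟨q' - q - 1, by omega⟩
    have h1 := ((isLittleO_iterLog r).comp_tendsto (tendsto_iterLog_natCast (q + 1))).bound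
      -- With this constant the right side uses up only half of `κ * ln^(q+1) n`.
      (show 0 < κ / (2 * κ') by positivity)
    refine not_eventually_mul_iterLog_le (half_pos hκ) (q + 1) (B := D) ?_
    filter_upwards [hD, h1, (tendsto_iterLog_natCast (q + 1)).eventually_ge_atTop 0]
      with n h2 h3 h4
    simp only [Function.comp_apply, id, Real.norm_eq_abs, abs_of_nonneg h4] at h3
    have h7 : iterLog (r + 1 + q + 1) (n : ℝ) = iterLog (r + 1) (iterLog (q + 1) n) := by
      rw [add_assoc (r + 1) q 1, iterLog_add]
    rw [h7] at h2
    have h5 := mul_le_mul_of_nonneg_left ((le_abs_self _).trans h3) hκ'.le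
    have h6 : κ' * (κ / (2 * κ') * iterLog (q + 1) n) = κ / 2 * iterLog (q + 1) n := by
      field_simp
    linarith
  · rintro rfl
    by_contra hlt
    refine not_eventually_mul_iterLog_le (sub_pos.2 (not_le.1 hlt)) (q' + 1) (B := D) ?_
    filter_upwards [hD] with n hn
    linarith

end HasQuasiLinearGrowth

end Analysis

/-! ### The tuples with prescribed partial sums -/

theorem exists_sum_range_eq {T : ℕ → ℕ} {n₀ : ℕ} (h0 : n₀ + 1 ≤ T n₀)
    (hT : ∀ n ≥ n₀, T n + (n + 1) ≤ T (n + 1)) :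
    ∃ S : ℕ → ℕ, (∀ i, 0 < S i) ∧ (∀ n ≥ n₀, ∑ i ∈ Finset.range (n + 1), S i = T n) ∧
      ∀ n ≥ n₀, n + 1 ≤ S (n + 1) := by
  -- Ones up to `n₀`, then one entry correcting the partial sum, then the differences of `T`.
  let S : ℕ → ℕ := fun i => if i < n₀ then 1 else if i = n₀ then T n₀ - n₀ else T i - T (i - 1)
  have h1 : ∀ i < n₀, S i = 1 := fun i hi => if_pos hi
  have h2 : S n₀ = T n₀ - n₀ := by simp [S]
  have h3 : ∀ n ≥ n₀, S (n + 1) = T (n + 1) - T n := fun n hn => by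
    simp only [S]
    rw [if_neg (by omega), if_neg (by omega), Nat.add_sub_cancel]
  have h4 : ∀ n ≥ n₀, n + 1 ≤ S (n + 1) := fun n hn => by
    have := hT n hn
    rw [h3 n hn]
    omega
  refine ⟨S, fun i => ?_, fun n hn => ?_, h4⟩
  · rcases lt_trichotomy i n₀ with h | rfl | h
    · rw [h1 i h]; exact one_pos
    · rw [h2]; omega
    · obtain ⟨n, rfl⟩ : ∃ n, i = n + 1 := ⟨i - 1, by omega⟩
      have := h4 n (by omega)
      omega
  · induction n, hn using Nat.le_induction with
    | base =>
      rw [Finset.sum_range_succ, Finset.sum_congr rfl fun i hi => h1 i (Finset.mem_range.1 hi), h2]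
      simp
      omega
    | succ n hn ih =>
      have := hT n hn
      rw [Finset.sum_range_succ, ih, h3 n hn]
      omega

/-- Raising the argument by `l` multiplies the iterated exponential by at least `exp l ≥ 1 + l`, and
`l` times its quadratic lower bound eventually exceeds `n + 1`. -/
theorem exists_floor_iterExp_add_le (r : ℕ) {l : ℝ} (hl : 0 < l) : ∃ n₀ : ℕ,
    n₀ + 1 ≤ ⌊iterExp (r + 1) (l * (n₀ + 2))⌋₊ + 1 ∧
    ∀ n ≥ n₀, ⌊iterExp (r + 1) (l * (n + 2))⌋₊ + 1 + (n + 1) ≤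
      ⌊iterExp (r + 1) (l * ((n + 1 : ℕ) + 2))⌋₊ + 1 := by
  obtain ⟨n₀, hn₀⟩ := exists_nat_ge (2 / l ^ 2 + 2 / l ^ 3)
  have hquad : ∀ n : ℕ, (l * (n + 2)) ^ 2 / 2 ≤ iterExp (r + 1) (l * (n + 2)) := fun n => by
    have h0 : 0 ≤ l * ((n : ℝ) + 2) := by positivity
    have := Real.quadratic_le_exp_of_nonneg h0
    exact le_trans (by linarith) (exp_le_iterExp r _)
  have h2 : ∀ n ≥ n₀, 2 ≤ l ^ 2 * (n : ℝ) ∧ 2 ≤ l ^ 3 * (n : ℝ) := fun n hn => by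
    have h : (n₀ : ℝ) ≤ n := by exact_mod_cast hn
    have p2 : 0 < 2 / l ^ 2 := by positivity
    have p3 : 0 < 2 / l ^ 3 := by positivity
    constructor
    · have : 2 / l ^ 2 ≤ n := by linarith
      rwa [div_le_iff₀' (by positivity)] at this
    · have : 2 / l ^ 3 ≤ n := by linarith
      rwa [div_le_iff₀' (by positivity)] at this
  refine ⟨n₀, ?_, fun n hn => ?_⟩
  · refine Nat.succ_le_succ (Nat.le_floor (le_trans ?_ (hquad n₀)))
    have := (h2 n₀ le_rfl).1
    have h0 : (0 : ℝ) ≤ n₀ := Nat.cast_nonneg _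
    nlinarith [sq_nonneg l]
  · have h0 : (0 : ℝ) ≤ n := Nat.cast_nonneg _
    have hX := hquad n
    have hE := exp_mul_iterExp_le r hl.le (show 0 ≤ l * ((n : ℝ) + 2) by positivity)
    have e : l * ((n : ℝ) + 2) + l = l * ((n + 1 : ℕ) + 2) := by push_cast; ring
    rw [e] at hE
    have hX0 : 0 ≤ iterExp (r + 1) (l * ((n : ℝ) + 2)) := le_trans (by positivity) hX
    have h3 : (n : ℝ) + 1 ≤ l * iterExp (r + 1) (l * (n + 2)) := by
      refine le_trans ?_ (mul_le_mul_of_nonneg_left hX hl.le)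
      have h4 := (h2 n hn).2
      have h5 : l * ((l * ((n : ℝ) + 2)) ^ 2 / 2) =
        (l ^ 3 * n) * (n + 4) / 2 + 2 * l ^ 3 := by ring
      have h6 : 0 < l ^ 3 := by positivity
      rw [h5]
      nlinarith
    have h7 : iterExp (r + 1) (l * ((n : ℝ) + 2)) + ((n + 1 : ℕ) : ℝ) ≤
        iterExp (r + 1) (l * ((n + 1 : ℕ) + 2)) := by
      refine le_trans ?_ hE
      have h8 := Real.add_one_le_exp l
      push_cast
      nlinarith
    have h9 := Nat.floor_le_floor h7
    rw [Nat.floor_add_natCast hX0] at h9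
    omega

/-! ### Asymptotics of the weights and of the growth. -/

namespace Clover

variable {K : Type*} [Field K] {p : ℕ} {Ξ : CloverTuple}

section

variable [Fact p.Prime]

/-- With `P = p ^ S n`, the ratio `(P + p - 1) / (P - 1)` is at most `exp (2 p / P)`, and `∑ p ^ (-S
n)` converges because `S n ≥ n` eventually. -/
theorem exists_mul_wt_le_prod (hS : ∀ᶠ n in atTop, n ≤ Ξ.S n) : ∃ c : ℝ, 0 < c ∧
    ∀ n, c * wt p Ξ n ≤ ∏ i ∈ Finset.range n, ((p : ℝ) ^ Ξ.S i - 1) := by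
  have hp2 : (2 : ℝ) ≤ p := by exact_mod_cast (Fact.out : p.Prime).two_le
  have hP : ∀ i, 2 ≤ (p : ℝ) ^ Ξ.S i := fun i =>
    hp2.trans (le_self_pow₀ (by linarith) (Ξ.S_pos i).ne')
  have hsum : Summable fun i => ((p : ℝ) ^ Ξ.S i)⁻¹ := by
    refine summable_geometric_two.of_norm_bounded_eventually_nat ?_
    filter_upwards [hS] with n hn
    have h1 : (0 : ℝ) < p ^ Ξ.S n := by have := hP n; linarith
    rw [Real.norm_of_nonneg (inv_nonneg.2 h1.le), one_div, inv_pow]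
    refine inv_anti₀ (by positivity) ?_
    exact (pow_le_pow_left₀ (by norm_num) hp2 n).trans (pow_le_pow_right₀ (by linarith) hn)
  have key : ∀ n, (wt p Ξ n : ℝ) ≤
      Real.exp (2 * p * ∑ i ∈ Finset.range n, ((p : ℝ) ^ Ξ.S i)⁻¹) *
        ∏ i ∈ Finset.range n, ((p : ℝ) ^ Ξ.S i - 1) := by
    intro n
    induction n with
    | zero => simp [wt]
    | succ n ih =>
      have h1 := hP n
      have hw : (wt p Ξ (n + 1) : ℝ) = (p ^ Ξ.S n + p - 1) * wt p Ξ n := by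
        have : 1 ≤ p ^ Ξ.S n + p := by have := (Fact.out : p.Prime).pos; omega
        rw [wt_succ, Nat.cast_mul, Nat.cast_sub this]
        push_cast
        ring
      rw [hw, Finset.sum_range_succ, Finset.prod_range_succ, mul_add, Real.exp_add]
      set P : ℝ := (p : ℝ) ^ Ξ.S n
      have h2 : P + p - 1 ≤ Real.exp (2 * p * P⁻¹) * (P - 1) := by
        have h3 := Real.add_one_le_exp (2 * p * P⁻¹)
        have h4 : (2 * p * P⁻¹ + 1) * (P - 1) = P + p - 1 + p * (1 - 2 * P⁻¹) := by
          field_simp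
          ring
        have h5 : P⁻¹ ≤ 2⁻¹ := inv_anti₀ (by norm_num) h1
        refine le_trans ?_ (mul_le_mul_of_nonneg_right h3 (by linarith))
        rw [h4]
        nlinarith
      have h6 := mul_le_mul h2 ih (Nat.cast_nonneg _) ((by linarith : (0:ℝ) ≤ P + p - 1).trans h2)
      refine h6.trans (le_of_eq ?_)
      ring
  refine ⟨Real.exp (-(2 * p * ∑' i, ((p : ℝ) ^ Ξ.S i)⁻¹)), Real.exp_pos _, fun n => ?_⟩
  rw [Real.exp_neg, inv_mul_le_iff₀ (Real.exp_pos _)]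
  refine (key n).trans (mul_le_mul_of_nonneg_right (Real.exp_le_exp.2 ?_) ?_)
  · refine mul_le_mul_of_nonneg_left (hsum.sum_le_tsum _ fun i _ => ?_) (by positivity)
    positivity
  · exact Finset.prod_nonneg fun i _ => by have := hP i; linarith

theorem pow_sum_le_wt (n : ℕ) : p ^ ∑ i ∈ Finset.range n, Ξ.S i ≤ wt p Ξ n := by
  have hp := (Fact.out : p.Prime).pos
  induction n with
  | zero => simp [wt]
  | succ n ih =>
    rw [Finset.sum_range_succ, pow_add, wt_succ, mul_comm]
    exact Nat.mul_le_mul (by omega) ih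

/-- Crude, since `p ^ S + p - 1 ≤ 2 * p ^ S ≤ p ^ (2 * S)`; the factor `2` in the exponent
disappears in the bounded error after taking iterated logarithms. -/
theorem wt_le_pow_sum (n : ℕ) : wt p Ξ n ≤ p ^ (2 * ∑ i ∈ Finset.range n, Ξ.S i) := by
  have hp := (Fact.out : p.Prime).two_le
  induction n with
  | zero => simp [wt]
  | succ n ih =>
    rw [Finset.sum_range_succ, mul_add, pow_add, wt_succ, mul_comm]
    refine Nat.mul_le_mul ih ?_
    have h1 := le_pow_S (p := p) (Ξ := Ξ) n
    rw [mul_comm, pow_mul]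
    have h2 : 2 * p ^ Ξ.S n ≤ (p ^ Ξ.S n) ^ 2 := by
      rw [sq]; exact Nat.mul_le_mul_right _ (hp.trans h1)
    omega

theorem exists_wt_le_lt {N m : ℕ} (h : 2 * wt p Ξ N ≤ m) :
    ∃ n ≥ N, 2 * wt p Ξ n ≤ m ∧ m < 2 * wt p Ξ (n + 1) := by
  have hex : ∃ n, m < 2 * wt p Ξ n :=
    ⟨m + 1, by have := (wt_strictMono (p := p) (Ξ := Ξ)).le_apply (x := m + 1); omega⟩
  classical
  have h1 := Nat.find_spec hex
  have h2 : N < Nat.find hex := by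
    rw [Nat.lt_find_iff]
    intro k hk
    have := (wt_strictMono (p := p) (Ξ := Ξ)).monotone hk
    omega
  refine ⟨Nat.find hex - 1, by omega, ?_, ?_⟩
  · exact not_lt.1 (Nat.find_min hex (by omega))
  · rwa [Nat.sub_add_cancel (by omega)]

/-- For `2 wt n ≤ d < 2 wt (n + 1)` the iterated logarithm of `d` is `l n` up to a constant. -/
theorem exists_abs_iterLog_sub_le (r : ℕ) {l : ℝ} (hl : 0 < l)
    (hS : ∀ᶠ n : ℕ in atTop, ∑ i ∈ Finset.range (n + 1), Ξ.S i =
      ⌊iterExp (r + 1) (l * (n + 2))⌋₊ + 1) :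
    ∃ D, ∀ᶠ n : ℕ in atTop, ∀ d : ℕ, 2 * wt p Ξ n ≤ d → d < 2 * wt p Ξ (n + 1) →
      |iterLog (r + 1 + 1) d - l * n| ≤ D := by
  have hp := (Fact.out : p.Prime).two_le
  have hp1 : (1 : ℝ) < p := by exact_mod_cast hp
  have hlp := Real.log_pos hp1
  -- Large enough for `exp D` to absorb both `6 * log p` above and `1 / log p` below.
  set D := |Real.log (Real.log p)| + Real.log 6 with hD
  have hl6 : 0 < Real.log 6 := Real.log_pos (by norm_num)
  have hD0 : 0 ≤ D := by positivity
  have hup : 6 * Real.log p ≤ Real.exp D := by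
    rw [hD, Real.exp_add, Real.exp_log (by norm_num : (0 : ℝ) < 6), mul_comm]
    refine mul_le_mul_of_nonneg_right ?_ (by norm_num)
    exact (Real.le_exp_log _).trans (Real.exp_le_exp.2 (le_abs_self _))
  have hlow : 1 ≤ Real.exp D * Real.log p := by
    rw [← Real.exp_log hlp, ← Real.exp_add]
    refine Real.one_le_exp ?_
    have := neg_abs_le (Real.log (Real.log p))
    rw [hD]
    linarith
  refine ⟨2 * l + D, ?_⟩
  obtain ⟨N₁, hN₁⟩ := eventually_atTop.1 hS
  obtain ⟨N₂, hN₂⟩ := exists_nat_ge (D / l)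
  refine eventually_atTop.2 ⟨N₁ + N₂ + 1, fun n hn d h1 h2 => ?_⟩
  obtain ⟨k, rfl⟩ : ∃ k, n = k + 1 := ⟨n - 1, by omega⟩
  have hlD : D ≤ l * k := by
    rw [div_le_iff₀' hl] at hN₂
    exact hN₂.trans (mul_le_mul_of_nonneg_left (by exact_mod_cast (by omega)) hl.le)
  have e1 := hN₁ k (by omega)
  have e2 := hN₁ (k + 1) (by omega)
  set E₁ := ∑ i ∈ Finset.range (k + 1), Ξ.S i
  set E₂ := ∑ i ∈ Finset.range (k + 1 + 1), Ξ.S i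
  have hd1 : p ^ E₁ ≤ d := (pow_sum_le_wt (p := p) (Ξ := Ξ) (k + 1)).trans (by omega)
  -- Two factors `p ^ E₂` bound `wt (k + 2)`; the third covers the factor `2`.
  have hd2 : d ≤ p ^ (3 * E₂) := by
    have h3 := wt_le_pow_sum (p := p) (Ξ := Ξ) (k + 1 + 1)
    have h4 : p ^ (3 * E₂) = p ^ E₂ * p ^ (2 * E₂) := by rw [← pow_add]; congr 1; omega
    rw [h4]
    refine h2.le.trans (Nat.mul_le_mul ?_ h3)
    exact hp.trans (Nat.le_self_pow (by omega) p)
  have hd0 : 0 < d := lt_of_lt_of_le (by positivity) hd1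
  have hd0' : (0 : ℝ) < d := by exact_mod_cast hd0
  have hlog1 : E₁ * Real.log p ≤ Real.log d := by
    rw [← Real.log_pow]
    exact Real.log_le_log (by positivity) (by exact_mod_cast hd1)
  have hlog2 : Real.log d ≤ 3 * E₂ * Real.log p := by
    have : Real.log d ≤ Real.log ((p : ℝ) ^ (3 * E₂)) :=
      Real.log_le_log hd0' (by exact_mod_cast hd2)
    rw [Real.log_pow] at this
    push_cast at this
    exact this
  have hk : (0 : ℝ) ≤ k := Nat.cast_nonneg k
  have hX1 : iterExp (r + 1) (l * (k + 2)) ≤ E₁ := by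
    rw [e1]
    push_cast
    exact (Nat.lt_floor_add_one _).le
  have hX2 : (E₂ : ℝ) ≤ 2 * iterExp (r + 1) (l * ((k + 1 : ℕ) + 2)) := by
    have h5 := one_le_iterExp r (show 0 ≤ l * (((k + 1 : ℕ) : ℝ) + 2) by positivity)
    have h6 := Nat.floor_le (zero_le_one.trans h5)
    rw [e2]
    push_cast at h5 h6 ⊢
    linarith
  have ht : 0 ≤ l * ((k : ℝ) + 2) - D := by nlinarith
  have hI1 : iterExp (r + 1) (l * (k + 2) - D) ≤ Real.log d := by
    have h7 := exp_mul_iterExp_le r hD0 ht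
    rw [sub_add_cancel] at h7
    have h8 := zero_le_one.trans (one_le_iterExp r ht)
    calc iterExp (r + 1) (l * (k + 2) - D)
        ≤ (Real.exp D * Real.log p) * iterExp (r + 1) (l * (k + 2) - D) :=
          le_mul_of_one_le_left h8 hlow
      _ = (Real.exp D * iterExp (r + 1) (l * (k + 2) - D)) * Real.log p := by ring
      _ ≤ E₁ * Real.log p := mul_le_mul_of_nonneg_right (h7.trans hX1) hlp.le
      _ ≤ _ := hlog1
  have hI2 : Real.log d ≤ iterExp (r + 1) (l * ((k + 1 : ℕ) + 2) + D) := by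
    have h5 : 0 ≤ l * (((k + 1 : ℕ) : ℝ) + 2) := by positivity
    have h6 := zero_le_one.trans (one_le_iterExp r h5)
    calc Real.log d ≤ 3 * E₂ * Real.log p := hlog2
      _ ≤ 3 * (2 * iterExp (r + 1) (l * ((k + 1 : ℕ) + 2))) * Real.log p := by gcongr
      _ = (6 * Real.log p) * iterExp (r + 1) (l * ((k + 1 : ℕ) + 2)) := by ring
      _ ≤ Real.exp D * iterExp (r + 1) (l * ((k + 1 : ℕ) + 2)) :=
          mul_le_mul_of_nonneg_right hup h6
      _ ≤ _ := exp_mul_iterExp_le r hD0 h5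
  rw [iterLog_succ', abs_le]
  have hL1 := le_iterLog hI1
  have hL2 := iterLog_le hI1 hI2
  push_cast at hL1 hL2 ⊢
  constructor <;> linarith

end

variable [Fact p.Prime] [CharP K p]

/-- For `2 wt n ≤ d < 2 wt (n + 1)` the growth at `d` is `d p^(2 n)` up to a constant. -/
theorem exists_abs_log_cloverGrowth_le (hR : ∀ n, Ξ.R n = 1) (hS : ∀ᶠ n in atTop, n ≤ Ξ.S n) :
    ∃ B : ℝ, ∀ n d : ℕ, 2 * wt p Ξ n ≤ d → d < 2 * wt p Ξ (n + 1) →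
      0 < cloverGrowth K p Ξ d ∧
      |Real.log (cloverGrowth K p Ξ d / d) - n * Real.log (p ^ 2)| ≤ B := by
  have hp := (Fact.out : p.Prime).two_le
  have hp0 : (0 : ℝ) < p := by exact_mod_cast (Fact.out : p.Prime).pos
  obtain ⟨c, hc, hcw⟩ := exists_mul_wt_le_prod (p := p) hS
  refine ⟨max (-Real.log (c / 8)) (Real.log (7 * (p ^ 2) ^ 3)), fun n d h1 h2 => ?_⟩
  have hw := wt_pos (p := p) (Ξ := Ξ) n
  have hd : (0 : ℝ) < d := by exact_mod_cast (by omega : 0 < d)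
  have hlow : c / 8 * (p ^ 2) ^ n * d ≤ cloverGrowth K p Ξ d := by
    -- Take `k = min (p ^ S n) (d / wt n)`, which is at least `2`. Then `d` is below `2 * (k + p -
    -- 1) * wt n` with `p ≤ k` in the first case and below `(k + 1) * wt n` in the second, so `8`
    -- suffices.
    obtain ⟨k, hk1, hk2, hk3, hk4⟩ : ∃ k : ℕ, 1 ≤ k ∧ k ≤ p ^ Ξ.S n ∧ k * wt p Ξ n ≤ d ∧
        d ≤ 8 * ((k - 1) * wt p Ξ n) := by
      have hP := le_pow_S (p := p) (Ξ := Ξ) n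
      rcases le_total (p ^ Ξ.S n * wt p Ξ n) d with h | h
      · refine ⟨p ^ Ξ.S n, by omega, le_rfl, h, ?_⟩
        rw [wt_succ, ← mul_assoc] at h2
        rw [← mul_assoc]
        exact h2.le.trans (Nat.mul_le_mul_right _ (by omega))
      · have h3 : 2 ≤ d / wt p Ξ n := (Nat.le_div_iff_mul_le hw).2 h1
        refine ⟨d / wt p Ξ n, by omega, Nat.div_le_of_le_mul (by rwa [mul_comm]),
          Nat.div_mul_le_self _ _, ?_⟩
        have h4 := Nat.lt_div_mul_add (a := d) hw
        rw [← Nat.succ_mul] at h4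
        rw [← mul_assoc]
        exact h4.le.trans (Nat.mul_le_mul_right _ (by omega))
    have h3 := le_cloverGrowth (K := K) hR hk2 hk3
    have h4 : (((k - 1) * ∏ i ∈ Finset.range n, ((p ^ Ξ.S i - 1) * (p * p)) : ℕ) : ℝ) =
        (k - 1 : ℕ) * ((p ^ 2) ^ n * ∏ i ∈ Finset.range n, ((p : ℝ) ^ Ξ.S i - 1)) := by
      rw [Nat.cast_mul, Nat.cast_prod, mul_comm ((p ^ 2 : ℝ) ^ n)]
      congr 1
      have : ∀ i, (((p ^ Ξ.S i - 1) * (p * p) : ℕ) : ℝ) = ((p : ℝ) ^ Ξ.S i - 1) * p ^ 2 := by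
        intro i
        rw [Nat.cast_mul, Nat.cast_sub (Nat.one_le_pow _ _ (by omega))]
        push_cast
        ring
      simp_rw [this]
      rw [Finset.prod_mul_distrib, Finset.prod_const, Finset.card_range]
    have h5 : (((k - 1) * ∏ i ∈ Finset.range n, ((p ^ Ξ.S i - 1) * (p * p)) : ℕ) : ℝ) ≤
      cloverGrowth K p Ξ d := by exact_mod_cast h3
    refine le_trans ?_ h5
    rw [h4]
    have h6 : (d : ℝ) ≤ 8 * ((k - 1 : ℕ) * wt p Ξ n) := by exact_mod_cast hk4
    calc c / 8 * (p ^ 2) ^ n * d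
        ≤ c / 8 * (p ^ 2) ^ n * (8 * ((k - 1 : ℕ) * wt p Ξ n)) :=
          mul_le_mul_of_nonneg_left h6 (by positivity)
      _ = (k - 1 : ℕ) * ((p ^ 2) ^ n * (c * wt p Ξ n)) := by ring
      _ ≤ _ := by gcongr; exact hcw n
  have hup : (cloverGrowth K p Ξ d : ℝ) ≤ 7 * (p ^ 2) ^ 3 * (p ^ 2) ^ n * d := by
    -- `2 * d < 4 * wt (n + 1) ≤ 9 * wt (n + 1) ≤ wt (n + 3)`; the surplus levels only cost the
    -- constant `(p ^ 2) ^ 3`.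
    have h3 : 2 * d ≤ wt p Ξ (n + 3) := by
      have h4 := three_mul_wt_le (p := p) (Ξ := Ξ) (n + 1)
      have h5 := three_mul_wt_le (p := p) (Ξ := Ξ) (n + 2)
      change 3 * wt p Ξ (n + 1) ≤ wt p Ξ (n + 2) at h4
      change 3 * wt p Ξ (n + 2) ≤ wt p Ξ (n + 3) at h5
      omega
    have h6 : (cloverGrowth K p Ξ d : ℝ) ≤ ((7 * d * (p * p) ^ (n + 3) : ℕ) : ℝ) := by
      exact_mod_cast cloverGrowth_le hR h3
    refine h6.trans (le_of_eq ?_)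
    push_cast
    ring
  have hγ : (0 : ℝ) < cloverGrowth K p Ξ d := lt_of_lt_of_le (by positivity) hlow
  refine ⟨by exact_mod_cast hγ, ?_⟩
  rw [← le_div_iff₀ hd] at hlow
  rw [← div_le_iff₀ hd] at hup
  have h7 := Real.log_le_log (by positivity) hlow
  have h8 := Real.log_le_log (by positivity) hup
  rw [Real.log_mul (by positivity) (by positivity), Real.log_pow] at h7 h8
  rw [abs_le]
  constructor
  · have := le_max_left (-Real.log (c / 8)) (Real.log (7 * (p ^ 2) ^ 3))
    linarith
  · have := le_max_right (-Real.log (c / 8)) (Real.log (7 * (p ^ 2) ^ 3))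
    linarith

/-- The level `n` is eliminated between `ln (γ m / m) = n * ln (p ^ 2) + O(1)` and `ln^(q+1) m = ln
(p ^ 2) / κ * n + O(1)`. -/
theorem hasQuasiLinearGrowth (hR : ∀ n, Ξ.R n = 1) (hS : ∀ᶠ n in atTop, n ≤ Ξ.S n) {r : ℕ}
    {κ : ℝ} (hκ : 0 < κ) (hT : ∀ᶠ n : ℕ in atTop, ∑ i ∈ Finset.range (n + 1), Ξ.S i =
      ⌊iterExp (r + 1) (Real.log (p ^ 2) / κ * (n + 2))⌋₊ + 1) :
    HasQuasiLinearGrowth (r + 1) κ (cloverGrowth K p Ξ) := by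
  have hp1 : (1 : ℝ) < p ^ 2 := by
    exact_mod_cast Nat.one_lt_pow two_ne_zero (Fact.out : p.Prime).one_lt
  have hlp := Real.log_pos hp1
  obtain ⟨B, hB⟩ := exists_abs_log_cloverGrowth_le (K := K) (p := p) hR hS
  obtain ⟨D, hD⟩ := exists_abs_iterLog_sub_le (p := p) r (div_pos hlp hκ) hT
  obtain ⟨N, hN⟩ := eventually_atTop.1 hD
  refine ⟨B + κ * D, eventually_atTop.2 ⟨2 * wt p Ξ N, fun m hm => ?_⟩⟩
  obtain ⟨n, hn, h1, h2⟩ := exists_wt_le_lt hm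
  obtain ⟨h3, h4⟩ := hB n m h1 h2
  have h5 := hN n hn m h1 h2
  refine ⟨h3, ?_⟩
  have h6 : Real.log (cloverGrowth K p Ξ m / m) - κ * iterLog (r + 1 + 1) m =
      (Real.log (cloverGrowth K p Ξ m / m) - n * Real.log (p ^ 2)) -
        κ * (iterLog (r + 1 + 1) m - Real.log (p ^ 2) / κ * n) := by
    field_simp
    ring
  rw [h6]
  refine (abs_sub _ _).trans (add_le_add h4 ?_)
  rw [abs_mul, abs_of_pos hκ]
  exact mul_le_mul_of_nonneg_left h5 hκ.le

/-- A tuple with `R = 1` whose `S` has the partial sums `⌊exp^(q) (ln (p^2) / κ (n + 2))⌋ + 1`. -/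
theorem exists_tuple (p : ℕ) [Fact p.Prime] (q : ℕ) (κ : ℝ) : ∃ Ξ : CloverTuple, 1 ≤ q → 0 < κ →
    (∀ n, Ξ.R n = 1) ∧ (∀ᶠ n in atTop, n ≤ Ξ.S n) ∧
      ∀ᶠ n : ℕ in atTop, ∑ i ∈ Finset.range (n + 1), Ξ.S i =
        ⌊iterExp q (Real.log (p ^ 2) / κ * (n + 2))⌋₊ + 1 := by
  by_cases h : 1 ≤ q ∧ 0 < κ
  · obtain ⟨hq, hκ⟩ := h
    obtain ⟨r, rfl⟩ : ∃ r, q = r + 1 := ⟨q - 1, by omega⟩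
    have hp1 : (1 : ℝ) < p ^ 2 := by
      exact_mod_cast Nat.one_lt_pow two_ne_zero (Fact.out : p.Prime).one_lt
    obtain ⟨n₀, h0, hT⟩ := exists_floor_iterExp_add_le r (div_pos (Real.log_pos hp1) hκ)
    obtain ⟨S, hS, hsum, hge⟩ := exists_sum_range_eq
      (T := fun n => ⌊iterExp (r + 1) (Real.log (p ^ 2) / κ * (n + 2))⌋₊ + 1) h0 hT
    refine ⟨⟨S, fun _ => 1, hS, fun _ => one_pos⟩, fun _ _ => ⟨fun _ => rfl, ?_, ?_⟩⟩
    · refine eventually_atTop.2 ⟨n₀ + 1, fun n hn => ?_⟩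
      obtain ⟨k, rfl⟩ : ∃ k, n = k + 1 := ⟨n - 1, by omega⟩
      exact hge k (by omega)
    · exact eventually_atTop.2 ⟨n₀, hsum⟩
  -- An arbitrary tuple for irrelevant parameters, so that the choice is a total function of `q` and
  -- `κ`.
  · exact ⟨⟨fun _ => 1, fun _ => 1, fun _ => one_pos, fun _ => one_pos⟩,
      fun hq hκ => absurd ⟨hq, hκ⟩ h⟩

end Clover

/-- For a field of characteristic `p > 0` there are tuples `Ξ q κ`, `q ≥ 1`, `κ > 0`, whose clover
restricted Lie algebras have growth `m (ln^(q) m)^(κ + o(1))`, with the stated dimensions, and are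
pairwise non-isomorphic. -/
theorem theorem3p6 (K : Type*) [Field K] (p : ℕ) [Fact p.Prime] [CharP K p] :
    ∃ Ξ : ℕ → ℝ → CloverTuple,
      (∀ (q : ℕ) (κ : ℝ), 1 ≤ q → 0 < κ →
        (∀ n, (Ξ q κ).R n = 1) ∧
        (∀ᶠ n : ℕ in atTop, ∑ i ∈ Finset.range (n + 1), (Ξ q κ).S i =
          ⌊iterExp q (Real.log (p ^ 2) / κ * (n + 2))⌋₊ + 1) ∧
        (∃ ε : ℕ → ℝ, Tendsto ε atTop (𝓝 0) ∧ ∀ᶠ m : ℕ in atTop,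
          (cloverGrowth K p (Ξ q κ) m : ℝ) = m * iterLog q m ^ (κ + ε m)) ∧
        gkDim (cloverGrowth K p (Ξ q κ)) = 1 ∧
        lowerGKDim (cloverGrowth K p (Ξ q κ)) = 1 ∧
        lDim q (cloverGrowth K p (Ξ q κ)) = ENNReal.ofReal κ ∧
        lowerLDim q (cloverGrowth K p (Ξ q κ)) = ENNReal.ofReal κ ∧
        ¬ GrowthLE (fun n => cloverGrowth K p (Ξ q κ) n) (fun n => n)) ∧
      (∀ (q q' : ℕ) (κ κ' : ℝ), 1 ≤ q → 1 ≤ q' → 0 < κ → 0 < κ' → (q, κ) ≠ (q', κ') →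
        IsEmpty (CloverLie K p (Ξ q κ) ≃ₗ⁅K⁆ CloverLie K p (Ξ q' κ'))) := by

  choose Ξ hΞ using Clover.exists_tuple p
  have hg : ∀ q κ, 1 ≤ q → 0 < κ → HasQuasiLinearGrowth q κ (cloverGrowth K p (Ξ q κ)) := by
    intro q κ hq hκ
    obtain ⟨h1, h2, h3⟩ := hΞ q κ hq hκ
    obtain ⟨r, rfl⟩ : ∃ r, q = r + 1 := ⟨q - 1, by omega⟩
    exact Clover.hasQuasiLinearGrowth h1 h2 hκ h3
  refine ⟨Ξ, fun q κ hq hκ => ?_, fun q q' κ κ' hq hq' hκ hκ' hne => ⟨fun φ => hne ?_⟩⟩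
  · obtain ⟨h1, -, h3⟩ := hΞ q κ hq hκ
    have h := hg q κ hq hκ
    exact ⟨h1, h3, h.exists_eps, h.gkDim_eq hq, h.lowerGKDim_eq hq, h.lDim_eq hκ,
      h.lowerLDim_eq hκ, h.not_growthLE_linear hκ⟩
  · have h := hg q κ hq hκ
    have h' := hg q' κ' hq' hκ'
    -- The isomorphism and its inverse bound each growth function by a rescaling of the other, and
    -- the two comparisons force equal parameters.
    obtain ⟨C, hC, hle⟩ := Clover.cloverGrowth_le_of_lieEquiv (hΞ q' κ' hq' hκ').1 φ
    obtain ⟨C', hC', hle'⟩ := Clover.cloverGrowth_le_of_lieEquiv (hΞ q κ hq hκ).1 φ.symm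
    obtain ⟨a1, a2⟩ := h.le_and_le_of_le hκ h' hκ' hC hle
    obtain ⟨b1, b2⟩ := h'.le_and_le_of_le hκ' h hκ hC' hle'
    have hqq : q' = q := le_antisymm a1 b1
    exact Prod.ext hqq.symm (le_antisymm (a2 hqq) (b2 hqq.symm))
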